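/- Setting. Let $\Omega\subset\mathbb R^2$ be an open set with $\Omega=\operatorname{int}\overline\Omega$, and let $\kappa,\rho$ be measurable coefficients on $\Omega$ with positive lower and upper bounds. Let $\mathcal T_0^H$ be a finite conforming triangulation of $\Omega$ with set of edges $\mathcal E_p$, and let $\mathcal E_p^0$ be the set of those edges that do not lie in $\partial\Omega$. The coarse mesh $\mathcal T^H$ is obtained by joining the centroid of every triangle of $\mathcal T_0^H$ to its three vertices; $\mathcal T^h$ is a conforming refinement of $\mathcal T^H$, and $h$ is its mesh size (largest diameter of a triangle). On each interior edge let $[w\cdot n]$ be the sum of the outward normal components of $w$ from the two sides. Divergences are taken elementwise. Fine spaces. $V_h$ and $Q_h$ are the lowest order Raviart–Thomas velocity space and the space of piecewise constants on $\mathcal T^h$; $\widehat V_h\supset V_h$ is obtained by dropping the continuity of the normal component on the fine edges lying in $\mathcal E_p^0$. $\widetilde Q_h$ consists of the functions $q$ that vanish outside the fine triangles having an edge in $\mathcal E_p$, that on each such triangle $\tau$ are affine with $\int_\tau q=0$ and constant on the edge of $\tau$ lying in $\mathcal E_p$, and that are continuous across the fine edges lying in $\mathcal E_p^0$; $\widetilde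 Q_{h,0}$ is the subspace of those $q\in\widetilde Q_h$ that vanish on $\mathcal E_p\cap\partial\Omega$. Put $\|v\|_V^2=\int_\Omega\kappa|v|^2$, $(p,q)_Q=\int_\Omega\rho pq$ and $\|p\|_Q^2=(p,p)_Q$. Reference solution. Let $T>0$, let $f(t,\cdot)$ be integrable on $\Omega$ for each $t\in[0,T]$, and let $v_h(t)\in\widehat V_h$, $p_h(t)=p_h^{(I)}(t)+p_h^{(B)}(t)$ with $p_h^{(I)}(t)\in Q_h$, $p_h^{(B)}(t)\in\widetilde Q_{h,0}$, be differentiable in $t\in[0,T]$ and satisfy, for all such $t$, $$\int_\Omega\kappa\dot v_h\cdot w-\int_\Omega p_h^{(I)}\nabla\cdot w+\sum_{e}\int_e p_h^{(B)}[w\cdot n]=0\quad\forall w\in\widehat V_h,$$ $$\int_\Omega\rho\,\dot p_h\,q+\int_\Omega q^{(I)}\nabla\cdot v_h-\sum_e\int_e q^{(B)}[v_h\cdot n]=\int_\Omega f q\quad\forall q=q^{(I)}+q^{(B)},\ q^{(I)}\in Q_h,\ q^{(B)}\in\widetilde Q_{h,0},$$ the sums being over the fine edges lying in $\mathcal E_p^0$.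 Eigenfunctions on coarse elements. For $K\in\mathcal T^H$ let $V_h(K),Q_h(K)$ be the restrictions of $V_h,Q_h$ to $K$, let $V_{h,0}(K)$ be the fields of $V_h(K)$ with zero normal component on $\partial K$, and let $Q_h^0(K)=\{q\in Q_h(K):\int_K q=0\}$, of dimension $M_K$. Let $(\phi^{(3)}_{K,j},p^{(3)}_{K,j},\mu_{K,j})$, $1\le j\le M_K$, be a complete system of solutions $(\psi,p,\mu)\in V_{h,0}(K)\times Q_h^0(K)\times\mathbb R$ of $$\int_K\kappa\psi\cdot w-\int_K p\,\nabla\cdot w=0\ \ \forall w\in V_{h,0}(K),\qquad \int_K q\,\nabla\cdot\psi=\mu\int_K\rho pq\ \ \forall q\in Q_h^0(K),$$ with $\int_K\rho\, p^{(3)}_{K,i}p^{(3)}_{K,j}=\delta_{ij}$ and $\mu_{K,1}\le\mu_{K,2}\le\cdots$. Eigenfunctions on coarse edges. For $E\in\mathcal E_p^0$ fix a unit normal $n$, let $\omega_E$ be the union of the coarse elements having the edge $E$, and let $N_E+1$ be the number of fine edges in $E$. Let $V_{E,\mathrm{snap}}$ be the set of all fields $\psi$ supported in $\omega_E$ for which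 there is a function $\delta$ on $E$ with mean zero, constant on each fine edge, such that on each coarse $K\subset\omega_E$: $\psi\in V_h(K)$; for some $r\in Q_h(K)$, $\int_K\kappa\psi\cdot w-\int_K r\nabla\cdot w=0$ for all $w\in V_{h,0}(K)$; $\int_K q\nabla\cdot\psi=0$ for all $q\in Q_h(K)$; $\psi\cdot n=\delta$ on $E$; and the normal component of $\psi$ is $0$ on $\partial K\setminus E$. Let $(\phi^{(2)}_{E,j},\lambda_{E,j})$, $1\le j\le N_E$, be a complete system of solutions in $V_{E,\mathrm{snap}}\times\mathbb R$ of $$\int_E(\phi\cdot n)(w\cdot n)=\lambda\int_{\omega_E}\kappa\,\phi\cdot w\quad\forall w\in V_{E,\mathrm{snap}},$$ with $\int_E(\phi^{(2)}_{E,i}\cdot n)(\phi^{(2)}_{E,j}\cdot n)=\delta_{ij}$ and $\lambda_{E,1}\le\lambda_{E,2}\le\cdots$. Let $p_E^{(1)},p^{(2)}_{E,j}\in\widetilde Q_h$ be supported in the fine elements having an edge in $E$, with values $1$ and $\phi^{(2)}_{E,j}\cdot n$ on $E$. Interpolants. For $0\le m_K\le M_K$ and $0\le n_E\le N_E$ let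 $$\pi(p_h^{(I)})=\sum_{K\in\mathcal T^H}\Big(a_{K,0}\mathbf 1_K+\sum_{j=1}^{m_K}a_{K,j}\,p^{(3)}_{K,j}\Big),\qquad \pi(p_h^{(B)})=\sum_{E\in\mathcal E_p^0}\Big(b_{E,0}\,p_E^{(1)}+\sum_{j=1}^{n_E}b_{E,j}\,p^{(2)}_{E,j}\Big),$$ where $a_{K,0}$ is the average of $p_h^{(I)}$ on $K$, $a_{K,j}=\int_K\rho\,(p_h^{(I)}-a_{K,0})\,p^{(3)}_{K,j}$, $b_{E,0}$ is the average of $p_h^{(B)}$ on $E$, and $b_{E,j}=\int_E p_h^{(B)}\,\phi^{(2)}_{E,j}\cdot n$. Theorem. There is a constant $c>0$, which may depend on $\Omega,\kappa,\rho$ but not on the meshes, the eigenfunctions and their selected numbers $m_K,n_E$, $T$, $f$ or the solution, such that for every $t\in[0,T]$ $$\|p_h^{(I)}-\pi(p_h^{(I)})\|_Q^2\le\Big(\max_{K\in\mathcal T^H}\mu_{K,m_K+1}^{-1}\Big)\|\dot v_h\|_V^2,\qquad \|p_h^{(B)}-\pi(p_h^{(B)})\|_Q^2\le c\,h\Big(\max_{E\in\mathcal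 E_p^0}\lambda_{E,n_E+1}^{-1}\Big)\|\dot v_h\|_V^2,$$ where $\mu_{K,M_K+1}^{-1}$ and $\lambda_{E,N_E+1}^{-1}$ are read as $0$, and a maximum over the empty set is $0$. -/

import Mathlib

open MeasureTheory Set

noncomputable section

namespace MGMsFEM

/-- The Euclidean plane. -/
abbrev Plane : Type := EuclideanSpace ℝ (Fin 2)

/-- The closed simplex (triangle or edge) spanned by a finite set of vertices. -/
def hull (s : Finset Plane) : Set Plane := convexHull ℝ (s : Set Plane)

/-! ### Lowest order shape functions on one triangle -/

/-- Coefficients `(a, b)` of the lowest order Raviart-Thomas field `x ↦ a + b x`. -/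
abbrev RT0 : Type := Plane × ℝ

/-- The Raviart-Thomas field with coefficients `(a, b)`. -/
def RT0.eval (c : RT0) (x : Plane) : Plane := c.1 + c.2 • x

/-- Coefficients `(c, g)` of the affine function `x ↦ c + g · x`. -/
abbrev P1 : Type := ℝ × Plane

/-- The affine function with coefficients `(c, g)`. -/
def P1.eval (c : P1) (x : Plane) : ℝ := c.1 + inner ℝ c.2 x

/-- The divergence of a planar vector field. -/
def divergence (u : Plane → Plane) (x : Plane) : ℝ :=
  ∑ i : Fin 2, (fderiv ℝ u x (EuclideanSpace.single i 1)) i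

theorem divergence_eval (c : RT0) (x : Plane) : divergence (RT0.eval c) x = 2 * c.2 := by
  have h : HasFDerivAt (RT0.eval c) (c.2 • ContinuousLinearMap.id ℝ Plane) x :=
    ((hasFDerivAt_id x).const_smul c.2).const_add c.1
  simp [divergence, h.fderiv]

/-- The unit normal of the edge `e` of the triangle `τ` that points out of `τ`: the component
orthogonal to `e` of the vector from the centroid of `τ` to the midpoint of `e`, normalized. -/
def outwardNormal (τ e : Finset Plane) : Plane :=
  let u := (vectorSpan ℝ (e : Set Plane))ᗮ.starProjection
    (e.centroid ℝ id - τ.centroid ℝ id)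
  ‖u‖⁻¹ • u

/-! ### Meshes -/

/-- A (finite, conforming) triangulation of the planar domain `Ω`. -/
structure Mesh (Ω : Set Plane) where
  complex : Geometry.SimplicialComplex ℝ Plane
  finite : complex.faces.Finite
  pure : ∀ s ∈ complex.faces, ∃ t ∈ complex.faces, s ⊆ t ∧ t.card = 3
  space_eq : complex.space = closure Ω

namespace Mesh

variable {Ω : Set Plane}

open Classical in
/-- The triangles of a mesh, as sets of three vertices. -/
def tri (T : Mesh Ω) : Finset (Finset Plane) := T.finite.toFinset.filter (fun s => s.card = 3)

open Classical in
/-- The edges of a mesh, as sets of two vertices. -/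
def edges (T : Mesh Ω) : Finset (Finset Plane) := T.finite.toFinset.filter (fun s => s.card = 2)

/-- The mesh size: the largest diameter of a triangle. -/
def size (T : Mesh Ω) : ℝ := ⨆ τ : T.tri, Metric.diam (hull τ.1)

open Classical in
/-- The triangles obtained by joining the centroid of every triangle to its three vertices. -/
def centroidRefinement (T : Mesh Ω) : Finset (Finset Plane) :=
  T.tri.biUnion (fun t => (t.powersetCard 2).image (fun E => insert (t.centroid ℝ id) E))

end Mesh

/-- The initial coarse mesh `T0` and the fine mesh `Th`. The coarse mesh is the centroid refinement
of `T0`, and `Th` is a conforming refinement of the coarse mesh. -/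
structure TwoLevelMesh (Ω : Set Plane) where
  T0 : Mesh Ω
  Th : Mesh Ω
  refines : ∀ τ ∈ Th.tri, ∃ K ∈ T0.centroidRefinement, hull τ ⊆ hull K

namespace TwoLevelMesh

variable {Ω : Set Plane} (M : TwoLevelMesh Ω)

/-- The coarse elements. -/
def coarse : Finset (Finset Plane) := M.T0.centroidRefinement

/-- The edges of the initial triangulation. -/
def Ep : Finset (Finset Plane) := M.T0.edges

open Classical in
/-- The edges of the initial triangulation that do not lie in the boundary of the domain. -/
def Ep0 : Finset (Finset Plane) := M.Ep.filter (fun E => ¬ hull E ⊆ frontier Ω)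

/-- The fine elements, as an index type. -/
abbrev Cell : Type := M.Th.tri

open Classical in
/-- The fine elements contained in `K`. -/
def cells (K : Finset Plane) : Finset M.Cell := Finset.univ.filter (fun τ => hull τ.1 ⊆ hull K)

open Classical in
/-- The fine elements in `ω_E`, the union of the coarse elements that have the edge `E`. -/
def patch (E : Finset Plane) : Finset M.Cell :=
  Finset.univ.filter (fun τ => ∃ K ∈ M.coarse, E ⊆ K ∧ hull τ.1 ⊆ hull K)

open Classical in
/-- The fine elements that have the fine edge `e`. -/
def cellsAt (e : Finset Plane) : Finset M.Cell := Finset.univ.filter (fun τ => e ⊆ τ.1)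

open Classical in
/-- The fine edges lying in `E`. -/
def fineOn (E : Finset Plane) : Finset (Finset Plane) :=
  M.Th.edges.filter (fun e => hull e ⊆ hull E)

open Classical in
/-- The fine edges lying in `E_p`. -/
def fineEp : Finset (Finset Plane) := M.Th.edges.filter (fun e => ∃ E ∈ M.Ep, e ∈ M.fineOn E)

open Classical in
/-- The fine edges lying in `E_p^0`. -/
def fineEp0 : Finset (Finset Plane) := M.Th.edges.filter (fun e => ∃ E ∈ M.Ep0, e ∈ M.fineOn E)

/-! ### Broken fields, integrals and forms -/

/-- Piecewise Raviart-Thomas fields without any continuity. -/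
abbrev BrokenRT : Type := M.Cell → RT0

/-- Piecewise affine functions without any continuity. -/
abbrev BrokenP1 : Type := M.Cell → P1

/-- The integral, over the union of the fine elements in `S`, of a piecewise given function. -/
def intCells (S : Finset M.Cell) (F : M.Cell → Plane → ℝ) : ℝ :=
  ∑ τ ∈ S, ∫ x in hull τ.1, F τ x

/-- `∫ κ v · w` over the elements in `S`. -/
def kappaForm (S : Finset M.Cell) (κ : Plane → ℝ) (v w : M.BrokenRT) : ℝ :=
  M.intCells S (fun τ x => κ x * inner ℝ ((v τ).eval x) ((w τ).eval x))

/-- `∫ ρ p q` over the elements in `S`. -/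
def rhoForm (S : Finset M.Cell) (ρ : Plane → ℝ) (p q : M.BrokenP1) : ℝ :=
  M.intCells S (fun τ x => ρ x * ((p τ).eval x * (q τ).eval x))

/-- `∫ q ∇ · w` over the elements in `S`, with the elementwise divergence. -/
def divForm (S : Finset M.Cell) (q : M.BrokenP1) (w : M.BrokenRT) : ℝ :=
  M.intCells S (fun τ x => (q τ).eval x * divergence (w τ).eval x)

/-- `‖v‖_V²`. -/
def normVsq (κ : Plane → ℝ) (v : M.BrokenRT) : ℝ := M.kappaForm Finset.univ κ v v

/-- `‖p‖_Q²`. -/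
def normQsq (ρ : Plane → ℝ) (p : M.BrokenP1) : ℝ := M.rhoForm Finset.univ ρ p p

/-- The integral of a function with respect to arc length over an edge. -/
def edgeInt (e : Finset Plane) (g : Plane → ℝ) : ℝ := ∫ x in hull e, g x ∂(μH[1])

/-- The integral over an edge `E` of a function given on the fine edges lying in `E`. -/
def coarseEdgeInt (E : Finset Plane) (g : Finset Plane → Plane → ℝ) : ℝ :=
  ∑ e ∈ M.fineOn E, edgeInt e (g e)

/-- The jump `[w · n]` at a point of the fine edge `e`: the sum of the outward normal components
over the fine elements that have the edge `e`. -/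
def jump (w : M.BrokenRT) (e : Finset Plane) (x : Plane) : ℝ :=
  ∑ τ ∈ M.cellsAt e, inner ℝ ((w τ).eval x) (outwardNormal τ.1 e)

/-- The trace of `q` on the fine edge `e`: the mean of the traces from the elements that have the
edge `e`, hence their common value where `q` is continuous across `e`. -/
def trace (q : M.BrokenP1) (e : Finset Plane) (x : Plane) : ℝ :=
  ((M.cellsAt e).card : ℝ)⁻¹ * ∑ τ ∈ M.cellsAt e, (q τ).eval x

/-- The normal component `w · n` on the fine edge `e`: the mean of the values from the elements
that have the edge `e`, hence their common value where `w · n` is single valued on `e`. -/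
def normalTrace (n : Plane) (w : M.BrokenRT) (e : Finset Plane) (x : Plane) : ℝ :=
  ((M.cellsAt e).card : ℝ)⁻¹ * ∑ τ ∈ M.cellsAt e, inner ℝ ((w τ).eval x) n

/-! ### Fine scale spaces -/

/-- The Raviart-Thomas velocity space on the fine mesh. -/
def Vh : Set M.BrokenRT :=
  {w | ∀ e ∈ M.Th.edges, ¬ hull e ⊆ frontier Ω → ∀ x ∈ hull e, M.jump w e x = 0}

/-- The velocity space decoupled on the fine edges lying in `E_p^0`. -/
def VhHat : Set M.BrokenRT :=
  {w | ∀ e ∈ M.Th.edges, ¬ hull e ⊆ frontier Ω → e ∉ M.fineEp0 → ∀ x ∈ hull e, M.jump w e x = 0}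

/-- The piecewise constant functions on the fine mesh. -/
def Qh : Set M.BrokenP1 := {q | ∀ τ, (q τ).2 = 0}

/-- The additional pressure space, supported in the fine elements that have an edge in `E_p`. -/
def QhTilde : Set M.BrokenP1 :=
  {q | (∀ τ : M.Cell, (∀ e ∈ M.fineEp, ¬ e ⊆ τ.1) → q τ = 0) ∧
    (∀ τ : M.Cell, ∀ e ∈ M.fineEp, e ⊆ τ.1 →
      ∀ x ∈ hull e, ∀ y ∈ hull e, (q τ).eval x = (q τ).eval y) ∧
    (∀ τ : M.Cell, ∫ x in hull τ.1, (q τ).eval x = 0) ∧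
    (∀ e ∈ M.fineEp0, ∀ τ ∈ M.cellsAt e, ∀ τ' ∈ M.cellsAt e,
      ∀ x ∈ hull e, (q τ).eval x = (q τ').eval x)}

/-- The functions of the additional pressure space that vanish on `E_p ∩ ∂Ω`. -/
def QhTilde0 : Set M.BrokenP1 :=
  {q | q ∈ M.QhTilde ∧ ∀ e ∈ M.fineEp, hull e ⊆ frontier Ω →
    ∀ τ ∈ M.cellsAt e, ∀ x ∈ hull e, (q τ).eval x = 0}

open Classical in
/-- The restriction to `K`, extended by zero. -/
def restr {α : Type} [Zero α] (K : Finset Plane) (w : M.Cell → α) : M.Cell → α :=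
  fun τ => if τ ∈ M.cells K then w τ else 0

/-- `V_h(K)`, with its elements extended by zero. -/
def VhLoc (K : Finset Plane) : Set M.BrokenRT := M.restr K '' M.Vh

/-- `Q_h(K)`, with its elements extended by zero. -/
def QhLoc (K : Finset Plane) : Set M.BrokenP1 := M.restr K '' M.Qh

/-- `V_{h,0}(K)`: the fields of `V_h(K)` whose normal component vanishes on `∂K`. -/
def VhLoc0 (K : Finset Plane) : Set M.BrokenRT :=
  {w | w ∈ M.VhLoc K ∧ ∀ τ ∈ M.cells K, ∀ e ∈ M.Th.edges, e ⊆ τ.1 → hull e ⊆ frontier (hull K) →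
    ∀ x ∈ hull e, inner ℝ ((w τ).eval x) (outwardNormal τ.1 e) = 0}

/-! ### Spectral problem on a coarse element -/

/-- `Q_h(K)` subject to the zero mean condition. -/
def QhLocMeanZero (K : Finset Plane) : Set M.BrokenP1 :=
  {q | q ∈ M.QhLoc K ∧ M.intCells (M.cells K) (fun τ x => (q τ).eval x) = 0}

/-- `M_K = dim Q_h(K) - 1`. -/
def numInt (K : Finset Plane) : ℕ := (M.cells K).card - 1

/-- A complete system of eigenpairs of the spectral problem on the coarse element `K`, normalized
by `∫_K ρ p_i p_j = δ_ij` and ordered by increasing eigenvalues. -/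
structure ElementBasis (κ ρ : Plane → ℝ) (K : Finset Plane) where
  φ : Fin (M.numInt K) → M.BrokenRT
  p : Fin (M.numInt K) → M.BrokenP1
  μ : Fin (M.numInt K) → ℝ
  φ_mem : ∀ j, φ j ∈ M.VhLoc0 K
  p_mem : ∀ j, p j ∈ M.QhLocMeanZero K
  eq_velocity : ∀ j, ∀ w ∈ M.VhLoc0 K,
    M.kappaForm (M.cells K) κ (φ j) w - M.divForm (M.cells K) (p j) w = 0
  eq_pressure : ∀ j, ∀ q ∈ M.QhLocMeanZero K,
    M.divForm (M.cells K) q (φ j) = μ j * M.rhoForm (M.cells K) ρ (p j) q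
  orthonormal : ∀ i j, M.rhoForm (M.cells K) ρ (p i) (p j) = if i = j then 1 else 0
  ordered : Monotone μ

/-! ### Spectral problem on a coarse edge -/

/-- The snapshot space of the edge `E` with unit normal `n`: the fields supported in `ω_E` that, for
some function `δ` of mean zero on `E`, constant on every fine edge in `E`, solve the divergence
free local problem on every coarse element having the edge `E`, with normal component `δ` on `E`
and `0` on the rest of the boundary of the coarse element. -/
def Vsnap (κ : Plane → ℝ) (E : Finset Plane) (n : Plane) : Set M.BrokenRT :=
  {φ | (∀ τ, τ ∉ M.patch E → φ τ = 0) ∧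
    ∃ δ : Finset Plane → ℝ, M.coarseEdgeInt E (fun e _ => δ e) = 0 ∧
      ∀ K ∈ M.coarse, E ⊆ K →
        M.restr K φ ∈ M.VhLoc K ∧
        (∃ q ∈ M.QhLoc K, ∀ w ∈ M.VhLoc0 K,
          M.kappaForm (M.cells K) κ φ w - M.divForm (M.cells K) q w = 0) ∧
        (∀ q ∈ M.QhLoc K, M.divForm (M.cells K) q φ = 0) ∧
        (∀ τ ∈ M.cells K, ∀ e ∈ M.fineOn E, e ⊆ τ.1 →
          ∀ x ∈ hull e, inner ℝ ((φ τ).eval x) n = δ e) ∧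
        (∀ τ ∈ M.cells K, ∀ e ∈ M.Th.edges, e ⊆ τ.1 → hull e ⊆ frontier (hull K) →
          e ∉ M.fineOn E → ∀ x ∈ hull e, inner ℝ ((φ τ).eval x) (outwardNormal τ.1 e) = 0)}

/-- `q` is the function of the additional pressure space that is supported in the fine elements
having an edge in `E` and has the boundary values `g` on `E`. -/
def IsEdgePressure (E : Finset Plane) (q : M.BrokenP1) (g : M.Cell → Plane → ℝ) : Prop :=
  q ∈ M.QhTilde ∧ (∀ τ : M.Cell, (∀ e ∈ M.fineOn E, ¬ e ⊆ τ.1) → q τ = 0) ∧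
    ∀ e ∈ M.fineOn E, ∀ τ ∈ M.cellsAt e, ∀ x ∈ hull e, (q τ).eval x = g τ x

/-- `N_E`, the dimension of the piecewise constant functions of mean zero on `E`. -/
def numEdge (E : Finset Plane) : ℕ := (M.fineOn E).card - 1

/-- A unit normal on the edge `E`, a complete system of eigenfunctions of the spectral problem on
`E`, normalized by `∫_E (φ_i · n) (φ_j · n) = δ_ij` and ordered by increasing eigenvalues, and the
associated edge pressure functions `p1`, with value `1` on `E`, and `p2 j`, with value `φ_j · n`. -/
structure EdgeBasis (κ : Plane → ℝ) (E : Finset Plane) where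
  n : Plane
  norm_n : ‖n‖ = 1
  n_orthogonal : ∀ a ∈ E, ∀ b ∈ E, inner ℝ (b - a) n = 0
  φ : Fin (M.numEdge E) → M.BrokenRT
  ev : Fin (M.numEdge E) → ℝ
  φ_mem : ∀ j, φ j ∈ M.Vsnap κ E n
  eq_spectral : ∀ j, ∀ w ∈ M.Vsnap κ E n,
    M.coarseEdgeInt E (fun e x => M.normalTrace n (φ j) e x * M.normalTrace n w e x) =
      ev j * M.kappaForm (M.patch E) κ (φ j) w
  orthonormal : ∀ i j,
    M.coarseEdgeInt E (fun e x => M.normalTrace n (φ i) e x * M.normalTrace n (φ j) e x) =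
      if i = j then 1 else 0
  ordered : Monotone ev
  p1 : M.BrokenP1
  p1_spec : M.IsEdgePressure E p1 (fun _ _ => 1)
  p2 : Fin (M.numEdge E) → M.BrokenP1
  p2_spec : ∀ j, M.IsEdgePressure E (p2 j) (fun τ x => inner ℝ ((φ j τ).eval x) n)

/-- The multiscale bases on all coarse elements and on all edges in `E_p^0`. -/
structure MultiscaleBasis (κ ρ : Plane → ℝ) where
  elt : ∀ K : M.coarse, M.ElementBasis κ ρ K.1
  edge : ∀ E : M.Ep0, M.EdgeBasis κ E.1

/-- The numbers `m_K ≤ M_K` and `n_E ≤ N_E` of selected eigenfunctions. -/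
structure Selection where
  m : M.coarse → ℕ
  m_le : ∀ K, m K ≤ M.numInt K.1
  n : M.Ep0 → ℕ
  n_le : ∀ E, n E ≤ M.numEdge E.1

/-- With eigenvalues numbered from one, `λ_{m+1}⁻¹`, or `0` if all eigenfunctions are selected. -/
def nextInv {N : ℕ} (ev : Fin N → ℝ) (m : ℕ) : ℝ := if h : m < N then (ev ⟨m, h⟩)⁻¹ else 0

/-! ### The interpolants -/

section Interpolants

variable {M} {κ ρ : Plane → ℝ}

/-- `a_{K,0}`, the average of `q` on `K`. -/
def coeffA0 (K : M.coarse) (q : M.BrokenP1) : ℝ :=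
  M.intCells (M.cells K.1) (fun τ x => (q τ).eval x) / M.intCells (M.cells K.1) (fun _ _ => 1)

/-- The function with the constant value `a` on `K`, and zero elsewhere. -/
def constOn (K : M.coarse) (a : ℝ) : M.BrokenP1 := M.restr K.1 (fun _ => (a, 0))

/-- `a_{K,j}`, the coefficient of `q - a_{K,0}` with respect to the `j`-th eigenfunction. -/
def coeffA (B : M.MultiscaleBasis κ ρ) (K : M.coarse) (q : M.BrokenP1)
    (j : Fin (M.numInt K.1)) : ℝ :=
  M.rhoForm (M.cells K.1) ρ (q - constOn K (coeffA0 K q)) ((B.elt K).p j)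

/-- The interpolant of the component in `Q_h`. -/
def piI (B : M.MultiscaleBasis κ ρ) (s : M.Selection) (q : M.BrokenP1) : M.BrokenP1 :=
  ∑ K : M.coarse, (constOn K (coeffA0 K q) +
    ∑ j : Fin (M.numInt K.1), if (j : ℕ) < s.m K then coeffA B K q j • (B.elt K).p j else 0)

/-- `b_{E,0}`, the average of `q` on `E`. -/
def coeffB0 (E : M.Ep0) (q : M.BrokenP1) : ℝ :=
  M.coarseEdgeInt E.1 (M.trace q) / M.coarseEdgeInt E.1 (fun _ _ => 1)

/-- `b_{E,j} = ∫_E q φ_{E,j} · n`. -/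
def coeffB (B : M.MultiscaleBasis κ ρ) (E : M.Ep0) (q : M.BrokenP1)
    (j : Fin (M.numEdge E.1)) : ℝ :=
  M.coarseEdgeInt E.1
    (fun e x => M.trace q e x * M.normalTrace (B.edge E).n ((B.edge E).φ j) e x)

/-- The interpolant of the component in the additional pressure space. -/
def piB (B : M.MultiscaleBasis κ ρ) (s : M.Selection) (q : M.BrokenP1) : M.BrokenP1 :=
  ∑ E : M.Ep0, (coeffB0 E q • (B.edge E).p1 +
    ∑ j : Fin (M.numEdge E.1), if (j : ℕ) < s.n E then coeffB B E q j • (B.edge E).p2 j else 0)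

end Interpolants

/-! ### The reference solution -/

/-- `(v, pI + pB)` is a solution on `[0, T]` of the semidiscrete scheme on the fine mesh, with
pressure components `pI` in `Q_h` and `pB` in the additional space, and with time derivatives
`v'`, `pI'` and `pB'`. -/
structure IsReferenceSolution (κ ρ : Plane → ℝ) (T : ℝ) (f : ℝ → Plane → ℝ)
    (v v' : ℝ → M.BrokenRT) (pI pI' pB pB' : ℝ → M.BrokenP1) : Prop where
  v_mem : ∀ t ∈ Icc 0 T, v t ∈ M.VhHat
  pI_mem : ∀ t ∈ Icc 0 T, pI t ∈ M.Qh
  pB_mem : ∀ t ∈ Icc 0 T, pB t ∈ M.QhTilde0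
  v_deriv : ∀ t ∈ Icc 0 T, HasDerivWithinAt v (v' t) (Icc 0 T) t
  pI_deriv : ∀ t ∈ Icc 0 T, HasDerivWithinAt pI (pI' t) (Icc 0 T) t
  pB_deriv : ∀ t ∈ Icc 0 T, HasDerivWithinAt pB (pB' t) (Icc 0 T) t
  eq_velocity : ∀ t ∈ Icc 0 T, ∀ w ∈ M.VhHat,
    M.kappaForm Finset.univ κ (v' t) w - M.divForm Finset.univ (pI t) w
      + ∑ e ∈ M.fineEp0, edgeInt e (fun x => M.trace (pB t) e x * M.jump w e x) = 0
  eq_pressure : ∀ t ∈ Icc 0 T, ∀ qI ∈ M.Qh, ∀ qB ∈ M.QhTilde0,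
    M.rhoForm Finset.univ ρ (pI' t + pB' t) (qI + qB) + M.divForm Finset.univ qI (v t)
      - ∑ e ∈ M.fineEp0, edgeInt e (fun x => M.trace qB e x * M.jump (v t) e x) =
    M.intCells Finset.univ (fun τ x => f t x * ((qI + qB) τ).eval x)

end TwoLevelMesh

/-- A measurable coefficient on `Ω` with positive lower and upper bounds. -/
def IsCoefficient (Ω : Set Plane) (κ : Plane → ℝ) : Prop :=
  AEMeasurable κ (volume.restrict Ω) ∧
    ∃ a b : ℝ, 0 < a ∧ ∀ᵐ x ∂(volume.restrict Ω), a ≤ κ x ∧ κ x ≤ b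

end MGMsFEM

end

/-! Both estimates are duality arguments at a fixed time, and only the velocity equation enters,
through test fields localized to one coarse element K.

Component in Q_h. A field of V_{h,0}(K) extended by zero has no jumps, so testing with it turns ∫_K
p^I ∇·w into ∫_K κ v'·w. For w = μ_j⁻¹ φ_j the eigenvalue equations identify the result with the
coefficient a_j; the average of p^I drops out because ∇·φ_j has mean zero. The eigenfunctions φ_j
are κ-orthogonal with energy μ_j. Hence, with S the sum of the discarded a_j², there is a field w
with ∫_K κ v'·w = S and energy at most S / μ_{m+1}, and Cauchy–Schwarz gives S ≤ μ_{m+1}⁻¹ ‖v'‖². A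
count of dimensions shows that the eigenfunctions are complete, so S is exactly the squared error on
K. Positivity of μ_j rests on the fact that the fine triangles of K are connected through common
edges. See `sum_tail_sq_le`, `orthonormal_complete`, `ElementBasis.μ_pos` and
`ElementBasis.estimate`.

Component in the additional space. The decoupled velocity space admits the restriction of φ_{E,j} to
a single coarse element K at E. It is divergence free, which removes p^I, and its jump on E is ± its
normal component, so the test yields ± b_{E,j} (`IsReferenceSolution.local_edge`). The energy on K
is at most the energy on ω_E, where the φ_{E,j} are orthogonal with energy λ_j⁻¹, and the same
duality bounds the discarded b_{E,j}². The sum of these squares is the squared L² norm of the error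
on E. To pass to Ω: on a fine triangle with edge e the error takes the values g, g, -2g at the
vertices, and the area is at most |e| h / 2; this produces the factor h
(`CoeffBounds.setIntegral_sq_le`).

Every coarse element has exactly one edge in E_p, and each fine edge on it belongs to exactly one
fine triangle of K. The local bounds therefore add up over K without an overlap constant. These
geometric facts are derived from the axioms of a simplicial complex by means of signed areas. -/

noncomputable section

namespace MGMsFEM

section

/-! ### Plane triangles -/

/-- The determinant of two plane vectors. -/
def cross (u v : Plane) : ℝ := u 0 * v 1 - u 1 * v 0

/-- Twice the signed area of the triangle with vertices `p`, `q`, `r`. -/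
def orient (p q r : Plane) : ℝ := cross (q - p) (r - p)

/-- The rotation by a right angle, clockwise. -/
def rot (u : Plane) : Plane := !₂[u 1, -u 0]

@[simp] theorem rot_zero (u : Plane) : rot u 0 = u 1 := rfl
@[simp] theorem rot_one (u : Plane) : rot u 1 = -u 0 := rfl

theorem inner_plane (u v : Plane) : inner ℝ u v = u 0 * v 0 + u 1 * v 1 := by
  simp [PiLp.inner_apply, Fin.sum_univ_two, mul_comm]

theorem plane_ext {u v : Plane} (h0 : u 0 = v 0) (h1 : u 1 = v 1) : u = v := by
  ext i; fin_cases i <;> assumption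

theorem orient_def (p q r : Plane) :
    orient p q r = (q 0 - p 0) * (r 1 - p 1) - (q 1 - p 1) * (r 0 - p 0) := by
  simp [orient, cross]

theorem orient_rotate (p q r : Plane) : orient q r p = orient p q r := by
  simp only [orient_def]; ring

theorem orient_swap (p q r : Plane) : orient q p r = -orient p q r := by
  simp only [orient_def]; ring

theorem orient_self_left (p q : Plane) : orient p q p = 0 := by
  simp only [orient_def]; ring

theorem orient_self_right (p q : Plane) : orient p q q = 0 := by
  simp only [orient_def]; ring

theorem orient_comb (p q x y z : Plane) {α β γ : ℝ} (h : α + β + γ = 1) :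
    orient p q (α • x + β • y + γ • z) = α * orient p q x + β * orient p q y + γ * orient p q z := by
  obtain rfl : α = 1 - β - γ := by linarith
  simp [orient_def]; ring

theorem orient_comb_two (p q x y : Plane) {α β : ℝ} (h : α + β = 1) :
    orient p q (α • x + β • y) = α * orient p q x + β * orient p q y := by
  obtain rfl : α = 1 - β := by linarith
  simp [orient_def]; ring

/-- Cramer's rule: the barycentric coordinates are quotients of signed areas. All later statements
about the position of a point in a triangle use these quotients. -/
theorem barycentric {p q r : Plane} (h : orient p q r ≠ 0) (x : Plane) :
    x = (orient q r x / orient p q r) • p + (orient r p x / orient p q r) • q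
      + (orient p q x / orient p q r) • r := by
  refine plane_ext ?_ ?_ <;> simp <;> field_simp <;> simp only [orient_def] <;> ring

theorem barycentric_sum {p q r : Plane} (h : orient p q r ≠ 0) (x : Plane) :
    orient q r x / orient p q r + orient r p x / orient p q r + orient p q x / orient p q r = 1 := by
  field_simp; simp only [orient_def]; ring

theorem mem_hull_pair {a b x : Plane} :
    x ∈ hull {a, b} ↔ ∃ α β : ℝ, 0 ≤ α ∧ 0 ≤ β ∧ α + β = 1 ∧ x = α • a + β • b := by
  simp only [hull, Finset.coe_insert, Finset.coe_singleton, convexHull_pair, segment, mem_ofPred_eq]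
  constructor
  · rintro ⟨α, β, h1, h2, h3, h4⟩; exact ⟨α, β, h1, h2, h3, h4.symm⟩
  · rintro ⟨α, β, h1, h2, h3, h4⟩; exact ⟨α, β, h1, h2, h3, h4.symm⟩

theorem mem_hull_triple {p q r x : Plane} : x ∈ hull {p, q, r} ↔
    ∃ α β γ : ℝ, 0 ≤ α ∧ 0 ≤ β ∧ 0 ≤ γ ∧ α + β + γ = 1 ∧ x = α • p + β • q + γ • r := by
  constructor
  · intro hx
    have hc : Convex ℝ {x : Plane | ∃ α β γ : ℝ, 0 ≤ α ∧ 0 ≤ β ∧ 0 ≤ γ ∧ α + β + γ = 1 ∧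
        x = α • p + β • q + γ • r} := by
      rintro x ⟨α, β, γ, h1, h2, h3, h4, rfl⟩ y ⟨α', β', γ', h1', h2', h3', h4', rfl⟩ s t hs ht hst
      refine ⟨s * α + t * α', s * β + t * β', s * γ + t * γ', by positivity, by positivity,
        by positivity, ?_, ?_⟩
      · linear_combination s * h4 + t * h4' + hst
      · module
    refine convexHull_min ?_ hc hx
    intro y hy
    simp only [Finset.coe_insert, Finset.coe_singleton, mem_insert_iff, mem_singleton_iff] at hy
    rcases hy with rfl | rfl | rfl
    · exact ⟨1, 0, 0, by norm_num, le_rfl, le_rfl, by norm_num, by simp⟩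
    · exact ⟨0, 1, 0, le_rfl, by norm_num, le_rfl, by norm_num, by simp⟩
    · exact ⟨0, 0, 1, le_rfl, le_rfl, by norm_num, by norm_num, by simp⟩
  · rintro ⟨α, β, γ, h1, h2, h3, h4, rfl⟩
    have := (convex_convexHull ℝ (({p, q, r} : Finset Plane) : Set Plane)).sum_mem
      (t := Finset.univ) (w := ![α, β, γ]) (z := ![p, q, r])
      (by intro i _; fin_cases i <;> simpa) (by simpa [Fin.sum_univ_three] using h4)
      (by intro i _; apply subset_convexHull; fin_cases i <;> simp)
    simpa [hull, Fin.sum_univ_three] using this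

theorem hull_mono {s t : Finset Plane} (h : s ⊆ t) : hull s ⊆ hull t :=
  convexHull_mono (by exact_mod_cast h)

theorem mem_hull_of_mem {s : Finset Plane} {x : Plane} (h : x ∈ s) : x ∈ hull s :=
  subset_convexHull ℝ _ h

theorem convex_hull (s : Finset Plane) : Convex ℝ (hull s) := convex_convexHull ℝ _

theorem isCompact_hull (s : Finset Plane) : IsCompact (hull s) :=
  s.finite_toSet.isCompact_convexHull ℝ

theorem isClosed_hull (s : Finset Plane) : IsClosed (hull s) := (isCompact_hull s).isClosed

theorem continuous_orient (p q : Plane) : Continuous (fun x => orient p q x) := by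
  simp only [orient_def]; fun_prop

theorem mem_hull_of_orient {p q r x : Plane} (h : orient p q r ≠ 0)
    (h1 : 0 ≤ orient q r x / orient p q r) (h2 : 0 ≤ orient r p x / orient p q r)
    (h3 : 0 ≤ orient p q x / orient p q r) : x ∈ hull {p, q, r} :=
  mem_hull_triple.2 ⟨_, _, _, h1, h2, h3, barycentric_sum h x, barycentric h x⟩

theorem mem_interior_hull {p q r x : Plane} (h : orient p q r ≠ 0)
    (h1 : 0 < orient q r x / orient p q r) (h2 : 0 < orient r p x / orient p q r)
    (h3 : 0 < orient p q x / orient p q r) : x ∈ interior (hull {p, q, r}) := by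
  refine mem_interior.2 ⟨{x | 0 < orient q r x / orient p q r} ∩ {x | 0 < orient r p x / orient p q r}
    ∩ {x | 0 < orient p q x / orient p q r}, ?_, ?_, ⟨⟨h1, h2⟩, h3⟩⟩
  · rintro y ⟨⟨h1, h2⟩, h3⟩
    exact mem_hull_of_orient h (le_of_lt h1) (le_of_lt h2) (le_of_lt h3)
  · exact ((isOpen_lt continuous_const ((continuous_orient _ _).div_const _)).inter
      (isOpen_lt continuous_const ((continuous_orient _ _).div_const _))).inter
      (isOpen_lt continuous_const ((continuous_orient _ _).div_const _))

theorem orient_nonneg_of_mem {p q r x : Plane} (h : orient p q r ≠ 0) (hx : x ∈ hull {p, q, r}) :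
    0 ≤ orient p q x / orient p q r := by
  obtain ⟨α, β, γ, h1, h2, h3, h4, rfl⟩ := mem_hull_triple.1 hx
  rw [orient_comb _ _ _ _ _ h4, orient_self_left, orient_self_right, mul_zero, mul_zero, zero_add,
    zero_add, mul_div_cancel_right₀ _ h]
  exact h3

theorem hull_triple_interior_nonempty {p q r : Plane} (h : orient p q r ≠ 0) :
    (interior (hull {p, q, r})).Nonempty := by
  refine ⟨(1/3 : ℝ) • p + (1/3 : ℝ) • q + (1/3 : ℝ) • r, mem_interior_hull h ?_ ?_ ?_⟩
  · rw [orient_comb _ _ _ _ _ (by norm_num), orient_self_left, orient_self_right, orient_rotate]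
    simp [h]
  · rw [orient_comb _ _ _ _ _ (by norm_num), orient_self_left, orient_self_right,
      ← orient_rotate r p q]
    simp [h]
  · rw [orient_comb _ _ _ _ _ (by norm_num), orient_self_left, orient_self_right]
    simp [h]

/-- An affine function that vanishes on a nonempty open set has zero slope. -/
theorem eq_zero_of_cross_eq_zero {O : Set Plane} (hO : IsOpen O) {y : Plane} (hy : y ∈ O)
    (w a : Plane) (h : ∀ x ∈ O, cross w (x - a) = 0) : w = 0 := by
  have hc : ∀ d : Plane, cross w d = 0 := by
    intro d
    have hcont : Continuous (fun s : ℝ => y + s • d) := by fun_prop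
    have hev : ∀ᶠ s in nhds (0 : ℝ), y + s • d ∈ O := by
      apply hcont.continuousAt.eventually_mem
      simpa using hO.mem_nhds hy
    obtain ⟨ε, hε, hball⟩ := Metric.eventually_nhds_iff.1 hev
    have h1 := h _ (hball (y := ε / 2) (by simp [abs_of_pos hε]; linarith))
    have h2 := h _ hy
    simp [cross] at h1 h2 ⊢
    have : ε / 2 * (w 0 * d 1 - w 1 * d 0) = 0 := by linear_combination h1 - h2
    rcases mul_eq_zero.1 this with h | h
    · linarith
    · exact h
  have h0 := hc !₂[0, 1]
  have h1 := hc !₂[1, 0]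
  simp [cross] at h0 h1
  exact plane_ext h0 h1

/-- Affinely independent triples are the nondegenerate ones. -/
theorem orient_ne_zero_of_affineIndependent {p q r : Plane} (hpq : p ≠ q) (hpr : p ≠ r) (hqr : q ≠ r)
    (h : AffineIndependent ℝ ((↑) : ({p, q, r} : Finset Plane) → Plane)) : orient p q r ≠ 0 := by
  intro h0
  have h' : AffineIndependent ℝ ![p, q, r] := by
    let e : Fin 3 ↪ ({p, q, r} : Finset Plane) :=
      ⟨![⟨p, by simp⟩, ⟨q, by simp⟩, ⟨r, by simp⟩], by
        intro i j; fin_cases i <;> fin_cases j <;> simp [hpq, hpr, hqr, hpq.symm, hpr.symm, hqr.symm]⟩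
    have := h.comp_embedding e
    convert this using 1
    ext i; fin_cases i <;> rfl
  rw [affineIndependent_iff] at h'
  have hs : ∀ w : Fin 3 → ℝ, w 0 + w 1 + w 2 = 0 → w 0 • p + w 1 • q + w 2 • r = 0 → w 0 = 0 ∧ w 1 = 0 ∧ w 2 = 0 := by
    intro w hw hw'
    have := h' Finset.univ w (by simpa [Fin.sum_univ_three] using hw)
      (by simpa [Fin.sum_univ_three] using hw')
    exact ⟨this 0 (by simp), this 1 (by simp), this 2 (by simp)⟩
  rw [orient_def] at h0
  -- If the signed area vanishes, the differences of the second coordinates are the weights of an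
  -- affine dependence, and likewise those of the first coordinates; all of them must be zero, so `p
  -- = q`.
  have hA := hs ![(r 1 - q 1), (p 1 - r 1), (q 1 - p 1)] (by simp) (by
    refine plane_ext ?_ ?_ <;> simp
    · linear_combination -h0
    · ring)
  have hB := hs ![(r 0 - q 0), (p 0 - r 0), (q 0 - p 0)] (by simp) (by
    refine plane_ext ?_ ?_ <;> simp
    · ring
    · linear_combination h0)
  simp at hA hB
  exact hpq (plane_ext (by linarith [hB.2.2]) (by linarith [hA.2.2]))

end

section

/-! ### Integration over triangles -/

/-- The reference triangle. -/
def refTriangle : Set Plane := {x | 0 ≤ x 0 ∧ 0 ≤ x 1 ∧ x 0 + x 1 ≤ 1}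

theorem measurableSet_refTriangle : MeasurableSet refTriangle := by
  have h : IsClosed refTriangle := by
    have h1 : Continuous fun x : Plane => x 0 := by fun_prop
    have h2 : Continuous fun x : Plane => x 1 := by fun_prop
    exact (isClosed_le continuous_const h1).inter
      ((isClosed_le continuous_const h2).inter (isClosed_le (h1.add h2) continuous_const))
  exact h.measurableSet

/-- Fubini: the inner integral runs over `[0, 1 - x]` and leaves a quadratic polynomial in `x`. -/
theorem setIntegral_refTriangle (α β γ : ℝ) :
    ∫ x in refTriangle, (α + β * x 0 + γ * x 1) = α / 2 + β / 6 + γ / 6 := by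
  let e : Plane ≃ᵐ ℝ × ℝ :=
    (MeasurableEquiv.toLp 2 (Fin 2 → ℝ)).symm.trans MeasurableEquiv.finTwoArrow
  have he : MeasurePreserving e := (volume_preserving_finTwoArrow ℝ).comp
    (EuclideanSpace.volume_preserving_symm_measurableEquiv_toLp (Fin 2))
  let S : Set (ℝ × ℝ) := {y | 0 ≤ y.1 ∧ 0 ≤ y.2 ∧ y.1 + y.2 ≤ 1}
  have hScl : IsClosed S := (isClosed_le continuous_const continuous_fst).inter
      ((isClosed_le continuous_const continuous_snd).inter
      (isClosed_le (continuous_fst.add continuous_snd) continuous_const))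
  have hSc : IsCompact S := by
    refine (isCompact_Icc (a := ((0, 0) : ℝ × ℝ)) (b := (1, 1))).of_isClosed_subset hScl ?_
    rintro ⟨a, b⟩ ⟨h1, h2, h3⟩
    simp only at h1 h2 h3
    exact ⟨⟨h1, h2⟩, ⟨by simp only; linarith, by simp only; linarith⟩⟩
  have h1 : ∫ x in refTriangle, (α + β * x 0 + γ * x 1)
      = ∫ y in S, (α + β * y.1 + γ * y.2) :=
    he.setIntegral_preimage_emb e.measurableEmbedding (fun y => α + β * y.1 + γ * y.2) S
  rw [h1, ← integral_indicator hScl.measurableSet, Measure.volume_eq_prod, integral_prod]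
  · have h2 : ∀ x : ℝ, ∫ y : ℝ, S.indicator (fun y => α + β * y.1 + γ * y.2) (x, y)
        = (Icc (0:ℝ) 1).indicator
          (fun x => (α + β * x) * (1 - x) + γ * (1 - x) ^ 2 / 2) x := by
      intro x
      by_cases hx : x ∈ Icc (0:ℝ) 1
      · rw [indicator_of_mem hx]
        have h3 : (fun y : ℝ => S.indicator (fun y => α + β * y.1 + γ * y.2) (x, y))
            = (Icc 0 (1 - x)).indicator (fun y => α + β * x + γ * y) := by
          ext y
          by_cases hy : y ∈ Icc 0 (1 - x)
          · rw [indicator_of_mem hy, indicator_of_mem]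
            exact ⟨hx.1, hy.1, by have := hy.2; simp only; linarith⟩
          · rw [indicator_of_notMem hy, indicator_of_notMem]
            rintro ⟨_, h4, h5⟩
            exact hy ⟨h4, by simp only at h5; linarith⟩
        rw [h3, integral_indicator measurableSet_Icc, integral_Icc_eq_integral_Ioc,
          ← intervalIntegral.integral_of_le (by linarith [hx.2])]
        rw [intervalIntegral.integral_add (by simp) (by apply Continuous.intervalIntegrable; fun_prop),
          intervalIntegral.integral_const_mul, integral_id]
        simp
        ring
      · rw [indicator_of_notMem hx]
        have h3 : (fun y : ℝ => S.indicator (fun y => α + β * y.1 + γ * y.2) (x, y)) = 0 := by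
          ext y
          rw [indicator_of_notMem]; · rfl
          rintro ⟨h4, h5, h6⟩
          simp only at h4 h5 h6
          exact hx ⟨h4, by linarith⟩
        rw [h3]; simp
    simp_rw [h2]
    rw [integral_indicator measurableSet_Icc, integral_Icc_eq_integral_Ioc,
          ← intervalIntegral.integral_of_le (by norm_num)]
    have h3 : ∀ x : ℝ, (α + β * x) * (1 - x) + γ * (1 - x) ^ 2 / 2
      = (α + γ / 2) + (β - α - γ) * x + (γ / 2 - β) * x ^ 2 := by intro x; ring
    simp_rw [h3]
    rw [intervalIntegral.integral_add (by apply Continuous.intervalIntegrable; fun_prop)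
      (by apply Continuous.intervalIntegrable; fun_prop),
      intervalIntegral.integral_add (by simp) (by apply Continuous.intervalIntegrable; fun_prop),
      intervalIntegral.integral_const_mul, intervalIntegral.integral_const_mul, integral_id]
    simp [integral_pow]
    ring
  · exact ((integrable_indicator_iff hScl.measurableSet).2
      (ContinuousOn.integrableOn_compact hSc (by fun_prop)))

theorem P1.eval_eq (f : P1) (x : Plane) : f.eval x = f.1 + (f.2 0 * x 0 + f.2 1 * x 1) := by
  rw [P1.eval, inner_plane]

theorem P1.continuous_eval (f : P1) : Continuous f.eval := by
  unfold P1.eval; fun_prop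

/-- The vertex rule is exact for affine functions. The affine map with columns `q - p` and `r - p`
carries the reference triangle onto this one, with Jacobian `orient p q r`. -/
theorem setIntegral_triangle {p q r : Plane} (h : orient p q r ≠ 0) (f : P1) :
    ∫ x in hull {p, q, r}, f.eval x
      = |orient p q r| / 6 * (f.eval p + f.eval q + f.eval r) := by
  let m : Matrix (Fin 2) (Fin 2) ℝ := !![q 0 - p 0, r 0 - p 0; q 1 - p 1, r 1 - p 1]
  let L : Plane →L[ℝ] Plane := LinearMap.toContinuousLinearMap
    (Matrix.toLin (EuclideanSpace.basisFun (Fin 2) ℝ).toBasis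
      (EuclideanSpace.basisFun (Fin 2) ℝ).toBasis m)
  have hL0 : ∀ x, L x 0 = (q 0 - p 0) * x 0 + (r 0 - p 0) * x 1 := by
    intro x
    simp [L, m, Matrix.toLin_apply, Matrix.mulVec, dotProduct, Fin.sum_univ_two]
  have hL1 : ∀ x, L x 1 = (q 1 - p 1) * x 0 + (r 1 - p 1) * x 1 := by
    intro x
    simp [L, m, Matrix.toLin_apply, Matrix.mulVec, dotProduct, Fin.sum_univ_two]
  have hdet : L.det = orient p q r := by
    rw [ContinuousLinearMap.det]
    simp only [L, LinearMap.coe_toContinuousLinearMap, LinearMap.det_toLin]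
    simp [m, Matrix.det_fin_two, orient_def]; ring
  have himg : (fun x => p + L x) '' refTriangle = hull {p, q, r} := by
    ext x
    rw [mem_hull_triple]
    constructor
    · rintro ⟨y, ⟨h1, h2, h3⟩, rfl⟩
      refine ⟨1 - y 0 - y 1, y 0, y 1, by linarith, h1, h2, by ring, ?_⟩
      refine plane_ext ?_ ?_ <;> simp [hL0, hL1] <;> ring
    · rintro ⟨α, β, γ, h1, h2, h3, h4, rfl⟩
      refine ⟨!₂[β, γ], ⟨by simpa, by simpa, by simp; linarith⟩, ?_⟩
      obtain rfl : α = 1 - β - γ := by linarith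
      refine plane_ext ?_ ?_ <;> simp [hL0, hL1] <;> ring
  have hinj : InjOn (fun x => p + L x) refTriangle := by
    intro x _ y _ hxy
    have h0 : L (x - y) = 0 := by simpa [sub_eq_zero] using hxy
    have e0 := hL0 (x - y)
    have e1 := hL1 (x - y)
    rw [h0] at e0 e1
    simp at e0 e1
    rw [orient_def] at h
    refine plane_ext ?_ ?_
    · have : ((q 0 - p 0) * (r 1 - p 1) - (q 1 - p 1) * (r 0 - p 0)) * (x 0 - y 0) = 0 := by
        linear_combination (r 0 - p 0) * e1 - (r 1 - p 1) * e0
      linarith [(mul_eq_zero.1 this).resolve_left h]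
    · have : ((q 0 - p 0) * (r 1 - p 1) - (q 1 - p 1) * (r 0 - p 0)) * (x 1 - y 1) = 0 := by
        linear_combination (q 1 - p 1) * e0 - (q 0 - p 0) * e1
      linarith [(mul_eq_zero.1 this).resolve_left h]
  rw [← himg, integral_image_eq_integral_abs_det_fderiv_smul volume measurableSet_refTriangle
    (fun x _ => ((L.hasFDerivAt).const_add p).hasFDerivWithinAt) hinj, hdet]
  have hf : ∀ x : Plane, |orient p q r| • f.eval (p + L x)
      = |orient p q r| * f.eval p + |orient p q r| * (f.eval q - f.eval p) * x 0
        + |orient p q r| * (f.eval r - f.eval p) * x 1 := by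
    intro x
    simp only [P1.eval_eq, PiLp.add_apply, hL0, hL1, smul_eq_mul]; ring
  simp_rw [hf]
  rw [setIntegral_refTriangle]
  ring

theorem volume_triangle {p q r : Plane} (h : orient p q r ≠ 0) :
    (volume : Measure Plane).real (hull {p, q, r}) = |orient p q r| / 2 := by
  have := setIntegral_triangle h (1, 0)
  simp [P1.eval] at this
  rw [this]; ring

theorem edgeInt_const {a b : Plane} (g : ℝ) : TwoLevelMesh.edgeInt {a, b} (fun _ => g) = ‖b - a‖ * g := by
  unfold TwoLevelMesh.edgeInt hull
  rw [setIntegral_const, Finset.coe_pair, convexHull_pair, Measure.real, hausdorffMeasure_segment,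
    edist_dist, ENNReal.toReal_ofReal dist_nonneg, dist_eq_norm, norm_sub_rev, smul_eq_mul]

theorem measurableSet_hull (s : Finset Plane) : MeasurableSet (hull s) :=
  (isClosed_hull s).measurableSet

theorem edgeInt_congr {e : Finset Plane} {f g : Plane → ℝ} (h : ∀ x ∈ hull e, f x = g x) :
    TwoLevelMesh.edgeInt e f = TwoLevelMesh.edgeInt e g :=
  setIntegral_congr_fun (measurableSet_hull e) h

end

section

/-! ### Outward normals and fluxes -/

theorem centroid_eq_smul_sum {s : Finset Plane} (hs : s.Nonempty) :
    s.centroid ℝ id = (s.card : ℝ)⁻¹ • ∑ x ∈ s, x := by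
  rw [Finset.centroid, Finset.affineCombination_eq_linear_combination]
  · simp [Finset.centroidWeights, Finset.smul_sum]
  · exact Finset.sum_centroidWeights_eq_one_of_nonempty ℝ s hs

theorem centroid_two {a b : Plane} (h : a ≠ b) :
    ({a, b} : Finset Plane).centroid ℝ id = (1 / 2 : ℝ) • (a + b) := by
  rw [centroid_eq_smul_sum (by simp), Finset.sum_pair h, Finset.card_pair h]; norm_num

theorem centroid_three {p q r : Plane} (hpq : p ≠ q) (hpr : p ≠ r) (hqr : q ≠ r) :
    ({p, q, r} : Finset Plane).centroid ℝ id = (1 / 3 : ℝ) • (p + q + r) := by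
  rw [centroid_eq_smul_sum (by simp), Finset.sum_insert (by simp [hpq, hpr]), Finset.sum_pair hqr,
    Finset.card_insert_of_notMem (by simp [hpq, hpr]), Finset.card_pair hqr]
  norm_num [add_assoc]

theorem ne_of_orient_ne_zero {p q r : Plane} (h : orient p q r ≠ 0) : p ≠ q ∧ p ≠ r ∧ q ≠ r := by
  refine ⟨?_, ?_, ?_⟩ <;> rintro rfl <;> apply h <;> simp only [orient_def] <;> ring

theorem norm_sq_plane (u : Plane) : ‖u‖ ^ 2 = u 0 ^ 2 + u 1 ^ 2 := by
  rw [← real_inner_self_eq_norm_sq, inner_plane]; ring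

theorem norm_rot (u : Plane) : ‖rot u‖ = ‖u‖ := by
  rw [← sq_eq_sq₀ (norm_nonneg _) (norm_nonneg _), norm_sq_plane, norm_sq_plane]
  simp; ring

theorem inner_rot (u v : Plane) : inner ℝ u (rot v) = cross u v := by
  rw [inner_plane]; simp [cross]; ring

/-- For positive `orient a b z` the vertex `z` lies to the left of the edge from `a` to `b`, so the
clockwise rotation of `b - a` points outward; otherwise the sign flips. -/
theorem outwardNormal_eq {a b z : Plane} (h : orient a b z ≠ 0) :
    outwardNormal {a, b, z} {a, b} = (orient a b z / |orient a b z| / ‖b - a‖) • rot (b - a) := by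
  obtain ⟨hab, haz, hbz⟩ := ne_of_orient_ne_zero h
  have hd : ‖b - a‖ ≠ 0 := by simpa [sub_eq_zero] using hab.symm
  have hd2 : (b 0 - a 0) ^ 2 + (b 1 - a 1) ^ 2 ≠ 0 := by
    have := norm_sq_plane (b - a)
    simp only [PiLp.sub_apply] at this
    rw [← this]; positivity
  -- The centroid has one third of the height `|orient a b z| / ‖b - a‖` over the edge, which
  -- accounts for the factor.
  have hproj : (vectorSpan ℝ ((({a, b} : Finset Plane)) : Set Plane))ᗮ.starProjection
      (({a, b} : Finset Plane).centroid ℝ id - ({a, b, z} : Finset Plane).centroid ℝ id)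
      = (orient a b z / 3 / ‖b - a‖ ^ 2) • rot (b - a) := by
    rw [centroid_two hab, centroid_three hab haz hbz, Finset.coe_pair,
      vectorSpan_pair_rev, vsub_eq_sub]
    apply Submodule.eq_starProjection_of_mem_of_inner_eq_zero
    · apply Submodule.smul_mem
      rw [Submodule.mem_orthogonal_singleton_iff_inner_right, inner_rot]
      simp [cross]; ring
    · intro w hw
      rw [Submodule.mem_orthogonal_singleton_iff_inner_right, inner_plane] at hw
      rw [inner_plane, orient_def, norm_sq_plane]
      simp at hw ⊢
      field_simp
      rw [show ∀ x y : ℝ, x + y = x - (-y) from fun x y => by ring]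
      linear_combination (((1/2) * (a 0 + b 0) - (1/3) * (a 0 + b 0 + z 0)) * (b 0 - a 0)
        + ((1/2) * (a 1 + b 1) - (1/3) * (a 1 + b 1 + z 1)) * (b 1 - a 1)) * 6 * hw
  unfold outwardNormal
  simp only [hproj, norm_smul, norm_rot, smul_smul]
  congr 1
  rw [norm_div, norm_div, norm_pow, norm_norm, Real.norm_eq_abs, Real.norm_eq_abs]
  have := abs_ne_zero.2 h
  rw [abs_of_pos (by norm_num : (0:ℝ) < 3)]
  field_simp

/-- The outward normal in terms of a given unit normal. -/
theorem outwardNormal_eq_of_normal {a b z n : Plane} (h : orient a b z ≠ 0) (hn : ‖n‖ = 1)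
    (hna : inner ℝ (b - a) n = 0) :
    inner ℝ (a - z) n ≠ 0 ∧
    outwardNormal {a, b, z} {a, b} = (inner ℝ (a - z) n / |inner ℝ (a - z) n|) • n := by
  obtain ⟨hab, haz, hbz⟩ := ne_of_orient_ne_zero h
  have hd : ‖b - a‖ ≠ 0 := by simpa [sub_eq_zero] using hab.symm
  obtain ⟨t, ht⟩ : ∃ t : ℝ, n = t • rot (b - a) := by
    refine ⟨inner ℝ n (rot (b - a)) / ‖b - a‖ ^ 2, ?_⟩
    have hd2 := pow_ne_zero 2 hd
    rw [norm_sq_plane] at hd2 ⊢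
    rw [inner_plane] at hna ⊢
    simp at hna hd2 ⊢
    refine plane_ext ?_ ?_ <;> simp <;> field_simp
    · linear_combination (b 0 - a 0) * hna
    · linear_combination (b 1 - a 1) * hna
  have ht1 : |t| * ‖b - a‖ = 1 := by
    rw [← hn, ht, norm_smul, norm_rot, Real.norm_eq_abs]
  have ht0 : |t| ≠ 0 := left_ne_zero_of_mul_eq_one ht1
  have hin : inner ℝ (a - z) n = t * orient a b z := by
    rw [ht, inner_smul_right, inner_rot, orient_def]; simp [cross]; ring_nf; simp
  have hin0 : inner ℝ (a - z) n ≠ 0 := by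
    rw [hin]; exact mul_ne_zero (abs_ne_zero.1 ht0) h
  refine ⟨hin0, ?_⟩
  rw [outwardNormal_eq h, hin, ht, smul_smul, abs_mul]
  congr 1
  have h1 := abs_ne_zero.2 h
  field_simp
  rw [← sq_abs t]
  linear_combination (-|t|) * ht1

/-- The nonconstant part of the field moves in the direction `d`, which is orthogonal to `n`. -/
theorem inner_eval_add_smul (c : RT0) (a d n : Plane) (s : ℝ) (h : inner ℝ d n = 0) :
    inner ℝ (c.eval (a + s • d)) n = inner ℝ (c.eval a) n := by
  unfold RT0.eval
  rw [smul_add, smul_smul, ← add_assoc, inner_add_left _ ((c.2 * s) • d), inner_smul_left, h]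
  simp

theorem exists_eq_add_smul {a b x : Plane} (hx : x ∈ hull {a, b}) : ∃ s : ℝ, x = a + s • (b - a) := by
  obtain ⟨α, β, h1, h2, h3, rfl⟩ := mem_hull_pair.1 hx
  obtain rfl : α = 1 - β := by linarith
  exact ⟨β, by module⟩

/-- Normal components of lowest order fields are constant on edges. -/
theorem inner_eval_eq {a b x y n : Plane} (c : RT0) (h : inner ℝ (b - a) n = 0)
    (hx : x ∈ hull {a, b}) (hy : y ∈ hull {a, b}) :
    inner ℝ (c.eval x) n = inner ℝ (c.eval y) n := by
  obtain ⟨s, rfl⟩ := exists_eq_add_smul hx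
  obtain ⟨t, rfl⟩ := exists_eq_add_smul hy
  rw [inner_eval_add_smul _ _ _ _ _ h, inner_eval_add_smul _ _ _ _ _ h]

theorem inner_sub_outwardNormal {a b z : Plane} (h : orient a b z ≠ 0) :
    inner ℝ (b - a) (outwardNormal {a, b, z} {a, b}) = 0 := by
  rw [outwardNormal_eq h, inner_smul_right, inner_rot]; simp [cross]; ring_nf; simp

/-- The length of an edge. -/
def edgeLength (e : Finset Plane) : ℝ := TwoLevelMesh.edgeInt e (fun _ => 1)

theorem edgeLength_pair (a b : Plane) : edgeLength {a, b} = ‖b - a‖ := by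
  rw [edgeLength, edgeInt_const, mul_one]

theorem edgeInt_const' (e : Finset Plane) (g : ℝ) :
    TwoLevelMesh.edgeInt e (fun _ => g) = edgeLength e * g := by
  simp [edgeLength, TwoLevelMesh.edgeInt]

theorem centroid_mem_hull {e : Finset Plane} (h : e.Nonempty) : e.centroid ℝ id ∈ hull e := by
  rw [centroid_eq_smul_sum h, Finset.smul_sum]
  refine (convex_hull e).sum_mem (by intros; positivity) ?_ (fun i hi => mem_hull_of_mem hi)
  rw [Finset.sum_const, nsmul_eq_mul, mul_inv_cancel₀]
  exact_mod_cast h.card_pos.ne'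

/-- The outward flux of a lowest order field through the edge `e` of the triangle `τ`. -/
def flux (τ e : Finset Plane) (c : RT0) : ℝ :=
  edgeLength e * inner ℝ (c.eval (e.centroid ℝ id)) (outwardNormal τ e)

theorem flux_eq {a b z : Plane} (h : orient a b z ≠ 0) (c : RT0) :
    flux {a, b, z} {a, b} c
      = orient a b z / |orient a b z| * inner ℝ (c.eval a) (rot (b - a)) := by
  obtain ⟨hab, haz, hbz⟩ := ne_of_orient_ne_zero h
  have hd : ‖b - a‖ ≠ 0 := by simpa [sub_eq_zero] using hab.symm
  rw [flux, inner_eval_eq c (inner_sub_outwardNormal h) (centroid_mem_hull (by simp))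
    (mem_hull_of_mem (x := a) (by simp)), edgeLength_pair, outwardNormal_eq h, inner_smul_right]
  field_simp

open Classical in
theorem powersetCard_two_eq {t : Finset Plane} (ht : t.card = 3) :
    t.powersetCard 2 = t.image t.erase := by
  ext e
  simp only [Finset.mem_powersetCard, Finset.mem_image]
  constructor
  · rintro ⟨h1, h2⟩
    have hc : (t \ e).card = 1 := by rw [Finset.card_sdiff_of_subset h1]; omega
    obtain ⟨v, hv⟩ := Finset.card_eq_one.1 hc
    have hv' : v ∈ t \ e := by rw [hv]; simp
    refine ⟨v, (Finset.mem_sdiff.1 hv').1, ?_⟩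
    rw [Finset.erase_eq, ← hv, Finset.sdiff_sdiff_eq_self h1]
  · rintro ⟨v, hv, rfl⟩
    exact ⟨Finset.erase_subset _ _, by rw [Finset.card_erase_of_mem hv, ht]⟩

/-- The divergence theorem for lowest order fields on a triangle. -/
theorem setIntegral_divergence {τ : Finset Plane} (hτ : τ.card = 3)
    (hi : AffineIndependent ℝ ((↑) : τ → Plane)) (c : RT0) :
    ∫ x in hull τ, divergence c.eval x = ∑ e ∈ τ.powersetCard 2, flux τ e c := by
  classical
  obtain ⟨p, q, r, hpq, hpr, hqr, rfl⟩ := Finset.card_eq_three.1 hτ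
  have hD := orient_ne_zero_of_affineIndependent hpq hpr hqr hi
  rw [powersetCard_two_eq hτ, Finset.sum_image (Finset.erase_injOn _),
    Finset.sum_insert (by simp [hpq, hpr]), Finset.sum_pair hqr]
  have e1 : ({p, q, r} : Finset Plane).erase p = {q, r} := by
    ext x; simp; grind
  have e2 : ({p, q, r} : Finset Plane).erase q = {r, p} := by
    ext x; simp; grind
  have e3 : ({p, q, r} : Finset Plane).erase r = {p, q} := by
    ext x; simp; grind
  have t1 : ({p, q, r} : Finset Plane) = {q, r, p} := by
    ext x; simp; grind
  have t2 : ({p, q, r} : Finset Plane) = {r, p, q} := by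
    ext x; simp; grind
  have hD1 : orient q r p = orient p q r := orient_rotate p q r
  have hD2 : orient r p q = orient p q r := by rw [← orient_rotate r p q]
  have f1 : flux {p, q, r} {q, r} c
      = orient p q r / |orient p q r| * inner ℝ (c.eval q) (rot (r - q)) := by
    rw [t1, flux_eq (by rwa [hD1]), hD1]
  have f2 : flux {p, q, r} {r, p} c
      = orient p q r / |orient p q r| * inner ℝ (c.eval r) (rot (p - r)) := by
    rw [t2, flux_eq (by rwa [hD2]), hD2]
  rw [e1, e2, e3, f1, f2, flux_eq hD]
  simp_rw [divergence_eval]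
  rw [setIntegral_const, volume_triangle hD, smul_eq_mul]
  -- The constant part of the field cancels because the edge vectors add up to zero; the linear part
  -- leaves the sum of the three cross products, which is the signed area.
  have hsum : inner ℝ (c.eval q) (rot (r - q)) + inner ℝ (c.eval r) (rot (p - r))
      + inner ℝ (c.eval p) (rot (q - p)) = c.2 * orient p q r := by
    simp only [RT0.eval, inner_rot, cross, orient_def, PiLp.add_apply, PiLp.smul_apply,
      PiLp.sub_apply, smul_eq_mul]
    ring
  have h0 := abs_ne_zero.2 hD
  rw [← add_assoc, ← mul_add, ← mul_add, hsum]
  field_simp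
  rw [sq_abs]
  ring

end

section

/-! ### Geometry of meshes -/

namespace Mesh

variable {Ω : Set Plane} (T : Mesh Ω)

theorem mem_tri {t : Finset Plane} : t ∈ T.tri ↔ t ∈ T.complex.faces ∧ t.card = 3 := by
  simp [tri]

theorem mem_edges {e : Finset Plane} : e ∈ T.edges ↔ e ∈ T.complex.faces ∧ e.card = 2 := by
  simp [edges]

theorem orient_ne_zero {p q r : Plane} (h : {p, q, r} ∈ T.tri) : orient p q r ≠ 0 := by
  obtain ⟨h1, h2⟩ := T.mem_tri.1 h
  have hpq : p ≠ q := by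
    rintro rfl
    have h3 := Finset.card_le_two (a := p) (b := r)
    simp only [Finset.insert_eq_of_mem, Finset.mem_insert, true_or] at h2
    omega
  have hpr : p ≠ r := by
    rintro rfl
    have h3 := Finset.card_le_two (a := q) (b := p)
    rw [Finset.insert_eq_of_mem (by simp)] at h2
    omega
  have hqr : q ≠ r := by
    rintro rfl
    have h3 := Finset.card_le_two (a := p) (b := q)
    simp only [Finset.mem_singleton, Finset.insert_eq_of_mem] at h2
    omega
  exact orient_ne_zero_of_affineIndependent hpq hpr hqr (T.complex.indep h1)

theorem tri_edge_form {t e : Finset Plane} (ht : t ∈ T.tri) (he : e.card = 2) (het : e ⊆ t) :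
    ∃ a b z, e = {a, b} ∧ t = {a, b, z} ∧ a ≠ b ∧ orient a b z ≠ 0 := by
  classical
  obtain ⟨a, b, hab, rfl⟩ := Finset.card_eq_two.1 he
  have hc : (t \ {a, b}).card = 1 := by
    rw [Finset.card_sdiff_of_subset het, he, (T.mem_tri.1 ht).2]
  obtain ⟨z, hz⟩ := Finset.card_eq_one.1 hc
  have h : t = {a, b, z} := by
    rw [← Finset.sdiff_union_of_subset het, hz]
    ext x; simp; grind
  exact ⟨a, b, z, rfl, h, hab, T.orient_ne_zero (h ▸ ht)⟩

theorem exists_edge_subset {t : Finset Plane} (ht : t ∈ T.tri) : ∃ e, e.card = 2 ∧ e ⊆ t := by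
  obtain ⟨e, h1, h2⟩ := Finset.exists_subset_card_eq (s := t) (n := 2) (by rw [(T.mem_tri.1 ht).2]; simp)
  exact ⟨e, h2, h1⟩

theorem tri_form {t : Finset Plane} (ht : t ∈ T.tri) :
    ∃ p q r, t = {p, q, r} ∧ orient p q r ≠ 0 := by
  obtain ⟨e, h1, h2⟩ := T.exists_edge_subset ht
  obtain ⟨a, b, z, -, h, -, h'⟩ := T.tri_edge_form ht h1 h2
  exact ⟨a, b, z, h, h'⟩

theorem subset_mem_edges {t e : Finset Plane} (ht : t ∈ T.tri) (he : e.card = 2) (het : e ⊆ t) :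
    e ∈ T.edges :=
  T.mem_edges.2 ⟨T.complex.down_closed (T.mem_tri.1 ht).1 het
    (Finset.card_pos.1 (by omega)), he⟩

theorem exists_tri {x : Plane} (hx : x ∈ closure Ω) : ∃ t ∈ T.tri, x ∈ hull t := by
  rw [← T.space_eq, Geometry.SimplicialComplex.mem_space_iff] at hx
  obtain ⟨s, hs, hxs⟩ := hx
  obtain ⟨t, ht, hst, hc⟩ := T.pure s hs
  exact ⟨t, T.mem_tri.2 ⟨ht, hc⟩, hull_mono hst hxs⟩

theorem hull_subset {t : Finset Plane} (ht : t ∈ T.tri) : hull t ⊆ closure Ω := by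
  rw [← T.space_eq]
  exact T.complex.convexHull_subset_space (T.mem_tri.1 ht).1

open Classical in
theorem mem_hull_inter {s t : Finset Plane} (hs : s ∈ T.complex.faces) (ht : t ∈ T.complex.faces)
    {x : Plane} (hxs : x ∈ hull s) (hxt : x ∈ hull t) : x ∈ hull (s ∩ t) := by
  have := T.complex.inter_subset_convexHull hs ht ⟨hxs, hxt⟩
  rwa [hull, Finset.coe_inter]

theorem interior_hull_nonempty {t : Finset Plane} (ht : t ∈ T.tri) : (interior (hull t)).Nonempty := by
  obtain ⟨p, q, r, rfl, h⟩ := T.tri_form ht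
  exact hull_triple_interior_nonempty h

/-- Distinct triangles have disjoint interiors. -/
theorem eq_of_mem_interior {t t' : Finset Plane} (ht : t ∈ T.tri) (ht' : t' ∈ T.tri) {y : Plane}
    (h1 : y ∈ interior (hull t)) (h2 : y ∈ interior (hull t')) : t = t' := by
  classical
  by_contra hne
  have hsub : ¬ t ⊆ t' := fun h => hne (Finset.eq_of_subset_of_card_le h
    (by rw [(T.mem_tri.1 ht).2, (T.mem_tri.1 ht').2]))
  obtain ⟨v, hv, hv'⟩ := Finset.not_subset.1 hsub
  obtain ⟨a, b, z, he, -, hab, -⟩ := T.tri_edge_form (e := t.erase v) ht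
    (by rw [Finset.card_erase_of_mem hv, (T.mem_tri.1 ht).2]) (Finset.erase_subset _ _)
  -- A common point lies in a common face, which misses `v` and so lies on the line through the
  -- opposite edge; a line contains no nonempty open set.
  have hO : ∀ x ∈ interior (hull t) ∩ interior (hull t'), cross (b - a) (x - a) = 0 := by
    rintro x ⟨hx1, hx2⟩
    have hx := T.mem_hull_inter (T.mem_tri.1 ht).1 (T.mem_tri.1 ht').1 (interior_subset hx1)
      (interior_subset hx2)
    have hx : x ∈ hull (t.erase v) := by
      refine hull_mono ?_ hx
      intro w hw
      rw [Finset.mem_inter] at hw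
      exact Finset.mem_erase.2 ⟨fun h => hv' (h ▸ hw.2), hw.1⟩
    rw [he] at hx
    obtain ⟨s, rfl⟩ := exists_eq_add_smul hx
    simp [cross]; ring
  have := eq_zero_of_cross_eq_zero (isOpen_interior.inter isOpen_interior) ⟨h1, h2⟩ _ _ hO
  exact hab (sub_eq_zero.1 this).symm

/-- Two triangles on the same side of a common edge are equal. -/
theorem eq_of_same_side {a b z z' : Plane} (ht : {a, b, z} ∈ T.tri) (ht' : {a, b, z'} ∈ T.tri)
    (h : 0 < orient a b z * orient a b z') : ({a, b, z} : Finset Plane) = {a, b, z'} := by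
  classical
  by_contra hne
  have hz : orient a b z ≠ 0 := T.orient_ne_zero ht
  have hz' : orient a b z' ≠ 0 := T.orient_ne_zero ht'
  set D := orient a b z
  set D' := orient a b z'
  have hpos : 0 < D / D' := div_pos_iff.2 (mul_pos_iff.1 h)
  obtain ⟨k₁, hk₁⟩ : ∃ k, k = orient b z' z / D' := ⟨_, rfl⟩
  obtain ⟨k₂, hk₂⟩ : ∃ k, k = orient z' a z / D' := ⟨_, rfl⟩
  -- The point `y` below is the midpoint of `a b` moved slightly towards `z`. This `s` is small
  -- enough that the coordinates `(1 - s) / 2 + s * kᵢ` of `y` in the second triangle stay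
  -- nonnegative, so `y` lies in both triangles but off their common edge.
  obtain ⟨s, hs⟩ : ∃ s : ℝ, s = 1 / (2 + 2 * |k₁| + 2 * |k₂|) := ⟨_, rfl⟩
  have hden : 0 < 2 + 2 * |k₁| + 2 * |k₂| := by positivity
  have hs0 : 0 < s := by rw [hs]; positivity
  have hs1 : s * (2 + 2 * |k₁| + 2 * |k₂|) = 1 := by rw [hs]; field_simp
  have p1 : 0 ≤ s * |k₁| := by positivity
  have p2 : 0 ≤ s * |k₂| := by positivity
  have n1 : -(s * |k₁|) ≤ s * k₁ := by
    rw [← mul_neg]; exact mul_le_mul_of_nonneg_left (neg_abs_le _) hs0.le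
  have n2 : -(s * |k₂|) ≤ s * k₂ := by
    rw [← mul_neg]; exact mul_le_mul_of_nonneg_left (neg_abs_le _) hs0.le
  obtain ⟨y, hy⟩ : ∃ y, y = ((1 - s) / 2) • a + ((1 - s) / 2) • b + s • z := ⟨_, rfl⟩
  have hsum : (1 - s) / 2 + (1 - s) / 2 + s = 1 := by ring
  have c3 : orient a b y = s * D := by
    rw [hy, orient_comb _ _ _ _ _ hsum, orient_self_left, orient_self_right]; ring
  have c1 : orient b z' y / D' = (1 - s) / 2 + s * k₁ := by
    rw [hy, orient_comb _ _ _ _ _ hsum, orient_self_left, orient_rotate, hk₁]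
    field_simp; ring
  have c2 : orient z' a y / D' = (1 - s) / 2 + s * k₂ := by
    rw [hy, orient_comb _ _ _ _ _ hsum, orient_self_right, ← orient_rotate z' a b, hk₂]
    field_simp; ring
  have hy1 : y ∈ hull {a, b, z} :=
    mem_hull_triple.2 ⟨_, _, _, by linarith, by linarith, hs0.le, hsum, hy⟩
  have hy2 : y ∈ hull {a, b, z'} := by
    refine mem_hull_of_orient hz' ?_ ?_ ?_
    · rw [c1]; linarith
    · rw [c2]; linarith
    · rw [c3, mul_div_assoc]; positivity
  have hy3 : y ∈ hull {a, b} := by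
    refine hull_mono ?_ (T.mem_hull_inter (T.mem_tri.1 ht).1 (T.mem_tri.1 ht').1 hy1 hy2)
    intro w hw
    simp only [Finset.mem_inter, Finset.mem_insert, Finset.mem_singleton] at hw ⊢
    rcases hw with ⟨h | h | rfl, h' | h' | h'⟩
    all_goals first | exact Or.inl h | exact Or.inr h | exact Or.inl h' | exact Or.inr h' | skip
    exact absurd (by rw [h']) hne
  obtain ⟨α, β, -, -, hαβ, hyab⟩ := mem_hull_pair.1 hy3
  have : orient a b y = 0 := by
    rw [hyab, orient_comb_two _ _ _ _ hαβ, orient_self_left, orient_self_right]; ring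
  rw [c3] at this
  exact (mul_ne_zero hs0.ne' hz) this

end Mesh

namespace TwoLevelMesh

variable {Ω : Set Plane} (M : TwoLevelMesh Ω)

theorem coarse_form {K : Finset Plane} (hK : K ∈ M.coarse) : ∃ p q r, {p, q, r} ∈ M.T0.tri ∧
    orient p q r ≠ 0 ∧ K = {(1 / 3 : ℝ) • (p + q + r), p, q} := by
  simp only [coarse, Mesh.centroidRefinement, Finset.mem_biUnion, Finset.mem_image,
    Finset.mem_powersetCard] at hK
  obtain ⟨t, ht, E, ⟨hEt, hE⟩, rfl⟩ := hK
  obtain ⟨a, b, z, rfl, rfl, hab, h⟩ := M.T0.tri_edge_form ht hE hEt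
  refine ⟨a, b, z, ht, h, ?_⟩
  obtain ⟨h1, h2, h3⟩ := ne_of_orient_ne_zero h
  rw [centroid_three h1 h2 h3]

theorem mem_coarse_of_edge {a b z : Plane} (ht : {a, b, z} ∈ M.T0.tri) (h : orient a b z ≠ 0) :
    {(1 / 3 : ℝ) • (a + b + z), a, b} ∈ M.coarse := by
  simp only [coarse, Mesh.centroidRefinement, Finset.mem_biUnion, Finset.mem_image,
    Finset.mem_powersetCard]
  obtain ⟨h1, h2, h3⟩ := ne_of_orient_ne_zero h
  refine ⟨_, ht, {a, b}, ⟨?_, Finset.card_pair h1⟩, ?_⟩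
  · intro x; simp; tauto
  · rw [centroid_three h1 h2 h3]

theorem orient_centroid (p q r : Plane) :
    orient ((1 / 3 : ℝ) • (p + q + r)) p q = orient p q r / 3 := by
  simp [orient_def]; ring

theorem coarse_hull_subset {p q r : Plane} :
    hull {(1 / 3 : ℝ) • (p + q + r), p, q} ⊆ hull {p, q, r} := by
  intro x hx
  obtain ⟨α, β, γ, h1, h2, h3, h4, rfl⟩ := mem_hull_triple.1 hx
  refine mem_hull_triple.2 ⟨α / 3 + β, α / 3 + γ, α / 3, by positivity, by positivity,
    by positivity, by linarith, by module⟩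

/-- In the coarse element at the edge `p q`, the barycentric coordinate of the third vertex is the
smallest. -/
theorem coarse_coord_le {p q r x : Plane} (h : orient p q r ≠ 0)
    (hx : x ∈ hull {(1 / 3 : ℝ) • (p + q + r), p, q}) :
    0 ≤ orient p q x / orient p q r ∧ orient p q x / orient p q r ≤ orient q r x / orient p q r ∧
    orient p q x / orient p q r ≤ orient r p x / orient p q r := by
  obtain ⟨α, β, γ, h1, h2, h3, h4, rfl⟩ := mem_hull_triple.1 hx
  have e1 : orient p q (α • (1 / 3 : ℝ) • (p + q + r) + β • p + γ • q) / orient p q r = α / 3 := by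
    rw [div_eq_iff h, orient_comb _ _ _ _ _ h4]; simp [orient_def]; ring
  have e2 : orient q r (α • (1 / 3 : ℝ) • (p + q + r) + β • p + γ • q) / orient p q r
      = α / 3 + β := by
    rw [div_eq_iff h, orient_comb _ _ _ _ _ h4]; simp [orient_def]; ring
  have e3 : orient r p (α • (1 / 3 : ℝ) • (p + q + r) + β • p + γ • q) / orient p q r
      = α / 3 + γ := by
    rw [div_eq_iff h, orient_comb _ _ _ _ _ h4]; simp [orient_def]; ring
  rw [e1, e2, e3]
  exact ⟨by positivity, by linarith, by linarith⟩

theorem coarse_interior_nonempty {K : Finset Plane} (hK : K ∈ M.coarse) :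
    (interior (hull K)).Nonempty := by
  obtain ⟨p, q, r, -, h, rfl⟩ := M.coarse_form hK
  exact hull_triple_interior_nonempty (by rw [orient_centroid]; simpa using h)

theorem coarse_subset_closure {K : Finset Plane} (hK : K ∈ M.coarse) : hull K ⊆ closure Ω := by
  obtain ⟨p, q, r, ht, h, rfl⟩ := M.coarse_form hK
  exact coarse_hull_subset.trans (M.T0.hull_subset ht)

/-- Two subtriangles of the same triangle either stand on the same side of it, or the apex opposite
to the second side is an endpoint of the first. -/
theorem orient_pair_cases {p q r p' q' r' : Plane} (h : orient p q r ≠ 0) (h' : orient p' q' r' ≠ 0)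
    (ht : ({p, q, r} : Finset Plane) = {p', q', r'}) :
    ({p, q} : Finset Plane) = {p', q'} ∨ (r' = p ∨ r' = q) := by
  obtain ⟨h1, h2, h3⟩ := ne_of_orient_ne_zero h
  obtain ⟨h1', h2', h3'⟩ := ne_of_orient_ne_zero h'
  have m1 : r' ∈ ({p, q, r} : Finset Plane) := by rw [ht]; simp
  simp only [Finset.mem_insert, Finset.mem_singleton] at m1
  rcases m1 with h | h | rfl
  · exact Or.inr (Or.inl h)
  · exact Or.inr (Or.inr h)
  · left
    ext x
    have := Finset.ext_iff.1 ht x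
    simp only [Finset.mem_insert, Finset.mem_singleton] at this ⊢
    grind

/-- In each of the two subtriangles the coordinate belonging to its own side is the smallest. On the
overlap both inequalities hold, so two coordinates agree and the point lies on the median through
`p`, which contains no open set. -/
theorem coarse_overlap {p q r y : Plane} (h : orient p q r ≠ 0) {O : Set Plane} (hO : IsOpen O)
    (hy : y ∈ O) (h1 : O ⊆ hull {(1 / 3 : ℝ) • (p + q + r), p, q})
    (h2 : O ⊆ hull {(1 / 3 : ℝ) • (p + q + r), r, p}) : False := by
  have hrot : orient r p q = orient p q r := (orient_rotate r p q).symm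
  have hc : ∀ x ∈ O, cross (q + r - (2 : ℝ) • p) (x - p) = 0 := by
    intro x hx
    have l1 := (coarse_coord_le h (h1 hx)).2.2
    have l2 := (coarse_coord_le (p := r) (q := p) (r := q) (by rwa [hrot]) (by
      rw [add_assoc, add_comm r, ]; exact h2 hx)).2.1
    rw [hrot] at l2
    have := le_antisymm l1 l2
    rw [div_left_inj' h, orient_def, orient_def] at this
    simp [cross]
    linear_combination this
  have h0 := eq_zero_of_cross_eq_zero hO hy _ _ hc
  have e0 := congrArg (fun v : Plane => v 0) h0
  have e1 := congrArg (fun v : Plane => v 1) h0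
  simp at e0 e1
  apply h
  rw [orient_def]
  linear_combination (q 0 - p 0) * e1 - (q 1 - p 1) * e0

/-- Coarse elements have disjoint interiors. -/
theorem coarse_eq_of_mem_interior {K K' : Finset Plane} (hK : K ∈ M.coarse) (hK' : K' ∈ M.coarse)
    {x : Plane} (h1 : x ∈ interior (hull K)) (h2 : x ∈ hull K') : K = K' := by
  -- The element `K'` is the closure of its interior, so the common point can be replaced by one
  -- that is interior to both elements.
  have hcl : closure (interior (hull K')) = hull K' := by
    rw [(convex_hull K').closure_interior_eq_closure_of_nonempty_interior
      (M.coarse_interior_nonempty hK'), (isClosed_hull K').closure_eq]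
  rw [← hcl] at h2
  obtain ⟨y, hy1, hy2⟩ := mem_closure_iff.1 h2 _ isOpen_interior h1
  obtain ⟨p, q, r, ht, h, rfl⟩ := M.coarse_form hK
  obtain ⟨p', q', r', ht', h', rfl⟩ := M.coarse_form hK'
  have htt := M.T0.eq_of_mem_interior ht ht' (interior_mono coarse_hull_subset hy1)
    (interior_mono coarse_hull_subset hy2)
  obtain ⟨n1, n2, n3⟩ := ne_of_orient_ne_zero h
  obtain ⟨n1', n2', n3'⟩ := ne_of_orient_ne_zero h'
  have hcen : (1 / 3 : ℝ) • (p + q + r) = (1 / 3 : ℝ) • (p' + q' + r') := by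
    rw [← centroid_three n1 n2 n3, ← centroid_three n1' n2' n3', htt]
  rcases orient_pair_cases h h' htt with he | he
  · rw [hcen, he]
  exfalso
  have m : ∀ x, x ∈ ({p, q, r} : Finset Plane) ↔ x ∈ ({p', q', r'} : Finset Plane) := by
    rw [htt]; simp
  simp only [Finset.mem_insert, Finset.mem_singleton] at m
  have hO : IsOpen (interior (hull {(1 / 3 : ℝ) • (p + q + r), p, q}) ∩
    interior (hull {(1 / 3 : ℝ) • (p' + q' + r'), p', q'})) := isOpen_interior.inter isOpen_interior
  rcases he with rfl | rfl
  · have e1 : ({(1 / 3 : ℝ) • (p' + q' + r'), p', q'} : Finset Plane)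
        = {(1 / 3 : ℝ) • (q + r' + r), r, q} := by
      rw [← hcen, add_comm q]
      congr 1
      ext x; have := m x; simp only [Finset.mem_insert, Finset.mem_singleton] at this ⊢; grind
    have e2 : ({(1 / 3 : ℝ) • (r' + q + r), r', q} : Finset Plane)
        = {(1 / 3 : ℝ) • (q + r' + r), q, r'} := by
      rw [Finset.pair_comm, add_comm q]
    exact coarse_overlap (p := q) (q := r') (r := r) (by rw [orient_swap]; simpa using h) hO
      ⟨hy1, hy2⟩ (fun x hx => e2 ▸ interior_subset hx.1) (fun x hx => e1 ▸ interior_subset hx.2)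
  · have e1 : ({(1 / 3 : ℝ) • (p' + q' + r'), p', q'} : Finset Plane)
        = {(1 / 3 : ℝ) • (p + r' + r), r, p} := by
      rw [← hcen]
      congr 1
      ext x; have := m x; simp only [Finset.mem_insert, Finset.mem_singleton] at this ⊢; grind
    exact coarse_overlap h hO
      ⟨hy1, hy2⟩ (fun x hx => interior_subset hx.1) (fun x hx => e1 ▸ interior_subset hx.2)

theorem mem_cells {K : Finset Plane} {τ : M.Cell} : τ ∈ M.cells K ↔ hull τ.1 ⊆ hull K := by
  simp [cells]

theorem exists_coarse (τ : M.Cell) : ∃ K ∈ M.coarse, τ ∈ M.cells K := by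
  obtain ⟨K, hK, h⟩ := M.refines τ.1 τ.2
  exact ⟨K, hK, M.mem_cells.2 h⟩

theorem coarse_unique {K K' : Finset Plane} (hK : K ∈ M.coarse) (hK' : K' ∈ M.coarse) {τ : M.Cell}
    (h : τ ∈ M.cells K) (h' : τ ∈ M.cells K') : K = K' := by
  obtain ⟨y, hy⟩ := M.Th.interior_hull_nonempty τ.2
  exact M.coarse_eq_of_mem_interior hK hK' (interior_mono (M.mem_cells.1 h) hy)
    (M.mem_cells.1 h' (interior_subset hy))

/-- A coarse element is the union of its fine elements. -/
theorem exists_cell {K : Finset Plane} (hK : K ∈ M.coarse) {x : Plane} (hx : x ∈ hull K) :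
    ∃ τ ∈ M.cells K, x ∈ hull τ.1 := by
  -- A fine triangle through an interior point of `K` lies in some coarse element, which must be
  -- `K`. Boundary points follow by taking closures.
  have hsub : interior (hull K) ⊆ ⋃ τ ∈ M.cells K, hull τ.1 := by
    intro y hy
    obtain ⟨t, ht, hyt⟩ := M.Th.exists_tri (M.coarse_subset_closure hK (interior_subset hy))
    obtain ⟨K', hK', h⟩ := M.exists_coarse ⟨t, ht⟩
    obtain rfl := M.coarse_eq_of_mem_interior hK hK' hy (M.mem_cells.1 h hyt)
    exact mem_biUnion (Finset.mem_coe.2 h) hyt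
  have hcl : IsClosed (⋃ τ ∈ M.cells K, hull τ.1) :=
    isClosed_biUnion_finset fun τ _ => isClosed_hull τ.1
  have h2 := closure_minimal hsub hcl
  rw [(convex_hull K).closure_interior_eq_closure_of_nonempty_interior
      (M.coarse_interior_nonempty hK), (isClosed_hull K).closure_eq] at h2
  simpa using h2 hx

/-- A fine edge of a fine element in `K` that is not contained in the boundary of `K` is an interior
edge, and all fine elements having this edge lie in `K`. -/
theorem cells_of_interior_edge {K : Finset Plane} (hK : K ∈ M.coarse) {e : Finset Plane}
    {τ : M.Cell} (hτ : τ ∈ M.cells K) (he : e ⊆ τ.1) (hfr : ¬ hull e ⊆ frontier (hull K)) :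
    (¬ hull e ⊆ frontier (closure Ω)) ∧ ∀ τ' ∈ M.cellsAt e, τ' ∈ M.cells K := by
  obtain ⟨x, hx, hx'⟩ := not_subset.1 hfr
  have hxK : x ∈ hull K := M.mem_cells.1 hτ (hull_mono he hx)
  have hxi : x ∈ interior (hull K) := by
    rw [frontier, (isClosed_hull K).closure_eq] at hx'
    by_contra h; exact hx' ⟨hxK, h⟩
  constructor
  · intro h
    exact (h hx).2 (interior_mono (M.coarse_subset_closure hK) hxi)
  · intro τ' hτ'
    obtain ⟨K', hK', h⟩ := M.exists_coarse τ'
    have hx2 : x ∈ hull K' := M.mem_cells.1 h (hull_mono (by simpa [cellsAt] using hτ') hx)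
    rwa [M.coarse_eq_of_mem_interior hK hK' hxi hx2]

end TwoLevelMesh

end

/-! ### Fine edges on the edges of the initial triangulation -/

section

theorem hull_singleton (a : Plane) : hull {a} = {a} := by
  simp [hull]

theorem eq_of_mem_hull_of_card_le_one {s : Finset Plane} (hs : s.card ≤ 1) {a b : Plane}
    (ha : a ∈ hull s) (hb : b ∈ hull s) : a = b := by
  rcases Finset.card_le_one_iff_subset_singleton.1 hs with ⟨v, hv⟩
  have h1 := hull_mono hv ha
  have h2 := hull_mono hv hb
  rw [hull_singleton] at h1 h2
  exact h1.trans h2.symm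

namespace Mesh

variable {Ω : Set Plane} (T : Mesh Ω)

theorem tri_third_vertex {t : Finset Plane} {a b : Plane} (ht : t ∈ T.tri) (hab : a ≠ b)
    (h : {a, b} ⊆ t) : ∃ z, t = {a, b, z} ∧ orient a b z ≠ 0 := by
  obtain ⟨a', b', z, he, rfl, -, -⟩ := T.tri_edge_form ht (Finset.card_pair hab) h
  have : ({a', b', z} : Finset Plane) = {a, b, z} := by
    ext x
    have := Finset.ext_iff.1 he x
    simp only [Finset.mem_insert, Finset.mem_singleton] at this ⊢
    grind
  exact ⟨z, this, T.orient_ne_zero (this ▸ ht)⟩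

end Mesh

namespace TwoLevelMesh

variable {Ω : Set Plane} (M : TwoLevelMesh Ω)

theorem mem_fineOn {E e : Finset Plane} : e ∈ M.fineOn E ↔ e ∈ M.Th.edges ∧ hull e ⊆ hull E := by
  simp [fineOn]

theorem mem_cellsAt {e : Finset Plane} {τ : M.Cell} : τ ∈ M.cellsAt e ↔ e ⊆ τ.1 := by
  simp [cellsAt]

theorem mem_fineEp {e : Finset Plane} : e ∈ M.fineEp ↔ ∃ E ∈ M.Ep, e ∈ M.fineOn E := by
  simp only [fineEp, Finset.mem_filter]
  exact ⟨fun h => h.2, fun h => ⟨by obtain ⟨E, -, h⟩ := h; exact (M.mem_fineOn.1 h).1, h⟩⟩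

theorem mem_fineEp0 {e : Finset Plane} : e ∈ M.fineEp0 ↔ ∃ E ∈ M.Ep0, e ∈ M.fineOn E := by
  simp only [fineEp0, Finset.mem_filter]
  exact ⟨fun h => h.2, fun h => ⟨by obtain ⟨E, -, h⟩ := h; exact (M.mem_fineOn.1 h).1, h⟩⟩

theorem mem_Ep0 {E : Finset Plane} : E ∈ M.Ep0 ↔ E ∈ M.Ep ∧ ¬ hull E ⊆ frontier Ω := by
  simp [Ep0]

theorem exists_coarse_of_edge {E : Finset Plane} (hE : E ∈ M.Ep) : ∃ K ∈ M.coarse, E ⊆ K := by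
  obtain ⟨h1, h2⟩ := M.T0.mem_edges.1 hE
  obtain ⟨t, ht, hEt, hc⟩ := M.T0.pure E h1
  obtain ⟨a, b, z, rfl, rfl, -, h⟩ := M.T0.tri_edge_form (M.T0.mem_tri.2 ⟨ht, hc⟩) h2 hEt
  exact ⟨_, M.mem_coarse_of_edge (M.T0.mem_tri.2 ⟨ht, hc⟩) h, Finset.subset_insert _ _⟩

/-- The centroid is not a vertex of the initial mesh: as a face it would have to be a vertex of its
own triangle, which would then be degenerate. This leaves only `p` and `q` as possible endpoints. -/
theorem edge_eq_of_subset {p q r : Plane} {E : Finset Plane} (ht : {p, q, r} ∈ M.T0.tri)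
    (hE : E ∈ M.Ep) (hEK : E ⊆ {(1 / 3 : ℝ) • (p + q + r), p, q}) : E = {p, q} := by
  classical
  have h := M.T0.orient_ne_zero ht
  obtain ⟨hE1, hE2⟩ := M.T0.mem_edges.1 hE
  obtain ⟨n1, n2, n3⟩ := ne_of_orient_ne_zero h
  have hc : (1 / 3 : ℝ) • (p + q + r) ∉ E := by
    intro hc
    have hface : {(1 / 3 : ℝ) • (p + q + r)} ∈ M.T0.complex.faces :=
      M.T0.complex.down_closed hE1 (by simpa using hc) (by simp)
    have hmem : (1 / 3 : ℝ) • (p + q + r) ∈ hull {p, q, r} :=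
      coarse_hull_subset (mem_hull_of_mem (by simp))
    have hx := M.T0.mem_hull_inter hface (M.T0.mem_tri.1 ht).1 (mem_hull_of_mem (by simp)) hmem
    have hin : (1 / 3 : ℝ) • (p + q + r) ∈ ({p, q, r} : Finset Plane) := by
      by_contra hn
      rw [Finset.singleton_inter_of_notMem hn] at hx
      simp [hull] at hx
    apply h
    simp only [Finset.mem_insert, Finset.mem_singleton] at hin
    rcases hin with hv | hv | hv <;>
    · have e0 := congrArg (fun v : Plane => v 0) hv
      have e1 := congrArg (fun v : Plane => v 1) hv
      simp at e0 e1
      rw [orient_def]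
      first
        | linear_combination 3 * (q 0 - p 0) * e1 - 3 * (q 1 - p 1) * e0
        | linear_combination 3 * (r 1 - q 1) * e0 - 3 * (r 0 - q 0) * e1
        | linear_combination 3 * (p 0 - r 0) * e1 - 3 * (p 1 - r 1) * e0
  refine Finset.eq_of_subset_of_card_le ?_ (by rw [hE2, Finset.card_pair n1])
  intro x hx
  have := hEK hx
  rw [Finset.mem_insert] at this
  rcases this with rfl | h
  · exact absurd hx hc
  · exact h

theorem coarse_edge_form {K E : Finset Plane} (hK : K ∈ M.coarse) (hE : E ∈ M.Ep) (hEK : E ⊆ K) :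
    ∃ p q r, {p, q, r} ∈ M.T0.tri ∧ orient p q r ≠ 0 ∧ E = {p, q} ∧
      K = {(1 / 3 : ℝ) • (p + q + r), p, q} := by
  obtain ⟨p, q, r, ht, h, rfl⟩ := M.coarse_form hK
  exact ⟨p, q, r, ht, h, M.edge_eq_of_subset ht hE hEK, rfl⟩

/-- A coarse element has only one edge in the initial triangulation. -/
theorem coarse_edge_unique {K E E' : Finset Plane} (hK : K ∈ M.coarse) (hE : E ∈ M.Ep)
    (hE' : E' ∈ M.Ep) (hEK : E ⊆ K) (hEK' : E' ⊆ K) : E = E' := by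
  obtain ⟨p, q, r, ht, h, rfl⟩ := M.coarse_form hK
  rw [M.edge_eq_of_subset ht hE hEK, M.edge_eq_of_subset ht hE' hEK']

/-- On the side `q r` the coordinate of `p` is zero, and in the subtriangle it dominates the
coordinate of `r`, so that one is zero as well. -/
theorem coarse_inter_left {p q r x : Plane} (h : orient p q r ≠ 0) (hx : x ∈ hull {q, r})
    (hx' : x ∈ hull {(1 / 3 : ℝ) • (p + q + r), p, q}) : x = q := by
  obtain ⟨α, β, h1, h2, h3, rfl⟩ := mem_hull_pair.1 hx
  have l := coarse_coord_le h hx'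
  have e1 : orient q r (α • q + β • r) = 0 := by
    rw [orient_comb_two _ _ _ _ h3, orient_self_left, orient_self_right]; ring
  have e2 : orient p q (α • q + β • r) / orient p q r = β := by
    rw [orient_comb_two _ _ _ _ h3, orient_self_right]; field_simp; ring
  rw [e1, e2, zero_div] at l
  obtain rfl : β = 0 := le_antisymm l.2.1 l.1
  obtain rfl : α = 1 := by linarith
  simp

theorem coarse_inter_right {p q r x : Plane} (h : orient p q r ≠ 0) (hx : x ∈ hull {r, p})
    (hx' : x ∈ hull {(1 / 3 : ℝ) • (p + q + r), p, q}) : x = p := by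
  obtain ⟨α, β, h1, h2, h3, rfl⟩ := mem_hull_pair.1 hx
  have l := coarse_coord_le h hx'
  have e1 : orient r p (α • r + β • p) = 0 := by
    rw [orient_comb_two _ _ _ _ h3, orient_self_left, orient_self_right]; ring
  have e2 : orient p q (α • r + β • p) / orient p q r = α := by
    rw [orient_comb_two _ _ _ _ h3, orient_self_left]; field_simp; ring
  rw [e1, e2, zero_div] at l
  obtain rfl : α = 0 := le_antisymm l.2.2 l.1
  obtain rfl : β = 1 := by linarith
  simp

theorem subset_pair_of_not_subset {α : Type*} [DecidableEq α] {p q r : α} {E : Finset α}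
    (h : E ⊆ {p, q, r}) (hc : E.card ≤ 2) (hn : ¬ E ⊆ {p, q}) : E ⊆ {q, r} ∨ E ⊆ {r, p} := by
  by_cases hp : p ∈ E
  · right
    have hr : r ∈ E := by
      by_contra hr
      refine hn fun x hx => ?_
      have := h hx
      simp only [Finset.mem_insert, Finset.mem_singleton] at this ⊢
      rcases this with h1 | h1 | h1
      · exact Or.inl h1
      · exact Or.inr h1
      · exact absurd (h1 ▸ hx) hr
    by_cases hpr : p = r
    · subst hpr
      exact absurd (fun x hx => by
        have := h hx
        simp only [Finset.mem_insert, Finset.mem_singleton] at this ⊢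
        tauto) hn
    · have : ({r, p} : Finset α) = E := by
        refine Finset.eq_of_subset_of_card_le ?_ ?_
        · intro x hx
          simp only [Finset.mem_insert, Finset.mem_singleton] at hx
          rcases hx with rfl | rfl <;> assumption
        · rw [Finset.card_pair (Ne.symm hpr)]; exact hc
      exact this.ge
  · left
    intro x hx
    have := h hx
    simp only [Finset.mem_insert, Finset.mem_singleton] at this ⊢
    rcases this with h1 | h1
    · exact absurd (h1 ▸ hx) hp
    · exact h1

/-- If a fine element in `K` has a fine edge lying in the edge `E` of the initial triangulation,
then `E` is an edge of `K`. -/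
theorem edge_subset_of_cell {K E e : Finset Plane} (hK : K ∈ M.coarse) (hE : E ∈ M.Ep)
    (he : e ∈ M.fineOn E) {τ : M.Cell} (hτ : τ ∈ M.cells K) (heτ : e ⊆ τ.1) : E ⊆ K := by
  classical
  obtain ⟨p, q, r, ht, h, rfl⟩ := M.coarse_form hK
  obtain ⟨he1, he2⟩ := M.mem_fineOn.1 he
  obtain ⟨hE1, hE2⟩ := M.T0.mem_edges.1 hE
  obtain ⟨a, b, hab, rfl⟩ := Finset.card_eq_two.1 (M.Th.mem_edges.1 he1).2
  have hmem : ∀ x ∈ ({a, b} : Finset Plane), x ∈ hull (E ∩ {p, q, r}) ∧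
      x ∈ hull {(1 / 3 : ℝ) • (p + q + r), p, q} := by
    intro x hx
    have h1 := M.mem_cells.1 hτ (mem_hull_of_mem (heτ hx))
    exact ⟨M.T0.mem_hull_inter hE1 (M.T0.mem_tri.1 ht).1 (he2 (mem_hull_of_mem hx))
      (coarse_hull_subset h1), h1⟩
  have ha := hmem a (by simp)
  have hb := hmem b (by simp)
  -- Otherwise `E` would meet the triangle in at most one point, while both endpoints of the fine
  -- edge lie there.
  have hc : E ∩ {p, q, r} = E := by
    refine Finset.eq_of_subset_of_card_le Finset.inter_subset_left ?_
    by_contra hlt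
    exact hab (eq_of_mem_hull_of_card_le_one (by omega) ha.1 hb.1)
  have hEt : E ⊆ {p, q, r} := Finset.inter_eq_left.1 hc
  rw [hc] at ha hb
  by_contra hne
  have hsub := subset_pair_of_not_subset hEt hE2.le
    (fun hs => hne (hs.trans (Finset.subset_insert _ _)))
  -- The other two sides of the triangle meet `K` in a single point each, which cannot contain both
  -- endpoints of the fine edge.
  rcases hsub with hs | hs
  · exact hab ((coarse_inter_left h (hull_mono hs ha.1) ha.2).trans (coarse_inter_left h (hull_mono hs hb.1) hb.2).symm)
  · exact hab ((coarse_inter_right h (hull_mono hs ha.1) ha.2).trans (coarse_inter_right h (hull_mono hs hb.1) hb.2).symm)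

/-- Every fine edge lying in an edge `E` of `K` belongs to a fine element in `K`. -/
theorem exists_cell_of_fineOn {K E e : Finset Plane} (hK : K ∈ M.coarse) (hEK : E ⊆ K)
    (he : e ∈ M.fineOn E) : ∃ τ ∈ M.cells K, e ⊆ τ.1 := by
  classical
  obtain ⟨he1, he2⟩ := M.mem_fineOn.1 he
  obtain ⟨hef, hec⟩ := M.Th.mem_edges.1 he1
  obtain ⟨a, b, hab, rfl⟩ := Finset.card_eq_two.1 hec
  have hm : (1 / 2 : ℝ) • a + (1 / 2 : ℝ) • b ∈ hull {a, b} :=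
    mem_hull_pair.2 ⟨_, _, by norm_num, by norm_num, by norm_num, rfl⟩
  obtain ⟨τ, hτ, hmτ⟩ := M.exists_cell hK (hull_mono hEK (he2 hm))
  refine ⟨τ, hτ, ?_⟩
  have hx := M.Th.mem_hull_inter hef (M.Th.mem_tri.1 τ.2).1 hm hmτ
  -- The midpoint of the fine edge lies in the common face with `τ`. If one endpoint were not a
  -- vertex of `τ`, that face would reduce to the other endpoint.
  have key : ∀ v : Plane, ({a, b} : Finset Plane) ∩ τ.1 ⊆ {v} →
      (1 / 2 : ℝ) • a + (1 / 2 : ℝ) • b = v := by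
    intro v h
    have := hull_mono h hx
    rwa [hull_singleton] at this
  intro v hv
  by_contra hn
  simp only [Finset.mem_insert, Finset.mem_singleton] at hv
  rcases hv with rfl | rfl
  · have h1 := key b (by
      intro w hw; simp only [Finset.mem_inter, Finset.mem_insert, Finset.mem_singleton] at hw ⊢
      rcases hw with ⟨rfl | h, h'⟩
      · exact absurd h' hn
      · exact h)
    apply hab
    have h2 : (1 / 2 : ℝ) • (v - b) = 0 := by
      rw [← sub_eq_zero] at h1; rw [← h1]; module
    simpa [sub_eq_zero] using h2
  · have h1 := key a (by
      intro w hw; simp only [Finset.mem_inter, Finset.mem_insert, Finset.mem_singleton] at hw ⊢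
      rcases hw with ⟨h | rfl, h'⟩
      · exact h
      · exact absurd h' hn)
    apply hab
    have h2 : (1 / 2 : ℝ) • (a - v) = 0 := by
      rw [← sub_eq_zero, ← neg_eq_zero] at h1; rw [← h1]; module
    simpa [sub_eq_zero] using h2

theorem edge_inner_eq_zero {E : Finset Plane} {n a b : Plane} (hE : E.card = 2)
    (hn : ∀ x ∈ E, ∀ y ∈ E, inner ℝ (y - x) n = 0)
    (ha : a ∈ hull E) (hb : b ∈ hull E) : inner ℝ (b - a) n = 0 := by
  obtain ⟨p, q, -, rfl⟩ := Finset.card_eq_two.1 hE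
  obtain ⟨s, rfl⟩ := exists_eq_add_smul ha
  obtain ⟨t, rfl⟩ := exists_eq_add_smul hb
  have : p + t • (q - p) - (p + s • (q - p)) = (t - s) • (q - p) := by module
  rw [this, inner_smul_left, hn p (by simp) q (by simp), mul_zero]

/-- The fine element in `K` that has a given fine edge on the boundary is unique. -/
theorem cell_unique_of_fineOn {K E e : Finset Plane} (hK : K ∈ M.coarse) (hE : E ∈ M.Ep)
    (hEK : E ⊆ K) (he : e ∈ M.fineOn E) {τ τ' : M.Cell} (hτ : τ ∈ M.cells K) (hτ' : τ' ∈ M.cells K)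
    (h : e ⊆ τ.1) (h' : e ⊆ τ'.1) : τ = τ' := by
  obtain ⟨he1, he2⟩ := M.mem_fineOn.1 he
  obtain ⟨a, b, hab, rfl⟩ := Finset.card_eq_two.1 (M.Th.mem_edges.1 he1).2
  obtain ⟨p, q, r, ht, hD, rfl, rfl⟩ := M.coarse_edge_form hK hE hEK
  obtain ⟨z, hz, ho⟩ := M.Th.tri_third_vertex τ.2 hab h
  obtain ⟨z', hz', ho'⟩ := M.Th.tri_third_vertex τ'.2 hab h'
  obtain ⟨s, rfl⟩ := exists_eq_add_smul (he2 (mem_hull_of_mem (x := a) (by simp)))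
  obtain ⟨t, rfl⟩ := exists_eq_add_smul (he2 (mem_hull_of_mem (x := b) (by simp)))
  have hor : ∀ w : Plane, orient (p + s • (q - p)) (p + t • (q - p)) w = (t - s) * orient p q w := by
    intro w; simp only [orient_def, PiLp.add_apply, PiLp.smul_apply, PiLp.sub_apply, smul_eq_mul]; ring
  have l := (coarse_coord_le hD (M.mem_cells.1 hτ (mem_hull_of_mem (x := z) (by simp [hz])))).1
  have l' := (coarse_coord_le hD (M.mem_cells.1 hτ' (mem_hull_of_mem (x := z') (by simp [hz'])))).1
  -- Both opposite vertices lie in `K`, hence on the same side of the line through `p` and `q`; the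
  -- square absorbs the unknown orientation of the fine edge.
  have hpos : 0 < orient (p + s • (q - p)) (p + t • (q - p)) z
      * orient (p + s • (q - p)) (p + t • (q - p)) z' := by
    refine lt_of_le_of_ne ?_ (mul_ne_zero ho ho').symm
    rw [hor, hor]
    have e : (t - s) * orient p q z * ((t - s) * orient p q z')
        = ((t - s) * orient p q r) ^ 2 *
          ((orient p q z / orient p q r) * (orient p q z' / orient p q r)) := by
      field_simp
    rw [e]
    positivity
  apply Subtype.ext
  rw [hz, hz']
  exact M.Th.eq_of_same_side (hz ▸ τ.2) (hz' ▸ τ'.2) hpos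

/-- On an edge `E` of `K` the outward normals of the fine elements in `K` are a fixed multiple
of a given unit normal. -/
theorem exists_sign {K E : Finset Plane} (hK : K ∈ M.coarse) (hE : E ∈ M.Ep)
    (hEK : E ⊆ K) {n : Plane} (hn : ‖n‖ = 1) (hnE : ∀ x ∈ E, ∀ y ∈ E, inner ℝ (y - x) n = 0) :
    ∃ σ : ℝ, |σ| = 1 ∧ ∀ e ∈ M.fineOn E, ∀ τ ∈ M.cells K, e ⊆ τ.1 → outwardNormal τ.1 e = σ • n := by
  obtain ⟨p, q, r, ht, hD, rfl, rfl⟩ := M.coarse_edge_form hK hE hEK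
  obtain ⟨c, hc⟩ : ∃ c, c = (1 / 3 : ℝ) • (p + q + r) := ⟨_, rfl⟩
  rw [← hc] at hK hEK ⊢
  have hDc : orient p q c ≠ 0 := by
    have := orient_centroid p q r
    rw [← hc, ← orient_rotate] at this
    rw [this]; simpa using hD
  have hx0 := (outwardNormal_eq_of_normal hDc hn (hnE p (by simp) q (by simp))).1
  refine ⟨inner ℝ (p - c) n / |inner ℝ (p - c) n|, ?_, ?_⟩
  · rw [abs_div, abs_abs, div_self (abs_ne_zero.2 hx0)]
  · intro e he τ hτ heτ
    obtain ⟨he1, he2⟩ := M.mem_fineOn.1 he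
    obtain ⟨a, b, hab, rfl⟩ := Finset.card_eq_two.1 (M.Th.mem_edges.1 he1).2
    obtain ⟨z, hz, ho⟩ := M.Th.tri_third_vertex τ.2 hab heτ
    have haE := he2 (mem_hull_of_mem (x := a) (by simp))
    have hbE := he2 (mem_hull_of_mem (x := b) (by simp))
    have hcard : ({p, q} : Finset Plane).card = 2 := (M.T0.mem_edges.1 hE).2
    have hba := edge_inner_eq_zero (E := {p, q}) hcard hnE haE hbE
    obtain ⟨hne, heq⟩ := outwardNormal_eq_of_normal ho hn hba
    rw [hz, heq]
    obtain ⟨α, β, γ, h1, h2, h3, h4, hzz⟩ :=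
      mem_hull_triple.1 (M.mem_cells.1 hτ (mem_hull_of_mem (x := z) (by simp [hz])))
    -- Moving along `E` does not change the component along `n`, so the height of `z` over `E` is
    -- `α` times that of the centroid `c`. As `α` is positive, the sign depends on `K` only.
    have hinner : inner ℝ (a - z) n = α * inner ℝ (p - c) n := by
      have e1 : a - z = (a - p) + α • (p - c) - γ • (q - p) := by
        rw [hzz]
        obtain rfl : β = 1 - α - γ := by linarith
        module
      rw [e1, inner_sub_left, inner_add_left, inner_smul_left, inner_smul_left,
        edge_inner_eq_zero (E := {p, q}) hcard hnE (mem_hull_of_mem (by simp)) haE,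
        hnE p (by simp) q (by simp)]
      simp
    rw [hinner] at hne ⊢
    have hα : 0 < α := lt_of_le_of_ne h1 (Ne.symm (left_ne_zero_of_mul hne))
    rw [abs_mul, abs_of_pos hα, mul_div_mul_left _ _ hα.ne']

end TwoLevelMesh

end

/-! ### Adjacency of the fine triangles in a coarse element -/

section

theorem RT0.eval_zero (x : Plane) : RT0.eval 0 x = 0 := by simp [RT0.eval]

theorem dense_cross_ne_zero {w : Plane} (hw : w ≠ 0) (a : Plane) :
    Dense {y : Plane | cross w (y - a) ≠ 0} := by
  rw [dense_iff_inter_open]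
  rintro O hO ⟨y, hy⟩
  by_contra hcon
  refine hw (eq_zero_of_cross_eq_zero hO hy w a fun x hx => ?_)
  by_contra h
  exact hcon ⟨x, hx, h⟩

theorem continuous_cross (w a : Plane) : Continuous (fun y : Plane => cross w (y - a)) := by
  unfold cross; fun_prop

/-- A linear combination of the vertices of a triangle that is nonnegative on two triangles
adjacent along `a b`, and nonconstant, is positive at the midpoint of `a b`. -/
theorem orient_midpoint_pos {u v w a b z₁ z₂ : Plane} (hD : orient u v w ≠ 0)
    (h1 : orient a b z₁ ≠ 0) (hs : orient a b z₁ * orient a b z₂ < 0)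
    (ha : 0 ≤ orient u v a / orient u v w) (hb : 0 ≤ orient u v b / orient u v w)
    (hz₁ : 0 ≤ orient u v z₁ / orient u v w) (hz₂ : 0 ≤ orient u v z₂ / orient u v w) :
    0 < orient u v ((1 / 2 : ℝ) • a + (1 / 2 : ℝ) • b) / orient u v w := by
  rw [orient_comb_two _ _ _ _ (by norm_num), add_div, mul_div_assoc, mul_div_assoc]
  by_contra hcon
  push Not at hcon
  have ea : orient u v a / orient u v w = 0 := by linarith
  have eb : orient u v b / orient u v w = 0 := by linarith
  have ea' : orient u v a = 0 := by simpa [hD] using ea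
  have eb' : orient u v b = 0 := by simpa [hD] using eb
  -- An affine function vanishing at `a` and `b` is a multiple of `orient a b`. Being nonnegative on
  -- both sides of the edge, it would vanish identically, in contradiction to its value at `w`.
  have hbary : ∀ x, orient u v x = orient a b x / orient a b z₁ * orient u v z₁ := by
    intro x
    conv_lhs => rw [barycentric h1 x]
    rw [orient_comb _ _ _ _ _ (barycentric_sum h1 x), ea', eb']; ring
  have hk : orient a b z₂ / orient a b z₁ < 0 := by
    rw [div_neg_iff]
    rcases mul_neg_iff.1 hs with h | h
    · exact Or.inr ⟨h.2, h.1⟩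
    · exact Or.inl ⟨h.2, h.1⟩
  have e2 : orient u v z₂ / orient u v w
      = orient a b z₂ / orient a b z₁ * (orient u v z₁ / orient u v w) := by
    rw [hbary z₂]; ring
  have hz : orient u v z₁ / orient u v w = 0 := by
    by_contra hne
    have : 0 < orient u v z₁ / orient u v w := lt_of_le_of_ne hz₁ (Ne.symm hne)
    rw [e2] at hz₂
    exact absurd hz₂ (not_le.2 (mul_neg_of_neg_of_pos hk this))
  have hz' : orient u v z₁ = 0 := by simpa [hD] using hz
  exact hD (by rw [hbary w, hz', mul_zero])

/-- The lowest order field on a triangle with unit flux density through one edge. -/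
theorem exists_edge_field {Ω : Set Plane} (T : Mesh Ω) {τ e : Finset Plane} (hτ : τ ∈ T.tri)
    (he : e.card = 2) (heτ : e ⊆ τ) :
    ∃ c : RT0, (∀ x ∈ hull e, inner ℝ (c.eval x) (outwardNormal τ e) = 1) ∧
      ∀ e', e'.card = 2 → e' ⊆ τ → e' ≠ e →
        ∀ x ∈ hull e', inner ℝ (c.eval x) (outwardNormal τ e') = 0 := by
  obtain ⟨a, b, z, rfl, rfl, hab, hD⟩ := T.tri_edge_form hτ he heτ
  have hd : ‖b - a‖ ≠ 0 := by simpa [sub_eq_zero] using hab.symm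
  obtain ⟨k, hk⟩ : ∃ k, k = inner ℝ (a - z) (outwardNormal {a, b, z} {a, b}) := ⟨_, rfl⟩
  have hk0 : k ≠ 0 := by
    have hc : cross (a - z) (b - a) = orient a b z := by simp [cross, orient_def]; ring
    rw [hk, outwardNormal_eq hD, inner_smul_right, inner_rot, hc]
    have := abs_ne_zero.2 hD
    positivity
  -- The field is radial from the opposite vertex `z`, hence tangential to the two other edges,
  -- which contain `z`; `k` normalizes the flux density on `e`.
  have heval : ∀ x, RT0.eval (-(k⁻¹ • z), k⁻¹) x = k⁻¹ • (x - z) := by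
    intro x; simp only [RT0.eval]; module
  refine ⟨(-(k⁻¹ • z), k⁻¹), ?_, ?_⟩
  · intro x hx
    rw [inner_eval_eq _ (inner_sub_outwardNormal hD) hx (mem_hull_of_mem (x := a) (by simp)),
      heval, inner_smul_left, ← hk]
    simpa using inv_mul_cancel₀ hk0
  · intro e' he' hsub hne x hx
    have hz : z ∈ e' := by
      by_contra hz
      refine hne (Finset.eq_of_subset_of_card_le ?_ (by rw [he', he]))
      intro y hy
      have := hsub hy
      simp only [Finset.mem_insert, Finset.mem_singleton] at this ⊢
      rcases this with h | h | h
      · exact Or.inl h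
      · exact Or.inr h
      · exact absurd (h ▸ hy) hz
    obtain ⟨a', b', hab', rfl⟩ := Finset.card_eq_two.1 he'
    obtain ⟨y, hy, hD'⟩ := T.tri_third_vertex hτ hab' hsub
    obtain ⟨s, hs⟩ := exists_eq_add_smul hx
    obtain ⟨t, ht⟩ := exists_eq_add_smul (mem_hull_of_mem hz)
    have hxz : x - z = (s - t) • (b' - a') := by
      rw [hs]
      conv_lhs => rw [ht]
      module
    rw [heval, hxz, hy, inner_smul_left, inner_smul_left, inner_sub_outwardNormal hD']
    simp

namespace TwoLevelMesh

variable {Ω : Set Plane} (M : TwoLevelMesh Ω)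

/-- The fine elements in `K` are connected through common edges. -/
theorem cells_induction {K : Finset Plane} (hK : K ∈ M.coarse) (P : M.Cell → Prop) {τ₀ : M.Cell}
    (hτ₀ : τ₀ ∈ M.cells K) (h₀ : P τ₀)
    (step : ∀ τ ∈ M.cells K, P τ → ∀ τ' ∈ M.cells K, τ ≠ τ' → ∀ e : Finset Plane, e.card = 2 →
      e ⊆ τ.1 → e ⊆ τ'.1 → P τ') : ∀ τ ∈ M.cells K, P τ := by
  classical
  intro τ₁ hτ₁
  by_contra hP
  let V : Finset Plane := Finset.univ.biUnion (fun τ : M.Cell => τ.1)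
  obtain ⟨x, hx, hxV⟩ : ∃ x ∈ interior (hull τ₀.1), x ∉ V := by
    have hd : Dense (⋂ v ∈ (V : Set Plane), ({v}ᶜ : Set Plane)) :=
      dense_biInter_of_isOpen (fun v _ => isOpen_compl_singleton) V.countable_toSet
        (fun v _ => dense_compl_singleton v)
    obtain ⟨x, hx, hx'⟩ := hd.inter_open_nonempty _ isOpen_interior
      (M.Th.interior_hull_nonempty τ₀.2)
    refine ⟨x, hx, fun hV => ?_⟩
    simp only [mem_iInter] at hx'
    exact hx' x hV rfl
  -- The point `y` avoids the finitely many lines joining `x` to a vertex, so the segment from `x`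
  -- to `y` meets no vertex. That `x` is itself no vertex makes these lines proper.
  obtain ⟨y, hy, hyV⟩ : ∃ y ∈ interior (hull τ₁.1), ∀ v ∈ V, cross (v - x) (y - x) ≠ 0 := by
    have hd : Dense (⋂ v ∈ (V : Set Plane), {y : Plane | cross (v - x) (y - x) ≠ 0}) := by
      refine dense_biInter_of_isOpen (fun v _ => ?_) V.countable_toSet (fun v hv => ?_)
      · exact isOpen_ne_fun (continuous_cross _ _) continuous_const
      · refine dense_cross_ne_zero ?_ x
        rw [sub_ne_zero]; rintro rfl; exact hxV hv
    obtain ⟨y, hy, hy'⟩ := hd.inter_open_nonempty _ isOpen_interior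
      (M.Th.interior_hull_nonempty τ₁.2)
    simp only [mem_iInter] at hy'
    exact ⟨y, hy, fun v hv => hy' v hv⟩
  have hseg : segment ℝ x y ⊆ hull K := (convex_hull K).segment_subset
    (M.mem_cells.1 hτ₀ (interior_subset hx)) (M.mem_cells.1 hτ₁ (interior_subset hy))
  have hpre := (convex_segment (𝕜 := ℝ) x y).isPreconnected
  rw [isPreconnected_closed_iff] at hpre
  -- If `P` failed somewhere, the triangles with and without `P` would form two closed sets covering
  -- the connected segment, so they would share a point of it.
  obtain ⟨w, hw, hwA, hwB⟩ := hpre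
    (⋃ τ ∈ (M.cells K).filter P, hull τ.1) (⋃ τ ∈ (M.cells K).filter (fun τ => ¬ P τ), hull τ.1)
    (isClosed_biUnion_finset fun τ _ => isClosed_hull τ.1)
    (isClosed_biUnion_finset fun τ _ => isClosed_hull τ.1)
    (by
      intro w hw
      obtain ⟨τ, hτ, hwτ⟩ := M.exists_cell hK (hseg hw)
      by_cases hPτ : P τ
      · left
        simp only [mem_iUnion, Finset.mem_filter]
        exact ⟨τ, ⟨hτ, hPτ⟩, hwτ⟩
      · right
        simp only [mem_iUnion, Finset.mem_filter]
        exact ⟨τ, ⟨hτ, hPτ⟩, hwτ⟩)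
    ⟨x, left_mem_segment ℝ x y, by
      simp only [mem_iUnion, Finset.mem_filter]
      exact ⟨τ₀, ⟨hτ₀, h₀⟩, interior_subset hx⟩⟩
    ⟨y, right_mem_segment ℝ x y, by
      simp only [mem_iUnion, Finset.mem_filter]
      exact ⟨τ₁, ⟨hτ₁, hP⟩, interior_subset hy⟩⟩
  simp only [mem_iUnion, Finset.mem_filter] at hwA hwB
  obtain ⟨τ, ⟨hτ, hPτ⟩, hwτ⟩ := hwA
  obtain ⟨τ', ⟨hτ', hPτ'⟩, hwτ'⟩ := hwB
  have hne : τ ≠ τ' := by rintro rfl; exact hPτ' hPτ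
  have hmem := M.Th.mem_hull_inter (M.Th.mem_tri.1 τ.2).1 (M.Th.mem_tri.1 τ'.2).1 hwτ hwτ'
  have hcard : (τ.1 ∩ τ'.1).card ≤ 2 := by
    by_contra hgt
    have c1 := (M.Th.mem_tri.1 τ.2).2
    have c2 := (M.Th.mem_tri.1 τ'.2).2
    have e1 : τ.1 ∩ τ'.1 = τ.1 :=
      Finset.eq_of_subset_of_card_le Finset.inter_subset_left (by omega)
    have e2 : τ.1 ∩ τ'.1 = τ'.1 :=
      Finset.eq_of_subset_of_card_le Finset.inter_subset_right (by omega)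
    exact hne (Subtype.ext (e1.symm.trans e2))
  have hne2 : (τ.1 ∩ τ'.1).card ≠ 2 := fun h2 => hPτ' (step τ hτ hPτ τ' hτ' hne _ h2
    Finset.inter_subset_left Finset.inter_subset_right)
  have hnon : (τ.1 ∩ τ'.1).Nonempty := by
    rw [Finset.nonempty_iff_ne_empty]
    intro h
    rw [h] at hmem
    simp [hull] at hmem
  obtain ⟨v, hv⟩ := hnon
  -- Two distinct triangles share at most an edge, and a common edge is excluded by `step`. The
  -- shared point is therefore a vertex on the segment.
  have hwv : w = v := eq_of_mem_hull_of_card_le_one (by omega) hmem (mem_hull_of_mem hv)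
  refine hyV v (Finset.mem_biUnion.2 ⟨τ, Finset.mem_univ _, (Finset.mem_inter.1 hv).1⟩) ?_
  rw [← hwv]
  obtain ⟨α, β, -, -, h3, rfl⟩ := hw
  obtain rfl : α = 1 - β := by linarith
  simp [cross]; ring

/-- A common edge of two fine elements in `K` is not contained in the boundary of `K`. -/
theorem common_edge_not_subset_frontier {K e : Finset Plane} (hK : K ∈ M.coarse) {τ τ' : M.Cell}
    (hτ : τ ∈ M.cells K) (hτ' : τ' ∈ M.cells K) (hne : τ ≠ τ') (he : e.card = 2) (h : e ⊆ τ.1)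
    (h' : e ⊆ τ'.1) : ¬ hull e ⊆ frontier (hull K) := by
  intro hfr
  obtain ⟨a, b, hab, rfl⟩ := Finset.card_eq_two.1 he
  obtain ⟨z, hz, ho⟩ := M.Th.tri_third_vertex τ.2 hab h
  obtain ⟨z', hz', ho'⟩ := M.Th.tri_third_vertex τ'.2 hab h'
  have hs : orient a b z * orient a b z' < 0 := by
    by_contra hcon
    push Not at hcon
    refine hne (Subtype.ext ?_)
    rw [hz, hz']
    exact M.Th.eq_of_same_side (hz ▸ τ.2) (hz' ▸ τ'.2)
      (lt_of_le_of_ne hcon (mul_ne_zero ho ho').symm)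
  obtain ⟨p, q, r, -, hD, rfl⟩ := M.coarse_form hK
  have hD' : orient ((1 / 3 : ℝ) • (p + q + r)) p q ≠ 0 := by rw [orient_centroid]; simpa using hD
  obtain ⟨c, hc⟩ : ∃ c, c = (1 / 3 : ℝ) • (p + q + r) := ⟨_, rfl⟩
  rw [← hc] at hD' hτ hτ' hfr
  have mz := M.mem_cells.1 hτ (mem_hull_of_mem (x := z) (by simp [hz]))
  have mz' := M.mem_cells.1 hτ' (mem_hull_of_mem (x := z') (by simp [hz']))
  have ma := M.mem_cells.1 hτ (mem_hull_of_mem (h (show a ∈ _ by simp)))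
  have mb := M.mem_cells.1 hτ (mem_hull_of_mem (h (show b ∈ _ by simp)))
  have hm : (1 / 2 : ℝ) • a + (1 / 2 : ℝ) • b ∈ hull {a, b} :=
    mem_hull_pair.2 ⟨_, _, by norm_num, by norm_num, by norm_num, rfl⟩
  refine (hfr hm).2 (mem_interior_hull hD' ?_ ?_ ?_)
  · have e : ({c, p, q} : Finset Plane) = {p, q, c} := by ext x; simp; tauto
    rw [e] at mz mz' ma mb
    rw [← orient_rotate c p q] at hD' ⊢
    exact orient_midpoint_pos hD' ho hs (orient_nonneg_of_mem hD' ma) (orient_nonneg_of_mem hD' mb)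
      (orient_nonneg_of_mem hD' mz) (orient_nonneg_of_mem hD' mz')
  · have e : ({c, p, q} : Finset Plane) = {q, c, p} := by ext x; simp; tauto
    rw [e] at mz mz' ma mb
    rw [orient_rotate q c p] at hD' ⊢
    exact orient_midpoint_pos hD' ho hs (orient_nonneg_of_mem hD' ma) (orient_nonneg_of_mem hD' mb)
      (orient_nonneg_of_mem hD' mz) (orient_nonneg_of_mem hD' mz')
  · exact orient_midpoint_pos hD' ho hs (orient_nonneg_of_mem hD' ma) (orient_nonneg_of_mem hD' mb)
      (orient_nonneg_of_mem hD' mz) (orient_nonneg_of_mem hD' mz')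

theorem restr_of_mem {α : Type} [Zero α] {K : Finset Plane} {w : M.Cell → α} {τ : M.Cell}
    (h : τ ∈ M.cells K) : M.restr K w τ = w τ := by simp [restr, h]

theorem restr_of_notMem {α : Type} [Zero α] {K : Finset Plane} {w : M.Cell → α} {τ : M.Cell}
    (h : τ ∉ M.cells K) : M.restr K w τ = 0 := by simp [restr, h]

open Classical in
/-- For two adjacent fine elements in `K` there is a field in `V_{h,0}(K)` that carries a unit flux
density from one to the other. -/
theorem exists_transfer_field {K e : Finset Plane} (hK : K ∈ M.coarse) {τ₁ τ₂ : M.Cell}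
    (hτ₁ : τ₁ ∈ M.cells K) (hτ₂ : τ₂ ∈ M.cells K) (hne : τ₁ ≠ τ₂) (he : e.card = 2) (h₁ : e ⊆ τ₁.1)
    (h₂ : e ⊆ τ₂.1) : ∃ w ∈ M.VhLoc0 K, (∀ τ, τ ≠ τ₁ → τ ≠ τ₂ → w τ = 0) ∧
      ∫ x in hull τ₁.1, divergence (w τ₁).eval x = edgeLength e ∧
      ∫ x in hull τ₂.1, divergence (w τ₂).eval x = -edgeLength e := by
  obtain ⟨c₁, hc₁, hc₁'⟩ := exists_edge_field M.Th τ₁.2 he h₁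
  obtain ⟨c₂, hc₂, hc₂'⟩ := exists_edge_field M.Th τ₂.2 he h₂
  have hneg : ∀ x, RT0.eval (-c₂) x = -RT0.eval c₂ x := by intro x; simp [RT0.eval]; abel
  -- Flux leaves `τ₁` through `e` and enters `τ₂`: opposite signs relative to the two outward
  -- normals make the jump on `e` vanish.
  let w : M.BrokenRT := fun τ => if τ = τ₁ then c₁ else if τ = τ₂ then -c₂ else 0
  have w1 : w τ₁ = c₁ := by simp [w]
  have w2 : w τ₂ = -c₂ := by simp [w, hne.symm]
  have w0 : ∀ τ, τ ≠ τ₁ → τ ≠ τ₂ → w τ = 0 := by intro τ a b; simp [w, a, b]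
  have hzero : ∀ τ : M.Cell, ∀ e' : Finset Plane, e'.card = 2 → e' ⊆ τ.1 → e' ≠ e → ∀ x ∈ hull e',
      inner ℝ ((w τ).eval x) (outwardNormal τ.1 e') = 0 := by
    intro τ e' he' hs hne' x hx
    by_cases a : τ = τ₁
    · subst a; rw [w1]; exact hc₁' e' he' hs hne' x hx
    by_cases b : τ = τ₂
    · subst b; rw [w2, hneg, inner_neg_left, hc₂' e' he' hs hne' x hx, neg_zero]
    · rw [w0 τ a b, RT0.eval_zero, inner_zero_left]
  have hint : ∀ (τ : M.Cell) (c : RT0), e ⊆ τ.1 → ∀ s : ℝ,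
      (∀ x ∈ hull e, inner ℝ (c.eval x) (outwardNormal τ.1 e) = s) →
      (∀ e', e'.card = 2 → e' ⊆ τ.1 → e' ≠ e →
        ∀ x ∈ hull e', inner ℝ (c.eval x) (outwardNormal τ.1 e') = 0) →
      ∫ x in hull τ.1, divergence c.eval x = edgeLength e * s := by
    intro τ c heτ s h1 h2
    rw [setIntegral_divergence (M.Th.mem_tri.1 τ.2).2 (M.Th.complex.indep (M.Th.mem_tri.1 τ.2).1),
      Finset.sum_eq_single e]
    · rw [flux, h1 _ (centroid_mem_hull (Finset.card_pos.1 (by omega)))]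
    · intro e' he' hne'
      obtain ⟨hs, hcd⟩ := Finset.mem_powersetCard.1 he'
      rw [flux, h2 e' hcd hs hne' _ (centroid_mem_hull (Finset.card_pos.1 (by omega))), mul_zero]
    · intro h; exact absurd (Finset.mem_powersetCard.2 ⟨heτ, he⟩) h
  refine ⟨w, ⟨⟨w, ?_, ?_⟩, ?_⟩, w0, ?_, ?_⟩
  · intro e' he' _ x hx
    unfold jump
    by_cases hee : e' = e
    · subst hee
      rw [Finset.sum_eq_add_of_mem τ₁ τ₂ (M.mem_cellsAt.2 h₁) (M.mem_cellsAt.2 h₂) hne, w1, w2,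
        hneg, inner_neg_left, hc₁ x hx, hc₂ x hx]
      · norm_num
      · intro τ _ hτ
        rw [w0 τ hτ.1 hτ.2, RT0.eval_zero, inner_zero_left]
    · exact Finset.sum_eq_zero fun τ hτ =>
        hzero τ e' (M.Th.mem_edges.1 he').2 (M.mem_cellsAt.1 hτ) hee x hx
  · funext τ
    by_cases hτ : τ ∈ M.cells K
    · exact M.restr_of_mem hτ
    · rw [M.restr_of_notMem hτ, w0]
      · rintro rfl; exact hτ hτ₁
      · rintro rfl; exact hτ hτ₂
  · intro τ hτ e' he' hs hfr x hx
    refine hzero τ e' (M.Th.mem_edges.1 he').2 hs ?_ x hx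
    rintro rfl
    exact M.common_edge_not_subset_frontier hK hτ₁ hτ₂ hne he h₁ h₂ hfr
  · rw [w1, hint τ₁ c₁ h₁ 1 hc₁ hc₁', mul_one]
  · rw [w2, hint τ₂ (-c₂) h₂ (-1) (fun x hx => by rw [hneg, inner_neg_left, hc₂ x hx])
      (fun e' a b c x hx => by rw [hneg, inner_neg_left, hc₂' e' a b c x hx, neg_zero])]
    ring

end TwoLevelMesh

end

section

/-! ### Linear algebra of orthonormal systems -/

section LinearAlgebra

variable {ι : Type*}

theorem sum_weighted_comb {N : ℕ} (S : Finset ι) (r : ι → ℝ) (p : Fin N → ι → ℝ)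
    (horth : ∀ j k, ∑ i ∈ S, r i * (p j i * p k i) = if j = k then 1 else 0)
    (J : Finset (Fin N)) (c : Fin N → ℝ) (k : Fin N) :
    ∑ i ∈ S, r i * ((∑ j ∈ J, c j * p j i) * p k i) = if k ∈ J then c k else 0 := by
  have h : ∀ i, r i * ((∑ j ∈ J, c j * p j i) * p k i) = ∑ j ∈ J, c j * (r i * (p j i * p k i)) := by
    intro i
    rw [Finset.sum_mul, Finset.mul_sum]
    exact Finset.sum_congr rfl fun j _ => by ring
  simp_rw [h]
  rw [Finset.sum_comm]
  simp_rw [← Finset.mul_sum, horth]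
  simp

theorem sum_weighted_sq {N : ℕ} (S : Finset ι) (r : ι → ℝ) (p : Fin N → ι → ℝ)
    (horth : ∀ j k, ∑ i ∈ S, r i * (p j i * p k i) = if j = k then 1 else 0)
    (J : Finset (Fin N)) (c : Fin N → ℝ) :
    ∑ i ∈ S, r i * ((∑ j ∈ J, c j * p j i) * (∑ j ∈ J, c j * p j i)) = ∑ j ∈ J, c j ^ 2 := by
  have h : ∀ i, r i * ((∑ j ∈ J, c j * p j i) * (∑ j ∈ J, c j * p j i))
      = ∑ k ∈ J, c k * (r i * ((∑ j ∈ J, c j * p j i) * p k i)) := by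
    intro i
    rw [Finset.mul_sum (a := ∑ j ∈ J, c j * p j i), Finset.mul_sum]
    exact Finset.sum_congr rfl fun j _ => by ring
  simp_rw [h]
  rw [Finset.sum_comm]
  simp_rw [← Finset.mul_sum, sum_weighted_comb S r p horth]
  exact Finset.sum_congr rfl fun k hk => by rw [if_pos hk]; ring

/-- An orthonormal system of maximal size among the functions of weighted mean zero is complete. -/
theorem orthonormal_complete (S : Finset ι) (r a : ι → ℝ) (ha : ∀ i ∈ S, 0 < a i)
    (p : Fin (S.card - 1) → ι → ℝ) (hp : ∀ j, ∑ i ∈ S, a i * p j i = 0)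
    (horth : ∀ j k, ∑ i ∈ S, r i * (p j i * p k i) = if j = k then 1 else 0)
    (q : ι → ℝ) (hq : ∑ i ∈ S, a i * q i = 0) :
    ∀ i ∈ S, q i = ∑ j, (∑ i ∈ S, r i * (q i * p j i)) * p j i := by
  classical
  intro i₀ hi₀
  let L : (S → ℝ) →ₗ[ℝ] ℝ := ∑ i : S, a i • LinearMap.proj i
  have hL : ∀ f : ι → ℝ, L (fun i => f i) = ∑ i ∈ S, a i * f i := by
    intro f
    simp only [L, LinearMap.sum_apply, LinearMap.smul_apply, LinearMap.proj_apply, smul_eq_mul]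
    exact Finset.sum_coe_sort S (fun i => a i * f i)
  -- The functions on `S` of weighted mean zero form the kernel of a nonzero functional, so their
  -- dimension equals the number of functions in the orthonormal system.
  have hker : Module.finrank ℝ (LinearMap.ker L) = S.card - 1 := by
    have h1 := LinearMap.finrank_range_add_finrank_ker L
    have h2 : LinearMap.range L = ⊤ := by
      rw [LinearMap.range_eq_top]
      intro c
      refine ⟨Pi.single ⟨i₀, hi₀⟩ (c / a i₀), ?_⟩
      simp only [L, LinearMap.sum_apply, LinearMap.smul_apply, LinearMap.proj_apply, smul_eq_mul]
      rw [Finset.sum_eq_single ⟨i₀, hi₀⟩]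
      · have := (ha i₀ hi₀).ne'
        simp; field_simp
      · intro b _ hb; simp [hb]
      · simp
    rw [h2, finrank_top, Module.finrank_self, Module.finrank_fintype_fun_eq_card, Fintype.card_coe]
      at h1
    omega
  let b : Fin (S.card - 1) → LinearMap.ker L := fun j => ⟨fun i => p j i, by
    rw [LinearMap.mem_ker, hL, hp]⟩
  have hli : LinearIndependent ℝ b := by
    rw [Fintype.linearIndependent_iff]
    intro g hg k
    have h0 : ∀ i ∈ S, ∑ j, g j * p j i = 0 := by
      intro i hi
      have := congrArg (fun v : LinearMap.ker L => (v : S → ℝ) ⟨i, hi⟩) hg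
      simpa [b] using this
    have h1 := sum_weighted_comb S r p horth Finset.univ g k
    rw [if_pos (Finset.mem_univ _)] at h1
    rw [← h1]
    exact Finset.sum_eq_zero fun i hi => by rw [h0 i hi]; ring
  have hspan := hli.span_eq_top_of_card_eq_finrank' (by rw [hker, Fintype.card_fin])
  have hmem : (⟨fun i => q i, by rw [LinearMap.mem_ker, hL, hq]⟩ : LinearMap.ker L) ∈
      Submodule.span ℝ (Set.range b) := by rw [hspan]; trivial
  obtain ⟨c, hc⟩ := (Submodule.mem_span_range_iff_exists_fun ℝ).1 hmem
  have hc' : ∀ i ∈ S, q i = ∑ j, c j * p j i := by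
    intro i hi
    have := congrArg (fun v : LinearMap.ker L => (v : S → ℝ) ⟨i, hi⟩) hc
    simpa [b] using this.symm
  have hcoef : ∀ k, ∑ i ∈ S, r i * (q i * p k i) = c k := by
    intro k
    have h1 := sum_weighted_comb S r p horth Finset.univ c k
    rw [if_pos (Finset.mem_univ _)] at h1
    rw [← h1]
    exact Finset.sum_congr rfl fun i hi => by rw [hc' i hi]
  simp_rw [hcoef]
  exact hc' i₀ hi₀

theorem form_sum_sum {V : Type*} [AddCommGroup V] [Module ℝ V] (A : V →ₗ[ℝ] V →ₗ[ℝ] ℝ)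
    {N : ℕ} (φ : Fin N → V) (d : Fin N → ℝ) (hφ : ∀ i j, A (φ i) (φ j) = if i = j then d i else 0)
    (J : Finset (Fin N)) (c : Fin N → ℝ) :
    A (∑ j ∈ J, c j • φ j) (∑ j ∈ J, c j • φ j) = ∑ j ∈ J, c j ^ 2 * d j := by
  simp only [map_sum, map_smul, LinearMap.sum_apply, LinearMap.smul_apply, smul_eq_mul, hφ]
  refine Finset.sum_congr rfl fun j hj => ?_
  simp [hj]; ring

/-- A duality estimate for a positive semidefinite form. -/
theorem le_of_dual {V : Type*} [AddCommGroup V] [Module ℝ V] (A : V →ₗ[ℝ] V →ₗ[ℝ] ℝ)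
    (hpos : ∀ x, 0 ≤ A x x) (hsymm : ∀ x y, A x y = A y x) {v w : V} {S L : ℝ} (hS : 0 ≤ S)
    (hL : 0 ≤ L) (h1 : S ≤ |A v w|) (h2 : A w w ≤ L * S) : S ≤ L * A v v := by
  have hcs := LinearMap.BilinForm.apply_sq_le_of_symm A hpos ⟨fun x y => hsymm x y⟩ v w
  -- Cauchy–Schwarz bounds `S²` by a multiple of `S` itself; one factor is cancelled unless `S` is
  -- zero.
  have h3 : S * S ≤ (L * A v v) * S := by
    calc S * S ≤ |A v w| * |A v w| := mul_self_le_mul_self hS h1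
      _ = (A v w) ^ 2 := by rw [abs_mul_abs_self, sq]
      _ ≤ A v v * A w w := hcs
      _ ≤ A v v * (L * S) := mul_le_mul_of_nonneg_left h2 (hpos v)
      _ = (L * A v v) * S := by ring
  rcases hS.eq_or_lt with h | h
  · rw [← h]; exact mul_nonneg hL (hpos v)
  · exact le_of_mul_le_mul_right h3 h

end LinearAlgebra

/-! ### Coefficients and forms -/

/-- The properties of a coefficient on triangles that are used for the bilinear forms. -/
structure CoeffBounds {Ω : Set Plane} (T : Mesh Ω) (κ : Plane → ℝ) (a b : ℝ) : Prop where
  pos : 0 < a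
  meas : ∀ t ∈ T.tri, AEMeasurable κ (volume.restrict (hull t))
  bound : ∀ t ∈ T.tri, ∀ᵐ x ∂(volume.restrict (hull t)), a ≤ κ x ∧ κ x ≤ b

/-- The mesh only covers the closure of Ω, whose boundary could have positive measure. A triangle
agrees with its interior up to a null set, and that interior lies in Ω because Ω is the interior of
its closure. -/
theorem restrict_hull_le {Ω : Set Plane} (hΩ : interior (closure Ω) = Ω) (T : Mesh Ω)
    {t : Finset Plane} (ht : t ∈ T.tri) :
    (volume : Measure Plane).restrict (hull t) ≤ volume.restrict Ω := by
  have h1 : interior (hull t) =ᵐ[volume] hull t :=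
    interior_ae_eq_of_null_frontier ((convex_hull t).addHaar_frontier volume)
  rw [← Measure.restrict_congr_set h1]
  refine Measure.restrict_mono ?_ le_rfl
  rw [← hΩ]
  exact interior_mono (T.hull_subset ht)

/-- The bounds are fixed before the mesh; this is what makes the final constant independent of it.
-/
theorem IsCoefficient.exists_bounds {Ω : Set Plane} (hΩ : interior (closure Ω) = Ω)
    {κ : Plane → ℝ} (hκ : IsCoefficient Ω κ) : ∃ a b, ∀ T : Mesh Ω, CoeffBounds T κ a b := by
  obtain ⟨hm, a, b, ha, hab⟩ := hκ
  exact ⟨a, b, fun T => ⟨ha, fun t ht => hm.mono_measure (restrict_hull_le hΩ T ht),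
    fun t ht => (ae_mono (restrict_hull_le hΩ T ht)) hab⟩⟩

namespace CoeffBounds

variable {Ω : Set Plane} {T : Mesh Ω} {κ : Plane → ℝ} {a b : ℝ}

theorem integrableOn (h : CoeffBounds T κ a b) {t : Finset Plane} (ht : t ∈ T.tri) {g : Plane → ℝ} (hg : Continuous g) :
    IntegrableOn (fun x => κ x * g x) (hull t) := by
  have hgi : IntegrableOn g (hull t) := hg.continuousOn.integrableOn_compact (isCompact_hull t)
  refine Integrable.bdd_mul (c := b) hgi (h.meas t ht).aestronglyMeasurable ?_
  filter_upwards [h.bound t ht] with x hx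
  rw [Real.norm_eq_abs, abs_of_nonneg (h.pos.le.trans hx.1)]
  exact hx.2

end CoeffBounds

end

/-! ### Bilinear forms on broken spaces -/

section

theorem RT0.eval_add (c d : RT0) (x : Plane) : (c + d).eval x = c.eval x + d.eval x := by
  simp only [RT0.eval, Prod.fst_add, Prod.snd_add]; module

theorem RT0.eval_smul (s : ℝ) (c : RT0) (x : Plane) : (s • c).eval x = s • c.eval x := by
  simp only [RT0.eval, Prod.smul_fst, Prod.smul_snd, smul_eq_mul]; module

theorem RT0.continuous_eval (c : RT0) : Continuous c.eval := by
  unfold RT0.eval; fun_prop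

theorem P1.eval_add (c d : P1) (x : Plane) : (c + d).eval x = c.eval x + d.eval x := by
  simp only [P1.eval, Prod.fst_add, Prod.snd_add, inner_add_left]; ring

theorem P1.eval_sub (c d : P1) (x : Plane) : (c - d).eval x = c.eval x - d.eval x := by
  simp only [P1.eval, Prod.fst_sub, Prod.snd_sub, inner_sub_left]; ring

theorem P1.eval_smul (s : ℝ) (c : P1) (x : Plane) : (s • c).eval x = s * c.eval x := by
  simp only [P1.eval, Prod.smul_fst, Prod.smul_snd, smul_eq_mul, inner_smul_left]
  simp; ring

theorem P1.eval_zero (x : Plane) : P1.eval 0 x = 0 := by simp [P1.eval]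

theorem P1.eval_sum {ι : Type*} (J : Finset ι) (c : ι → P1) (x : Plane) :
    (∑ j ∈ J, c j).eval x = ∑ j ∈ J, (c j).eval x := by
  classical
  induction J using Finset.induction_on with
  | empty => simp [P1.eval_zero]
  | insert a s ha ih => rw [Finset.sum_insert ha, Finset.sum_insert ha, P1.eval_add, ih]

theorem P1.eval_of_snd_eq_zero {c : P1} (h : c.2 = 0) (x : Plane) : c.eval x = c.1 := by
  simp [P1.eval, h]

theorem volume_hull_pos {Ω : Set Plane} (T : Mesh Ω) {t : Finset Plane} (ht : t ∈ T.tri) :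
    0 < (volume : Measure Plane).real (hull t) := by
  obtain ⟨p, q, r, rfl, h⟩ := T.tri_form ht
  rw [volume_triangle h]
  have := abs_pos.2 h
  positivity

namespace TwoLevelMesh

variable {Ω : Set Plane} (M : TwoLevelMesh Ω)

section Forms

variable {M} {κ ρ : Plane → ℝ} {a b : ℝ}

/-- The form `∫ κ v · w` as a bilinear map. -/
def kappaBilin (h : CoeffBounds M.Th κ a b) (S : Finset M.Cell) :
    M.BrokenRT →ₗ[ℝ] M.BrokenRT →ₗ[ℝ] ℝ :=
  have hi : ∀ (τ : M.Cell) (c d : RT0),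
      IntegrableOn (fun x => κ x * inner ℝ (c.eval x) (d.eval x)) (hull τ.1) := fun τ c d =>
    h.integrableOn τ.2 (c.continuous_eval.inner d.continuous_eval)
  LinearMap.mk₂ ℝ (fun v w => M.kappaForm S κ v w)
    (by
      intro v v' w
      simp only [kappaForm, intCells]
      rw [← Finset.sum_add_distrib]
      refine Finset.sum_congr rfl fun τ _ => ?_
      rw [← integral_add (hi _ _ _) (hi _ _ _)]
      simp only [Pi.add_apply, RT0.eval_add, inner_add_left, mul_add])
    (by
      intro s v w
      simp only [kappaForm, intCells]
      rw [smul_eq_mul, Finset.mul_sum]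
      refine Finset.sum_congr rfl fun τ _ => ?_
      rw [← integral_const_mul]
      simp only [Pi.smul_apply, RT0.eval_smul, inner_smul_left, RCLike.conj_to_real, mul_left_comm])
    (by
      intro v w w'
      simp only [kappaForm, intCells]
      rw [← Finset.sum_add_distrib]
      refine Finset.sum_congr rfl fun τ _ => ?_
      rw [← integral_add (hi _ _ _) (hi _ _ _)]
      simp only [Pi.add_apply, RT0.eval_add, inner_add_right, mul_add])
    (by
      intro s v w
      simp only [kappaForm, intCells]
      rw [smul_eq_mul, Finset.mul_sum]
      refine Finset.sum_congr rfl fun τ _ => ?_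
      rw [← integral_const_mul]
      simp only [Pi.smul_apply, RT0.eval_smul, inner_smul_right, mul_left_comm])

theorem kappaBilin_apply (h : CoeffBounds M.Th κ a b) (S : Finset M.Cell) (v w : M.BrokenRT) :
    kappaBilin h S v w = M.kappaForm S κ v w := rfl

theorem kappaForm_symm (S : Finset M.Cell) (v w : M.BrokenRT) :
    M.kappaForm S κ v w = M.kappaForm S κ w v := by
  simp only [kappaForm, real_inner_comm]

theorem kappaForm_self_cell_nonneg (h : CoeffBounds M.Th κ a b) (τ : M.Cell) (c : RT0) :
    0 ≤ ∫ x in hull τ.1, κ x * inner ℝ (c.eval x) (c.eval x) := by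
  refine integral_nonneg_of_ae ?_
  filter_upwards [h.bound τ.1 τ.2] with x hx
  exact mul_nonneg (h.pos.le.trans hx.1) real_inner_self_nonneg

theorem kappaForm_nonneg (h : CoeffBounds M.Th κ a b) (S : Finset M.Cell) (v : M.BrokenRT) :
    0 ≤ M.kappaForm S κ v v :=
  Finset.sum_nonneg fun τ _ => kappaForm_self_cell_nonneg h τ (v τ)

theorem kappaForm_mono (h : CoeffBounds M.Th κ a b) {S S' : Finset M.Cell} (hS : S ⊆ S')
    (v : M.BrokenRT) : M.kappaForm S κ v v ≤ M.kappaForm S' κ v v :=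
  Finset.sum_le_sum_of_subset_of_nonneg hS fun τ _ _ => kappaForm_self_cell_nonneg h τ (v τ)

theorem intCells_eq_of_subset {S S' : Finset M.Cell} (hS : S ⊆ S') {F : M.Cell → Plane → ℝ}
    (h : ∀ τ ∈ S', τ ∉ S → ∀ x, F τ x = 0) : M.intCells S' F = M.intCells S F := by
  symm
  refine Finset.sum_subset hS fun τ h1 h2 => ?_
  simp [h τ h1 h2]

theorem kappaForm_eq_of_subset {S S' : Finset M.Cell} (hS : S ⊆ S') {v w : M.BrokenRT}
    (h : ∀ τ ∈ S', τ ∉ S → w τ = 0) : M.kappaForm S' κ v w = M.kappaForm S κ v w :=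
  intCells_eq_of_subset hS fun τ h1 h2 x => by rw [h τ h1 h2, RT0.eval_zero]; simp

theorem divergence_eval_zero (x : Plane) : divergence (RT0.eval 0) x = 0 := by
  rw [divergence_eval]; simp

theorem divForm_eq_of_subset {S S' : Finset M.Cell} (hS : S ⊆ S') {q : M.BrokenP1} {w : M.BrokenRT}
    (h : ∀ τ ∈ S', τ ∉ S → w τ = 0) : M.divForm S' q w = M.divForm S q w :=
  intCells_eq_of_subset hS fun τ h1 h2 x => by rw [h τ h1 h2, divergence_eval_zero]; simp

theorem kappaForm_congr {S : Finset M.Cell} {v v' w w' : M.BrokenRT} (hv : ∀ τ ∈ S, v τ = v' τ)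
    (hw : ∀ τ ∈ S, w τ = w' τ) : M.kappaForm S κ v w = M.kappaForm S κ v' w' :=
  Finset.sum_congr rfl fun τ hτ => by beta_reduce; rw [hv τ hτ, hw τ hτ]

theorem divForm_congr {S : Finset M.Cell} {q q' : M.BrokenP1} {w w' : M.BrokenRT}
    (hq : ∀ τ ∈ S, q τ = q' τ)
    (hw : ∀ τ ∈ S, w τ = w' τ) : M.divForm S q w = M.divForm S q' w' :=
  Finset.sum_congr rfl fun τ hτ => by beta_reduce; rw [hq τ hτ, hw τ hτ]

theorem divForm_const {S : Finset M.Cell} {q : M.BrokenP1} (hq : ∀ τ ∈ S, (q τ).2 = 0)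
    (w : M.BrokenRT) :
    M.divForm S q w = ∑ τ ∈ S, (q τ).1 * ∫ x in hull τ.1, divergence (w τ).eval x := by
  refine Finset.sum_congr rfl fun τ hτ => ?_
  simp_rw [P1.eval_of_snd_eq_zero (hq τ hτ)]
  rw [integral_const_mul]

theorem rhoForm_const {S : Finset M.Cell} {p q : M.BrokenP1} (hp : ∀ τ ∈ S, (p τ).2 = 0)
    (hq : ∀ τ ∈ S, (q τ).2 = 0) :
    M.rhoForm S ρ p q = ∑ τ ∈ S, (∫ x in hull τ.1, ρ x) * ((p τ).1 * (q τ).1) := by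
  refine Finset.sum_congr rfl fun τ hτ => ?_
  simp_rw [P1.eval_of_snd_eq_zero (hp τ hτ), P1.eval_of_snd_eq_zero (hq τ hτ)]
  rw [integral_mul_const]

theorem intCells_const {S : Finset M.Cell} {q : M.BrokenP1} (hq : ∀ τ ∈ S, (q τ).2 = 0) :
    M.intCells S (fun τ x => (q τ).eval x)
      = ∑ τ ∈ S, (volume : Measure Plane).real (hull τ.1) * (q τ).1 := by
  refine Finset.sum_congr rfl fun τ hτ => ?_
  simp_rw [P1.eval_of_snd_eq_zero (hq τ hτ)]
  rw [setIntegral_const, smul_eq_mul]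

end Forms

/-! ### Local velocity fields as global test fields -/

theorem frontier_closure_eq (hΩ : interior (closure Ω) = Ω) : frontier (closure Ω) = frontier Ω := by
  have hopen : IsOpen Ω := by rw [← hΩ]; exact isOpen_interior
  rw [frontier, closure_closure, hΩ, frontier, hopen.interior_eq]

/-- The jump of a local field vanishes on every edge that is interior to `K` or does not meet the
fine elements in `K`. -/
theorem jump_restr_eq_zero (hΩ : interior (closure Ω) = Ω) {K : Finset Plane} (hK : K ∈ M.coarse)
    {w : M.BrokenRT} (hw : w ∈ M.VhLoc K) {e : Finset Plane} (he : e ∈ M.Th.edges)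
    (hfr : ¬ hull e ⊆ frontier (hull K)) {x : Plane} (hx : x ∈ hull e) : M.jump w e x = 0 := by
  obtain ⟨w₀, hw₀, rfl⟩ := hw
  by_cases hex : ∃ τ ∈ M.cells K, e ⊆ τ.1
  · obtain ⟨τ, hτ, heτ⟩ := hex
    obtain ⟨h1, h2⟩ := M.cells_of_interior_edge hK hτ heτ hfr
    rw [frontier_closure_eq hΩ] at h1
    rw [← hw₀ e he h1 x hx]
    exact Finset.sum_congr rfl fun τ' hτ' => by rw [M.restr_of_mem (h2 τ' hτ')]
  · push Not at hex
    refine Finset.sum_eq_zero fun τ hτ => ?_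
    rw [M.restr_of_notMem fun h => hex τ h (M.mem_cellsAt.1 hτ), RT0.eval_zero, inner_zero_left]

theorem apply_eq_zero_of_mem_VhLoc {K : Finset Plane} {w : M.BrokenRT} (hw : w ∈ M.VhLoc K)
    {τ : M.Cell} (hτ : τ ∉ M.cells K) : w τ = 0 := by
  obtain ⟨w₀, -, rfl⟩ := hw
  exact M.restr_of_notMem hτ

/-- On the boundary of `K` each one-sided normal component vanishes separately, and elsewhere the
field inherits the continuity of a global one. Extension by zero is thus a legitimate global field,
also without flux through the boundary of Ω. -/
theorem jump_eq_zero_of_mem_VhLoc0 (hΩ : interior (closure Ω) = Ω) {K : Finset Plane}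
    (hK : K ∈ M.coarse) {w : M.BrokenRT} (hw : w ∈ M.VhLoc0 K) {e : Finset Plane}
    (he : e ∈ M.Th.edges) {x : Plane} (hx : x ∈ hull e) : M.jump w e x = 0 := by
  by_cases hfr : hull e ⊆ frontier (hull K)
  · refine Finset.sum_eq_zero fun τ hτ => ?_
    by_cases hτK : τ ∈ M.cells K
    · exact hw.2 τ hτK e he (M.mem_cellsAt.1 hτ) hfr x hx
    · rw [M.apply_eq_zero_of_mem_VhLoc hw.1 hτK, RT0.eval_zero, inner_zero_left]
  · exact M.jump_restr_eq_zero hΩ hK hw.1 he hfr hx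

/-- The discrete divergence theorem. -/
theorem sum_divergence_eq_zero {w : M.BrokenRT}
    (hw : ∀ e ∈ M.Th.edges, ∀ x ∈ hull e, M.jump w e x = 0) :
    ∑ τ : M.Cell, ∫ x in hull τ.1, divergence (w τ).eval x = 0 := by
  have h1 : ∀ τ : M.Cell, ∫ x in hull τ.1, divergence (w τ).eval x
      = ∑ e ∈ τ.1.powersetCard 2, flux τ.1 e (w τ) := fun τ =>
    setIntegral_divergence (M.Th.mem_tri.1 τ.2).2 (M.Th.complex.indep (M.Th.mem_tri.1 τ.2).1) _
  simp_rw [h1]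
  -- Collecting the fluxes edge by edge instead of triangle by triangle turns them into jumps.
  rw [Finset.sum_comm' (t' := M.Th.edges) (s' := fun e => M.cellsAt e)]
  · refine Finset.sum_eq_zero fun e he => ?_
    have hne : e.Nonempty := Finset.card_pos.1 (by rw [(M.Th.mem_edges.1 he).2]; norm_num)
    have := hw e he _ (centroid_mem_hull hne)
    unfold flux
    rw [← Finset.mul_sum]
    unfold jump at this
    rw [this, mul_zero]
  · intro τ e
    simp only [Finset.mem_univ, true_and, Finset.mem_powersetCard, mem_cellsAt]
    exact ⟨fun h => ⟨h.1, M.Th.subset_mem_edges τ.2 h.2 h.1⟩,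
      fun h => ⟨h.1, (M.Th.mem_edges.1 h.2).2⟩⟩

theorem sum_divergence_cells_eq_zero (hΩ : interior (closure Ω) = Ω) {K : Finset Plane}
    (hK : K ∈ M.coarse) {w : M.BrokenRT} (hw : w ∈ M.VhLoc0 K) :
    ∑ τ ∈ M.cells K, ∫ x in hull τ.1, divergence (w τ).eval x = 0 := by
  rw [← M.sum_divergence_eq_zero fun e he x hx => M.jump_eq_zero_of_mem_VhLoc0 hΩ hK hw he hx]
  refine Finset.sum_subset (Finset.subset_univ _) fun τ _ h2 => ?_
  rw [M.apply_eq_zero_of_mem_VhLoc hw.1 h2]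
  simp_rw [divergence_eval_zero]
  simp

/-- A piecewise constant function on `K` that is orthogonal to all divergences is constant. -/
theorem const_of_divForm_eq_zero {K : Finset Plane} (hK : K ∈ M.coarse) {p : M.BrokenP1}
    (hp : ∀ τ ∈ M.cells K, (p τ).2 = 0) (h : ∀ w ∈ M.VhLoc0 K, M.divForm (M.cells K) p w = 0)
    {τ₀ : M.Cell} (hτ₀ : τ₀ ∈ M.cells K) : ∀ τ ∈ M.cells K, (p τ).1 = (p τ₀).1 := by
  refine M.cells_induction hK (fun τ => (p τ).1 = (p τ₀).1) hτ₀ rfl ?_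
  intro τ hτ hP τ' hτ' hne e he h1 h2
  -- Orthogonality to the field carrying flux from `τ` to `τ'` says exactly that the two values
  -- agree.
  obtain ⟨w, hw, w0, hw1, hw2⟩ := M.exists_transfer_field hK hτ hτ' hne he h1 h2
  have h3 := h w hw
  rw [divForm_const hp, Finset.sum_eq_add_of_mem τ τ' hτ hτ' hne, hw1, hw2] at h3
  · have hl : 0 < edgeLength e := by
      obtain ⟨a, b, hab, rfl⟩ := Finset.card_eq_two.1 he
      rw [edgeLength_pair]
      exact norm_pos_iff.2 (sub_ne_zero.2 hab.symm)
    have h4 : edgeLength e * ((p τ).1 - (p τ').1) = 0 := by linear_combination h3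
    have h5 := (mul_eq_zero.1 h4).resolve_left hl.ne'
    change (p τ').1 = _
    rw [← hP]; linarith
  · intro σ _ hσ
    rw [w0 σ hσ.1 hσ.2]
    simp_rw [divergence_eval_zero]
    simp

end TwoLevelMesh

end

/-! ### Spectral projection on a coarse element -/

section

namespace TwoLevelMesh

variable {Ω : Set Plane} {M : TwoLevelMesh Ω}

theorem nextInv_nonneg {N : ℕ} {ev : Fin N → ℝ} (h : ∀ j, 0 < ev j) (m : ℕ) : 0 ≤ nextInv ev m := by
  unfold nextInv
  split
  · exact (inv_pos.2 (h _)).le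
  · exact le_rfl

theorem sub_sum_head {N : ℕ} (m : ℕ) {y : ℝ} (x : Fin N → ℝ) (h : y = ∑ j, x j) :
    y - ∑ j : Fin N, (if (j : ℕ) < m then x j else 0)
      = ∑ j ∈ Finset.univ.filter (fun j : Fin N => ¬ (j : ℕ) < m), x j := by
  rw [h, ← Finset.sum_filter, sub_eq_iff_eq_add, add_comm, Finset.sum_filter_add_sum_filter_not]

/-- The estimate of the discarded coefficients by duality with the eigenfunctions. -/
theorem sum_tail_sq_le {V : Type*} [AddCommGroup V] [Module ℝ V] (A : V →ₗ[ℝ] V →ₗ[ℝ] ℝ)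
    (hpos : ∀ x, 0 ≤ A x x) (hsymm : ∀ x y, A x y = A y x) (A' : V →ₗ[ℝ] V →ₗ[ℝ] ℝ)
    (hle : ∀ x, A x x ≤ A' x x)
    {N : ℕ} (ev : Fin N → ℝ) (hev : ∀ j, 0 < ev j) (hmono : Monotone ev) (m : ℕ) (φ : Fin N → V)
    (hφ : ∀ i j, A' (φ i) (φ j) = if i = j then (ev i)⁻¹ else 0) (v : V) (c : Fin N → ℝ) {s : ℝ}
    (hs : |s| = 1) (hv : ∀ j, A v (φ j) = s * c j) :
    ∑ j ∈ Finset.univ.filter (fun j : Fin N => ¬ (j : ℕ) < m), c j ^ 2 ≤ nextInv ev m * A v v := by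
  set J := Finset.univ.filter (fun j : Fin N => ¬ (j : ℕ) < m) with hJ
  refine le_of_dual A hpos hsymm (w := ∑ j ∈ J, c j • φ j) (Finset.sum_nonneg fun j _ => sq_nonneg _)
    (nextInv_nonneg hev m) ?_ ?_
  · have : A v (∑ j ∈ J, c j • φ j) = s * ∑ j ∈ J, c j ^ 2 := by
      rw [map_sum, Finset.mul_sum]
      exact Finset.sum_congr rfl fun j _ => by rw [map_smul, hv, smul_eq_mul]; ring
    rw [this, abs_mul, hs, one_mul]
    exact le_abs_self _
  -- The fields are orthogonal for `A'` only, so the energy is enlarged before it is expanded. On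
  -- coarse edges `A` belongs to one element and `A'` to the whole patch.
  · refine (hle _).trans ?_
    rw [form_sum_sum A' φ (fun i => (ev i)⁻¹) hφ, Finset.mul_sum]
    refine Finset.sum_le_sum fun j hj => ?_
    have hmj : m ≤ (j : ℕ) := by simpa [hJ] using hj
    -- Eigenvalues are indexed from zero, so index `m` is the first discarded one. It exists as soon
    -- as there is a term to estimate, and the default value of `nextInv` does not matter here.
    have hmN : m < N := lt_of_le_of_lt hmj j.2
    rw [mul_comm]
    refine mul_le_mul_of_nonneg_right ?_ (sq_nonneg _)
    rw [nextInv, dif_pos hmN]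
    exact inv_anti₀ (hev _) (hmono (Fin.le_def.2 hmj))

namespace ElementBasis

variable {κ ρ : Plane → ℝ} {a b a' b' : ℝ} {K : Finset Plane} (B : M.ElementBasis κ ρ K)

theorem p_snd (j : Fin (M.numInt K)) (τ : M.Cell) : (B.p j τ).2 = 0 := by
  obtain ⟨q, hq, h⟩ := (B.p_mem j).1
  rw [← h]
  by_cases hτ : τ ∈ M.cells K
  · rw [M.restr_of_mem hτ]; exact hq τ
  · rw [M.restr_of_notMem hτ]; rfl

theorem p_eq_zero (j : Fin (M.numInt K)) {τ : M.Cell} (hτ : τ ∉ M.cells K) : B.p j τ = 0 := by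
  obtain ⟨q, hq, h⟩ := (B.p_mem j).1
  rw [← h, M.restr_of_notMem hτ]

theorem p_mean (j : Fin (M.numInt K)) :
    ∑ τ ∈ M.cells K, (volume : Measure Plane).real (hull τ.1) * (B.p j τ).1 = 0 := by
  rw [← intCells_const fun τ _ => B.p_snd j τ]
  exact (B.p_mem j).2

theorem p_orthonormal (i j : Fin (M.numInt K)) :
    ∑ τ ∈ M.cells K, (∫ x in hull τ.1, ρ x) * ((B.p i τ).1 * (B.p j τ).1)
      = if i = j then 1 else 0 := by
  rw [← rhoForm_const (fun τ _ => B.p_snd i τ) (fun τ _ => B.p_snd j τ)]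
  exact B.orthonormal i j

/-- Each eigenfunction is admissible as a test function for the others, so the mixed problem passes
the ρ-orthogonality of the pressures on to the velocities. -/
theorem kappaForm_φ (i j : Fin (M.numInt K)) :
    M.kappaForm (M.cells K) κ (B.φ i) (B.φ j) = if i = j then B.μ i else 0 := by
  rw [sub_eq_zero.1 (B.eq_velocity i (B.φ j) (B.φ_mem j)), B.eq_pressure j _ (B.p_mem i),
    B.orthonormal]
  by_cases h : i = j
  · subst h; simp
  · simp [h, Ne.symm h]

/-- If `μ j` were zero, `φ j` would have no energy, and by Cauchy–Schwarz `p j` would be orthogonal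
to all divergences. It would then be constant on `K`, and zero by its mean, against the
normalization. -/
theorem μ_pos (hκ : CoeffBounds M.Th κ a b) (hK : K ∈ M.coarse) (j : Fin (M.numInt K)) :
    0 < B.μ j := by
  have h0 : 0 ≤ B.μ j := by
    have := kappaForm_nonneg hκ (M.cells K) (B.φ j)
    rwa [B.kappaForm_φ, if_pos rfl] at this
  refine lt_of_le_of_ne h0 fun hμ => ?_
  have hφ0 : M.kappaForm (M.cells K) κ (B.φ j) (B.φ j) = 0 := by
    rw [B.kappaForm_φ, if_pos rfl, hμ]
  have hdiv : ∀ w ∈ M.VhLoc0 K, M.divForm (M.cells K) (B.p j) w = 0 := by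
    intro w hw
    rw [← sub_eq_zero.1 (B.eq_velocity j w hw)]
    have hcs := LinearMap.BilinForm.apply_sq_le_of_symm (kappaBilin hκ (M.cells K))
      (fun x => kappaForm_nonneg hκ _ x) ⟨fun x y => kappaForm_symm _ x y⟩ (B.φ j) w
    simp only [kappaBilin_apply] at hcs
    rw [hφ0, zero_mul] at hcs
    exact pow_eq_zero_iff (two_ne_zero) |>.1 (le_antisymm hcs (sq_nonneg _))
  have hne : (M.cells K).Nonempty := by
    obtain ⟨x, hx⟩ := M.coarse_interior_nonempty hK
    obtain ⟨τ, hτ, -⟩ := M.exists_cell hK (interior_subset hx)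
    exact ⟨τ, hτ⟩
  obtain ⟨τ₀, hτ₀⟩ := hne
  have hconst := M.const_of_divForm_eq_zero hK (fun τ _ => B.p_snd j τ) hdiv hτ₀
  have hmean := B.p_mean j
  rw [Finset.sum_congr rfl fun τ hτ => by rw [hconst τ hτ], ← Finset.sum_mul] at hmean
  have hvol : 0 < ∑ τ ∈ M.cells K, (volume : Measure Plane).real (hull τ.1) :=
    Finset.sum_pos (fun τ _ => volume_hull_pos M.Th τ.2) ⟨τ₀, hτ₀⟩
  have hp0 : (B.p j τ₀).1 = 0 := (mul_eq_zero.1 hmean).resolve_left hvol.ne'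
  have horth := B.p_orthonormal j j
  rw [if_pos rfl, Finset.sum_eq_zero fun τ hτ => by rw [hconst τ hτ, hp0]; ring] at horth
  exact zero_ne_one horth

/-- The projection error on a coarse element. -/
theorem estimate (hΩ : interior (closure Ω) = Ω) (hκ : CoeffBounds M.Th κ a b)
    (hK : K ∈ M.coarse) (m : ℕ) {p q : M.BrokenP1} {α : ℝ} {v : M.BrokenRT}
    (hp : ∀ τ, (p τ).2 = 0) (hq : ∀ τ ∈ M.cells K, q τ = p τ - (α, 0))
    (hmean : M.intCells (M.cells K) (fun τ x => (q τ).eval x) = 0)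
    (hv : ∀ w ∈ M.VhLoc0 K, M.kappaForm (M.cells K) κ v w = M.divForm (M.cells K) p w)
    {r : M.BrokenP1}
    (hr : ∀ τ ∈ M.cells K, r τ = q τ - ∑ j : Fin (M.numInt K), if (j : ℕ) < m then
      M.rhoForm (M.cells K) ρ q (B.p j) • B.p j τ else 0) :
    M.rhoForm (M.cells K) ρ r r ≤ nextInv B.μ m * M.kappaForm (M.cells K) κ v v := by
  have hq2 : ∀ τ ∈ M.cells K, (q τ).2 = 0 := fun τ hτ => by rw [hq τ hτ]; simp [hp τ]
  have hcoef : ∀ j, M.rhoForm (M.cells K) ρ q (B.p j)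
      = ∑ τ ∈ M.cells K, (∫ x in hull τ.1, ρ x) * ((q τ).1 * (B.p j τ).1) := fun j =>
    rhoForm_const hq2 fun τ _ => B.p_snd j τ
  -- The mean is weighted by area and the orthonormality by `ρ`; completeness only needs the number
  -- of eigenfunctions to match the dimension.
  have hcomplete : ∀ τ ∈ M.cells K, (q τ).1
      = ∑ j, M.rhoForm (M.cells K) ρ q (B.p j) * (B.p j τ).1 := by
    simp_rw [hcoef]
    exact orthonormal_complete (M.cells K) (fun τ => ∫ x in hull τ.1, ρ x)
      (fun τ => (volume : Measure Plane).real (hull τ.1)) (fun τ _ => volume_hull_pos M.Th τ.2)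
      (fun j τ => (B.p j τ).1) B.p_mean B.p_orthonormal (fun τ => (q τ).1)
      (by rw [← intCells_const hq2]; exact hmean)
  have hr1 : ∀ τ ∈ M.cells K, (r τ).1 = ∑ j ∈ Finset.univ.filter (fun j : Fin (M.numInt K) => ¬ (j : ℕ) < m),
      M.rhoForm (M.cells K) ρ q (B.p j) * (B.p j τ).1 := by
    intro τ hτ
    rw [hr τ hτ, Prod.fst_sub, Prod.fst_sum, ← sub_sum_head m _ (hcomplete τ hτ)]
    congr 1
    refine Finset.sum_congr rfl fun j _ => ?_
    split <;> simp
  have hr2 : ∀ τ ∈ M.cells K, (r τ).2 = 0 := by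
    intro τ hτ
    rw [hr τ hτ, Prod.snd_sub, hq2 τ hτ, Prod.snd_sum, zero_sub, neg_eq_zero]
    refine Finset.sum_eq_zero fun j _ => ?_
    split <;> simp [B.p_snd]
  have hL : M.rhoForm (M.cells K) ρ r r
      = ∑ j ∈ Finset.univ.filter (fun j : Fin (M.numInt K) => ¬ (j : ℕ) < m),
        (M.rhoForm (M.cells K) ρ q (B.p j)) ^ 2 := by
    rw [rhoForm_const hr2 hr2, ← sum_weighted_sq (M.cells K) (fun τ => ∫ x in hull τ.1, ρ x)
      (fun j τ => (B.p j τ).1) B.p_orthonormal]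
    exact Finset.sum_congr rfl fun τ hτ => by rw [hr1 τ hτ]
  rw [hL]
  have hμ := B.μ_pos hκ hK
  -- Division by `μ j` makes testing return the coefficient itself and turns the energy `μ j` into
  -- its inverse.
  refine sum_tail_sq_le (kappaBilin hκ (M.cells K)) (fun x => kappaForm_nonneg hκ _ x)
    (fun x y => kappaForm_symm _ x y) (kappaBilin hκ (M.cells K)) (fun x => le_rfl) B.μ hμ
    B.ordered m (fun j => (B.μ j)⁻¹ • B.φ j) ?_ v _ (s := 1) (by simp) ?_
  · intro i j
    rw [map_smul, map_smul, LinearMap.smul_apply, kappaBilin_apply, B.kappaForm_φ]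
    by_cases h : i = j
    · subst h
      have := (hμ i).ne'
      simp [this]
    · simp [h]
  · intro j
    have hmem : M.restr K q ∈ M.QhLocMeanZero K := by
      refine ⟨⟨M.restr K q, ?_, ?_⟩, ?_⟩
      · intro τ
        by_cases hτ : τ ∈ M.cells K
        · rw [M.restr_of_mem hτ]; exact hq2 τ hτ
        · rw [M.restr_of_notMem hτ]; rfl
      · funext τ
        by_cases hτ : τ ∈ M.cells K
        · rw [M.restr_of_mem hτ]
        · rw [M.restr_of_notMem hτ, M.restr_of_notMem hτ]
      · rw [← hmean]
        exact Finset.sum_congr rfl fun τ hτ => by beta_reduce; rw [M.restr_of_mem hτ]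
    have h1 := B.eq_pressure j _ hmem
    -- Subtracting the average is harmless, since the divergence of a field without boundary flux
    -- has mean zero.
    have h2 : M.divForm (M.cells K) (M.restr K q) (B.φ j) = M.divForm (M.cells K) p (B.φ j) := by
      have h3 := M.sum_divergence_cells_eq_zero hΩ hK (B.φ_mem j)
      rw [divForm_congr (q' := q) (w' := B.φ j) (fun τ hτ => M.restr_of_mem hτ) (fun _ _ => rfl),
        divForm_const hq2, divForm_const fun τ _ => hp τ, ← sub_eq_zero, ← Finset.sum_sub_distrib,
        ← mul_zero (-α), ← h3, Finset.mul_sum]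
      refine Finset.sum_congr rfl fun τ hτ => ?_
      rw [hq τ hτ, Prod.fst_sub]; ring
    have h4 : M.rhoForm (M.cells K) ρ (B.p j) (M.restr K q) = M.rhoForm (M.cells K) ρ q (B.p j) := by
      refine Finset.sum_congr rfl fun τ hτ => ?_
      beta_reduce
      rw [M.restr_of_mem hτ]
      simp_rw [mul_comm ((B.p j τ).eval _)]
    rw [map_smul, kappaBilin_apply, hv _ (B.φ_mem j), ← h2, h1, h4, smul_eq_mul,
      inv_mul_cancel_left₀ (hμ j).ne', one_mul]

end ElementBasis

end TwoLevelMesh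

end

/-! ### Assembling the estimate of the component in `Q_h` -/

section

namespace TwoLevelMesh

variable {Ω : Set Plane} {M : TwoLevelMesh Ω} {κ ρ : Plane → ℝ} {a b a' b' : ℝ}

/-- A sum over all fine elements splits into sums over the coarse elements. -/
theorem sum_cells (F : M.Cell → ℝ) :
    ∑ τ, F τ = ∑ K : M.coarse, ∑ τ ∈ M.cells K.1, F τ := by
  classical
  have hU : (Finset.univ : Finset M.Cell)
      = (Finset.univ : Finset M.coarse).biUnion (fun K => M.cells K.1) := by
    ext τ
    simp only [Finset.mem_univ, Finset.mem_biUnion, true_and, true_iff]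
    obtain ⟨K, hK, h⟩ := M.exists_coarse τ
    exact ⟨⟨K, hK⟩, h⟩
  rw [hU, Finset.sum_biUnion]
  intro K _ K' _ hne
  rw [Function.onFun, Finset.disjoint_left]
  intro τ h h'
  exact hne (Subtype.ext (M.coarse_unique K.2 K'.2 h h'))

theorem le_iSup_mul_of_local {f g F : M.coarse → ℝ} (hg : ∀ K, 0 ≤ g K)
    (h : ∀ K, F K ≤ f K * g K) : ∑ K, F K ≤ (⨆ K, f K) * ∑ K, g K := by
  rw [Finset.mul_sum]
  refine Finset.sum_le_sum fun K _ => (h K).trans ?_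
  exact mul_le_mul_of_nonneg_right (le_ciSup (Set.finite_range f).bddAbove K) (hg K)

theorem VhLoc0_subset_VhHat (hΩ : interior (closure Ω) = Ω) {K : Finset Plane} (hK : K ∈ M.coarse) :
    M.VhLoc0 K ⊆ M.VhHat :=
  fun _ hw _ he _ _ _ hx => M.jump_eq_zero_of_mem_VhLoc0 hΩ hK hw he hx

variable {T : ℝ} {f : ℝ → Plane → ℝ} {v v' : ℝ → M.BrokenRT} {pI pI' pB pB' : ℝ → M.BrokenP1}

/-- The velocity equation tested with a local field whose normal component vanishes on the
boundary of the coarse element. -/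
theorem IsReferenceSolution.local_velocity (hΩ : interior (closure Ω) = Ω)
    (h : M.IsReferenceSolution κ ρ T f v v' pI pI' pB pB') {t : ℝ} (ht : t ∈ Icc 0 T)
    {K : Finset Plane} (hK : K ∈ M.coarse) {w : M.BrokenRT} (hw : w ∈ M.VhLoc0 K) :
    M.kappaForm (M.cells K) κ (v' t) w = M.divForm (M.cells K) (pI t) w := by
  have h1 := h.eq_velocity t ht w (VhLoc0_subset_VhHat hΩ hK hw)
  have hout : ∀ τ ∈ Finset.univ, τ ∉ M.cells K → w τ = 0 :=
    fun τ _ hτ => M.apply_eq_zero_of_mem_VhLoc hw.1 hτ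
  rw [Finset.sum_eq_zero, kappaForm_eq_of_subset (Finset.subset_univ _) hout,
    divForm_eq_of_subset (Finset.subset_univ _) hout] at h1
  · linarith
  · intro e he
    obtain ⟨E, -, heE⟩ := M.mem_fineEp0.1 he
    rw [edgeInt_congr (g := fun _ => 0), edgeInt_const', mul_zero]
    intro x hx
    rw [M.jump_eq_zero_of_mem_VhLoc0 hΩ hK hw (M.mem_fineOn.1 heE).1 hx, mul_zero]

/-- A fine triangle lies in only one coarse element, so a single summand of the interpolant survives
on it. -/
theorem piI_apply (B : M.MultiscaleBasis κ ρ) (s : M.Selection) (q : M.BrokenP1) (K : M.coarse)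
    {τ : M.Cell} (hτ : τ ∈ M.cells K.1) :
    piI B s q τ = (coeffA0 K q, 0) + ∑ j : Fin (M.numInt K.1),
      if (j : ℕ) < s.m K then coeffA B K q j • (B.elt K).p j τ else 0 := by
  unfold piI
  rw [Finset.sum_apply, Finset.sum_eq_single K]
  · rw [Pi.add_apply, Finset.sum_apply, constOn, M.restr_of_mem hτ]
    congr 1
    refine Finset.sum_congr rfl fun j _ => ?_
    split <;> simp
  · intro K' _ hne
    have hτ' : τ ∉ M.cells K'.1 := fun h => hne (Subtype.ext (M.coarse_unique K'.2 K.2 h hτ))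
    rw [Pi.add_apply, Finset.sum_apply, constOn, M.restr_of_notMem hτ', zero_add]
    refine Finset.sum_eq_zero fun j _ => ?_
    split
    · rw [Pi.smul_apply, (B.elt K').p_eq_zero j hτ', smul_zero]
    · rfl
  · simp

theorem coeffA0_mean (K : M.coarse) {p : M.BrokenP1} (hp : ∀ τ, (p τ).2 = 0) :
    M.intCells (M.cells K.1) (fun τ x => ((p - constOn K (coeffA0 K p)) τ).eval x) = 0 := by
  have hc : ∀ τ ∈ M.cells K.1, (p - constOn K (coeffA0 K p)) τ = p τ - (coeffA0 K p, 0) := by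
    intro τ hτ; rw [Pi.sub_apply, constOn, M.restr_of_mem hτ]
  have hvol : M.intCells (M.cells K.1) (fun _ _ => 1)
      = ∑ τ ∈ M.cells K.1, (volume : Measure Plane).real (hull τ.1) :=
    Finset.sum_congr rfl fun τ _ => by simp
  rw [intCells_const fun τ hτ => by rw [hc τ hτ]; simp [hp τ]]
  rw [Finset.sum_congr rfl fun τ hτ => by rw [hc τ hτ, Prod.fst_sub, mul_sub],
    Finset.sum_sub_distrib, ← Finset.sum_mul, ← intCells_const fun τ _ => hp τ, ← hvol, coeffA0]
  rcases (M.cells K.1).eq_empty_or_nonempty with h | h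
  · simp [h, intCells]
  · have : 0 < M.intCells (M.cells K.1) (fun _ _ => 1) := by
      rw [hvol]; exact Finset.sum_pos (fun τ _ => volume_hull_pos M.Th τ.2) h
    rw [mul_div_cancel₀ _ this.ne', sub_self]

/-- The error of the interpolant of the component in `Q_h`. -/
theorem piI_error (hΩ : interior (closure Ω) = Ω) (hκ : CoeffBounds M.Th κ a b)
    (B : M.MultiscaleBasis κ ρ) (s : M.Selection)
    (h : M.IsReferenceSolution κ ρ T f v v' pI pI' pB pB') {t : ℝ} (ht : t ∈ Icc 0 T) :
    M.normQsq ρ (pI t - piI B s (pI t)) ≤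
      (⨆ K : M.coarse, nextInv (B.elt K).μ (s.m K)) * M.normVsq κ (v' t) := by
  have hp : ∀ τ, (pI t τ).2 = 0 := h.pI_mem t ht
  have e1 : M.normQsq ρ (pI t - piI B s (pI t)) = ∑ K : M.coarse,
    M.rhoForm (M.cells K.1) ρ (pI t - piI B s (pI t)) (pI t - piI B s (pI t)) := sum_cells _
  have e2 : M.normVsq κ (v' t) = ∑ K : M.coarse, M.kappaForm (M.cells K.1) κ (v' t) (v' t) :=
    sum_cells _
  rw [e1, e2]
  refine le_iSup_mul_of_local (fun K => kappaForm_nonneg hκ _ _) fun K => ?_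
  have hq : ∀ τ ∈ M.cells K.1, (pI t - constOn K (coeffA0 K (pI t))) τ
      = pI t τ - (coeffA0 K (pI t), 0) := by
    intro τ hτ; rw [Pi.sub_apply, constOn, M.restr_of_mem hτ]
  refine (B.elt K).estimate hΩ hκ K.2 (s.m K) hp hq (coeffA0_mean K hp)
    (fun w hw => h.local_velocity hΩ ht K.2 hw) ?_
  intro τ hτ
  rw [Pi.sub_apply, piI_apply B s _ K hτ, hq τ hτ, sub_sub]
  rfl

end TwoLevelMesh

end

/-! ### Edge eigenfunctions as test fields -/

section

namespace TwoLevelMesh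

variable {Ω : Set Plane} {M : TwoLevelMesh Ω} {κ ρ : Plane → ℝ} {a b a' b' : ℝ}
  {K E e : Finset Plane}

theorem coarseEdgeInt_of_const {F : Finset Plane → Plane → ℝ} {g : Finset Plane → ℝ}
    (h : ∀ e ∈ M.fineOn E, ∀ x ∈ hull e, F e x = g e) :
    M.coarseEdgeInt E F = ∑ e ∈ M.fineOn E, edgeLength e * g e :=
  Finset.sum_congr rfl fun e he => by rw [edgeInt_congr (h e he), edgeInt_const']

theorem edgeLength_pos (he : e ∈ M.Th.edges) : 0 < edgeLength e := by
  obtain ⟨x, y, hxy, rfl⟩ := Finset.card_eq_two.1 (M.Th.mem_edges.1 he).2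
  rw [edgeLength_pair]
  exact norm_pos_iff.2 (sub_ne_zero.2 hxy.symm)

theorem edge_nonempty (he : e ∈ M.Th.edges) : e.Nonempty :=
  Finset.card_pos.1 (by rw [(M.Th.mem_edges.1 he).2]; norm_num)

theorem cellsAt_nonempty (hE : E ∈ M.Ep) (he : e ∈ M.fineOn E) : (M.cellsAt e).Nonempty := by
  obtain ⟨K, hK, hEK⟩ := M.exists_coarse_of_edge hE
  obtain ⟨τ, -, hτ⟩ := M.exists_cell_of_fineOn hK hEK he
  exact ⟨τ, M.mem_cellsAt.2 hτ⟩

theorem mean_eq_of_const {ι : Type*} {S : Finset ι} (hS : S.Nonempty) {f : ι → ℝ} {c : ℝ}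
    (h : ∀ i ∈ S, f i = c) : (S.card : ℝ)⁻¹ * ∑ i ∈ S, f i = c := by
  have : (S.card : ℝ) ≠ 0 := Nat.cast_ne_zero.2 hS.card_ne_zero
  rw [Finset.sum_congr rfl h, Finset.sum_const, nsmul_eq_mul, inv_mul_cancel_left₀ this]

theorem cells_subset_patch (hK : K ∈ M.coarse) (hEK : E ⊆ K) : M.cells K ⊆ M.patch E := by
  intro τ hτ
  simp only [patch, Finset.mem_filter, Finset.mem_univ, true_and]
  exact ⟨K, hK, hEK, M.mem_cells.1 hτ⟩

namespace EdgeBasis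

variable (B : M.EdgeBasis κ E)

/-- The normal component of the eigenfunctions on the fine edges. -/
def delta (j : Fin (M.numEdge E)) : Finset Plane → ℝ := (B.φ_mem j).2.choose

/-- Every fine triangle at `e` lies in a coarse element that has the edge `E`, and the same δ serves
on both sides of `E`. -/
theorem inner_eq_delta (hE : E ∈ M.Ep) (j : Fin (M.numEdge E)) (he : e ∈ M.fineOn E) {τ : M.Cell}
    (hτ : e ⊆ τ.1) {x : Plane} (hx : x ∈ hull e) :
    inner ℝ ((B.φ j τ).eval x) B.n = B.delta j e := by
  obtain ⟨K, hK, hτK⟩ := M.exists_coarse τ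
  exact ((B.φ_mem j).2.choose_spec.2 K hK (M.edge_subset_of_cell hK hE he hτK hτ)).2.2.2.1
    τ hτK e he hτ x hx

theorem normalTrace_eq (hE : E ∈ M.Ep) (j : Fin (M.numEdge E)) (he : e ∈ M.fineOn E) {x : Plane}
    (hx : x ∈ hull e) : M.normalTrace B.n (B.φ j) e x = B.delta j e :=
  mean_eq_of_const (cellsAt_nonempty hE he) fun _ hτ =>
    B.inner_eq_delta hE j he (M.mem_cellsAt.1 hτ) hx

theorem delta_mean (j : Fin (M.numEdge E)) :
    ∑ e ∈ M.fineOn E, edgeLength e * B.delta j e = 0 := by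
  rw [← coarseEdgeInt_of_const (F := fun e _ => B.delta j e) fun _ _ _ _ => rfl]
  exact (B.φ_mem j).2.choose_spec.1

theorem delta_orthonormal (hE : E ∈ M.Ep) (i j : Fin (M.numEdge E)) :
    ∑ e ∈ M.fineOn E, edgeLength e * (B.delta i e * B.delta j e) = if i = j then 1 else 0 := by
  rw [← B.orthonormal i j]
  refine (coarseEdgeInt_of_const fun e he x hx => ?_).symm
  rw [B.normalTrace_eq hE i he hx, B.normalTrace_eq hE j he hx]

theorem ev_mul_kappaForm (i j : Fin (M.numEdge E)) :
    B.ev i * M.kappaForm (M.patch E) κ (B.φ i) (B.φ j) = if i = j then 1 else 0 := by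
  rw [← B.orthonormal i j, B.eq_spectral i _ (B.φ_mem j)]

/-- The normalization on `E` says that the eigenvalue times the nonnegative energy equals one. -/
theorem ev_pos (hκ : CoeffBounds M.Th κ a b) (j : Fin (M.numEdge E)) : 0 < B.ev j := by
  have h := B.ev_mul_kappaForm j j
  rw [if_pos rfl] at h
  exact pos_of_mul_pos_left (by rw [h]; exact one_pos) (kappaForm_nonneg hκ _ _)

theorem kappaForm_φ (hκ : CoeffBounds M.Th κ a b) (i j : Fin (M.numEdge E)) :
    M.kappaForm (M.patch E) κ (B.φ i) (B.φ j) = if i = j then (B.ev i)⁻¹ else 0 := by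
  have h := B.ev_mul_kappaForm i j
  have h0 := (B.ev_pos hκ i).ne'
  by_cases hij : i = j
  · rw [if_pos hij] at h ⊢
    exact eq_inv_of_mul_eq_one_right h
  · rw [if_neg hij] at h ⊢
    exact (mul_eq_zero.1 h).resolve_left h0

/-- The restriction of an eigenfunction to a coarse element is an admissible test field. -/
theorem restr_mem_VhHat (hΩ : interior (closure Ω) = Ω) (hK : K ∈ M.coarse) (hE : E ∈ M.Ep0)
    (hEK : E ⊆ K) (j : Fin (M.numEdge E)) : M.restr K (B.φ j) ∈ M.VhHat := by
  have hspec := (B.φ_mem j).2.choose_spec.2 K hK hEK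
  intro e he hfr he0 x hx
  by_cases hfK : hull e ⊆ frontier (hull K)
  · refine Finset.sum_eq_zero fun τ hτ => ?_
    by_cases hτK : τ ∈ M.cells K
    · rw [M.restr_of_mem hτK]
      exact hspec.2.2.2.2 τ hτK e he (M.mem_cellsAt.1 hτ) hfK
        (fun h => he0 (M.mem_fineEp0.2 ⟨E, hE, h⟩)) x hx
    · rw [M.restr_of_notMem hτK, RT0.eval_zero, inner_zero_left]
  · exact M.jump_restr_eq_zero hΩ hK hspec.1 he hfK hx

/-- The jump of the restriction of an eigenfunction to a coarse element. -/
theorem jump_restr (hK : K ∈ M.coarse) (hE : E ∈ M.Ep) (hEK : E ⊆ K) {σ : ℝ}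
    (hσ : ∀ e ∈ M.fineOn E, ∀ τ ∈ M.cells K, e ⊆ τ.1 → outwardNormal τ.1 e = σ • B.n)
    (j : Fin (M.numEdge E)) (he : e ∈ M.fineOn E) {x : Plane} (hx : x ∈ hull e) :
    M.jump (M.restr K (B.φ j)) e x = σ * B.delta j e := by
  obtain ⟨τ, hτK, hτ⟩ := M.exists_cell_of_fineOn hK hEK he
  unfold jump
  rw [Finset.sum_eq_single τ]
  · rw [M.restr_of_mem hτK, hσ e he τ hτK hτ, real_inner_smul_right, B.inner_eq_delta hE j he hτ hx]
  · intro τ' hτ' hne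
    have : τ' ∉ M.cells K := fun h =>
      hne (M.cell_unique_of_fineOn hK hE hEK he h hτK (M.mem_cellsAt.1 hτ') hτ)
    rw [M.restr_of_notMem this, RT0.eval_zero, inner_zero_left]
  · exact fun h => absurd (M.mem_cellsAt.2 hτ) h

/-- Since `K` has only one edge in the initial triangulation, no fine triangle of `K` touches `e`
along an edge. -/
theorem jump_restr_of_notMem (hK : K ∈ M.coarse) (hE : E ∈ M.Ep) (hEK : E ⊆ K)
    (j : Fin (M.numEdge E)) (he : e ∈ M.fineEp) (heE : e ∉ M.fineOn E) (x : Plane) :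
    M.jump (M.restr K (B.φ j)) e x = 0 := by
  obtain ⟨E', hE', he'⟩ := M.mem_fineEp.1 he
  refine Finset.sum_eq_zero fun τ hτ => ?_
  have : τ ∉ M.cells K := fun h => heE (M.coarse_edge_unique hK hE hE' hEK
    (M.edge_subset_of_cell hK hE' he' h (M.mem_cellsAt.1 hτ)) ▸ he')
  rw [M.restr_of_notMem this, RT0.eval_zero, inner_zero_left]

theorem divForm_eq_zero (hK : K ∈ M.coarse) (hEK : E ⊆ K) (j : Fin (M.numEdge E)) {q : M.BrokenP1}
    (hq : q ∈ M.Qh) : M.divForm (M.cells K) q (B.φ j) = 0 := by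
  rw [← ((B.φ_mem j).2.choose_spec.2 K hK hEK).2.2.1 _ ⟨q, hq, rfl⟩]
  exact divForm_congr (fun τ hτ => (M.restr_of_mem hτ).symm) fun _ _ => rfl

end EdgeBasis

theorem fineOn_subset_fineEp (hE : E ∈ M.Ep) : M.fineOn E ⊆ M.fineEp :=
  fun _ he => M.mem_fineEp.2 ⟨E, hE, he⟩

theorem fineOn_subset_fineEp0 (hE : E ∈ M.Ep0) : M.fineOn E ⊆ M.fineEp0 :=
  fun _ he => M.mem_fineEp0.2 ⟨E, hE, he⟩

theorem fineEp0_subset_fineEp : M.fineEp0 ⊆ M.fineEp := fun _ he => by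
  obtain ⟨E, hE, h⟩ := M.mem_fineEp0.1 he
  exact fineOn_subset_fineEp (M.mem_Ep0.1 hE).1 h

/-- The value of a function of the additional pressure space on a fine edge. -/
def edgeValue (q : M.BrokenP1) (e : Finset Plane) : ℝ := M.trace q e (e.centroid ℝ id)

/-- Constancy along `e` and continuity across it leave one number per fine edge, so traces become
finite vectors to which `orthonormal_complete` applies. -/
theorem eval_eq_edgeValue {q : M.BrokenP1} (hq : q ∈ M.QhTilde) (he : e ∈ M.fineEp0) {τ : M.Cell}
    (hτ : e ⊆ τ.1) {x : Plane} (hx : x ∈ hull e) : (q τ).eval x = edgeValue q e := by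
  obtain ⟨E, hE, heE⟩ := M.mem_fineEp0.1 he
  have hc : e.centroid ℝ id ∈ hull e := centroid_mem_hull (edge_nonempty (M.mem_fineOn.1 heE).1)
  rw [hq.2.1 τ e (fineEp0_subset_fineEp he) hτ x hx _ hc]
  exact (mean_eq_of_const ⟨τ, M.mem_cellsAt.2 hτ⟩ fun τ' hτ' =>
    hq.2.2.2 e he τ' hτ' τ (M.mem_cellsAt.2 hτ) _ hc).symm

theorem trace_eq_edgeValue {q : M.BrokenP1} (hq : q ∈ M.QhTilde) (he : e ∈ M.fineEp0) {x : Plane}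
    (hx : x ∈ hull e) : M.trace q e x = edgeValue q e := by
  obtain ⟨E, hE, heE⟩ := M.mem_fineEp0.1 he
  exact mean_eq_of_const (cellsAt_nonempty (M.mem_Ep0.1 hE).1 heE) fun τ hτ =>
    eval_eq_edgeValue hq he (M.mem_cellsAt.1 hτ) hx

theorem coeffB0_eq (E : M.Ep0) {q : M.BrokenP1} (hq : q ∈ M.QhTilde) :
    coeffB0 E q = (∑ e ∈ M.fineOn E.1, edgeLength e * edgeValue q e)
      / ∑ e ∈ M.fineOn E.1, edgeLength e := by
  unfold coeffB0
  rw [coarseEdgeInt_of_const fun e he x hx =>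
      trace_eq_edgeValue hq (fineOn_subset_fineEp0 E.2 he) hx,
    coarseEdgeInt_of_const (g := fun _ => 1) fun _ _ _ _ => rfl]
  simp

theorem coeffB_eq (B : M.MultiscaleBasis κ ρ) (E : M.Ep0) {q : M.BrokenP1} (hq : q ∈ M.QhTilde)
    (j : Fin (M.numEdge E.1)) : coeffB B E q j
      = ∑ e ∈ M.fineOn E.1, edgeLength e * (edgeValue q e * (B.edge E).delta j e) :=
  coarseEdgeInt_of_const fun e he x hx => by
    rw [trace_eq_edgeValue hq (fineOn_subset_fineEp0 E.2 he) hx,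
      (B.edge E).normalTrace_eq (M.mem_Ep0.1 E.2).1 j he hx]

/-- The expansion of the edge values with respect to the eigenfunctions. -/
theorem edgeValue_expansion (B : M.MultiscaleBasis κ ρ) (E : M.Ep0) {q : M.BrokenP1}
    (hq : q ∈ M.QhTilde) (he : e ∈ M.fineOn E.1) :
    edgeValue q e - coeffB0 E q = ∑ j, coeffB B E q j * (B.edge E).delta j e := by
  have hpos : ∀ e ∈ M.fineOn E.1, 0 < edgeLength e := fun e he =>
    edgeLength_pos (M.mem_fineOn.1 he).1
  have hsum : 0 < ∑ e ∈ M.fineOn E.1, edgeLength e := Finset.sum_pos hpos ⟨e, he⟩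
  have h := orthonormal_complete (M.fineOn E.1) edgeLength edgeLength hpos (B.edge E).delta
    (B.edge E).delta_mean ((B.edge E).delta_orthonormal (M.mem_Ep0.1 E.2).1)
    (fun e => edgeValue q e - coeffB0 E q) ?_ e he
  · have hj : ∀ j : Fin (M.numEdge E.1), ∑ e ∈ M.fineOn E.1,
        edgeLength e * ((edgeValue q e - coeffB0 E q) * (B.edge E).delta j e) = coeffB B E q j := by
      intro j
      rw [coeffB_eq B E hq, ← sub_eq_zero, ← Finset.sum_sub_distrib,
        Finset.sum_congr rfl (g := fun e => -coeffB0 E q * (edgeLength e * (B.edge E).delta j e))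
          fun _ _ => by ring, ← Finset.mul_sum, (B.edge E).delta_mean, mul_zero]
    exact h.trans (Finset.sum_congr rfl fun j _ => congrArg (· * _) (hj j))
  · rw [Finset.sum_congr rfl fun _ _ => mul_sub _ _ _, Finset.sum_sub_distrib, ← Finset.sum_mul,
      coeffB0_eq E hq, mul_div_cancel₀ _ hsum.ne', sub_self]

variable {T : ℝ} {f : ℝ → Plane → ℝ} {v v' : ℝ → M.BrokenRT} {pI pI' pB pB' : ℝ → M.BrokenP1}

/-- The velocity equation tested with an eigenfunction of a coarse edge on one coarse element. -/
theorem IsReferenceSolution.local_edge (hΩ : interior (closure Ω) = Ω)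
    (h : M.IsReferenceSolution κ ρ T f v v' pI pI' pB pB') {t : ℝ} (ht : t ∈ Icc 0 T)
    (B : M.MultiscaleBasis κ ρ) (hK : K ∈ M.coarse) (E : M.Ep0) (hEK : E.1 ⊆ K) :
    ∃ s : ℝ, |s| = 1 ∧ ∀ j, M.kappaForm (M.cells K) κ (v' t) ((B.edge E).φ j)
      = s * coeffB B E (pB t) j := by
  have hE := (M.mem_Ep0.1 E.2).1
  obtain ⟨σ, hσ1, hσ⟩ := M.exists_sign hK hE hEK (B.edge E).norm_n (B.edge E).n_orthogonal
  refine ⟨-σ, by rw [abs_neg, hσ1], fun j => ?_⟩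
  set w := M.restr K ((B.edge E).φ j) with hw
  have h1 := h.eq_velocity t ht w ((B.edge E).restr_mem_VhHat hΩ hK E.2 hEK j)
  have hout : ∀ τ ∈ Finset.univ, τ ∉ M.cells K → w τ = 0 := fun τ _ hτ => M.restr_of_notMem hτ
  have hin : ∀ τ ∈ M.cells K, w τ = (B.edge E).φ j τ := fun τ hτ => M.restr_of_mem hτ
  have hq : pB t ∈ M.QhTilde := (h.pB_mem t ht).1
  -- Restricting to one side of `E` leaves a one-sided normal component as the jump, whereas the
  -- full eigenfunction would have jump zero on `E` and carry no information.
  have hjump : ∑ e ∈ M.fineEp0, edgeInt e (fun x => M.trace (pB t) e x * M.jump w e x)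
      = σ * coeffB B E (pB t) j := by
    rw [← Finset.sum_subset (fineOn_subset_fineEp0 E.2), coeffB_eq B E hq, Finset.mul_sum]
    · refine Finset.sum_congr rfl fun e he => ?_
      rw [edgeInt_congr (g := fun _ => edgeValue (pB t) e * (σ * (B.edge E).delta j e)),
        edgeInt_const']
      · ring
      · intro x hx
        rw [trace_eq_edgeValue hq (fineOn_subset_fineEp0 E.2 he) hx,
          (B.edge E).jump_restr hK hE hEK hσ j he hx]
    · intro e he heE
      rw [edgeInt_congr (g := fun _ => 0), edgeInt_const', mul_zero]
      intro x _
      rw [(B.edge E).jump_restr_of_notMem hK hE hEK j (fineEp0_subset_fineEp he) heE, mul_zero]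
  -- The component in `Q_h` disappears because the eigenfunction is divergence free on `K`.
  rw [hjump, kappaForm_eq_of_subset (Finset.subset_univ _) hout,
    divForm_eq_of_subset (Finset.subset_univ _) hout, kappaForm_congr (fun _ _ => rfl) hin,
    divForm_congr (fun _ _ => rfl) hin, (B.edge E).divForm_eq_zero hK hEK j (h.pI_mem t ht)] at h1
  linarith

end TwoLevelMesh

end

/-! ### From edge values to triangles, and the second estimate -/

section

/-- Lagrange's identity: the squares of the determinant and of the inner product add up to the
product of the squared lengths. -/
theorem abs_orient_le (p q r : Plane) : |orient p q r| ≤ ‖q - p‖ * ‖r - p‖ := by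
  refine abs_le_of_sq_le_sq ?_ (by positivity)
  rw [mul_pow, norm_sq_plane, norm_sq_plane, orient_def]
  simp only [PiLp.sub_apply]
  nlinarith [sq_nonneg ((q 0 - p 0) * (r 0 - p 0) + (q 1 - p 1) * (r 1 - p 1))]

variable {Ω : Set Plane}

theorem Mesh.diam_le_size (T : Mesh Ω) {t : Finset Plane} (ht : t ∈ T.tri) :
    Metric.diam (hull t) ≤ T.size :=
  le_ciSup (f := fun τ : T.tri => Metric.diam (hull τ.1)) (Set.finite_range _).bddAbove ⟨t, ht⟩

theorem Mesh.size_nonneg (T : Mesh Ω) : 0 ≤ T.size := Real.iSup_nonneg fun _ => Metric.diam_nonneg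

theorem Mesh.sum_vertices_eq_zero (T : Mesh Ω) {t : Finset Plane} (ht : t ∈ T.tri) {c : P1}
    (h : ∫ x in hull t, c.eval x = 0) : ∑ x ∈ t, c.eval x = 0 := by
  obtain ⟨p, q, r, rfl, ho⟩ := T.tri_form ht
  obtain ⟨h1, h2, h3⟩ := ne_of_orient_ne_zero ho
  rw [setIntegral_triangle ho] at h
  have := (mul_eq_zero.1 h).resolve_left (by positivity)
  rw [Finset.sum_insert, Finset.sum_pair] <;> first | linarith | simp_all [eq_comm]

/-- An affine function of mean zero on a triangle that is constant on an edge. -/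
theorem Mesh.sq_eval_le (T : Mesh Ω) {t e : Finset Plane} (ht : t ∈ T.tri) (he : e ∈ T.edges)
    (het : e ⊆ t) {c : P1} {g : ℝ} (hg : ∀ x ∈ hull e, c.eval x = g) (hc : ∑ x ∈ t, c.eval x = 0)
    {x : Plane} (hx : x ∈ hull t) : c.eval x ^ 2 ≤ 4 * g ^ 2 := by
  obtain ⟨p, q, r, rfl, rfl, -, ho⟩ := T.tri_edge_form ht (T.mem_edges.1 he).2 het
  obtain ⟨h1, h2, h3⟩ := ne_of_orient_ne_zero ho
  have hp := hg p (mem_hull_of_mem (by simp))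
  have hq := hg q (mem_hull_of_mem (by simp))
  -- The vertex values add up to zero. Inside the triangle the value is `(1 - 3γ) g` with γ between
  -- 0 and 1, whence the factor 4 for the square.
  have hr : c.eval r = -2 * g := by
    rw [Finset.sum_insert, Finset.sum_pair] at hc <;> first | linarith | simp_all [eq_comm]
  obtain ⟨α, β, γ, hα, hβ, hγ, hsum, rfl⟩ := mem_hull_triple.1 hx
  have hev : c.eval (α • p + β • q + γ • r) = (1 - 3 * γ) * g := by
    have : c.eval (α • p + β • q + γ • r) = α * c.eval p + β * c.eval q + γ * c.eval r := by
      simp only [P1.eval, inner_add_right, real_inner_smul_right]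
      linear_combination -c.1 * hsum
    rw [this, hp, hq, hr]
    linear_combination g * hsum
  rw [hev, mul_pow]
  exact mul_le_mul_of_nonneg_right (by nlinarith) (sq_nonneg g)

theorem Mesh.volume_le (T : Mesh Ω) {t e : Finset Plane} (ht : t ∈ T.tri) (he : e ∈ T.edges)
    (het : e ⊆ t) : volume.real (hull t) ≤ edgeLength e * T.size / 2 := by
  have hd := T.diam_le_size ht
  obtain ⟨p, q, r, rfl, rfl, -, ho⟩ := T.tri_edge_form ht (T.mem_edges.1 he).2 het
  rw [volume_triangle ho, edgeLength_pair]
  have h1 : ‖r - p‖ ≤ T.size := by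
    refine le_trans ?_ hd
    rw [← dist_eq_norm]
    exact Metric.dist_le_diam_of_mem (isCompact_hull _).isBounded (mem_hull_of_mem (by simp))
      (mem_hull_of_mem (by simp))
  have := (abs_orient_le p q r).trans (mul_le_mul_of_nonneg_left h1 (norm_nonneg _))
  linarith

/-- The constant 2 is the product of 4, from the pointwise bound, and 1/2, from the area. The
maximum with 1 keeps the constant positive, because `b` may be negative when Ω is empty. -/
theorem CoeffBounds.setIntegral_sq_le {T : Mesh Ω} {ρ : Plane → ℝ} {a b : ℝ}
    (h : CoeffBounds T ρ a b) {t e : Finset Plane} (ht : t ∈ T.tri) (he : e ∈ T.edges)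
    (het : e ⊆ t) {c : P1} {g : ℝ} (hg : ∀ x ∈ hull e, c.eval x = g)
    (hc : ∑ x ∈ t, c.eval x = 0) :
    ∫ x in hull t, ρ x * (c.eval x * c.eval x)
      ≤ 2 * max b 1 * T.size * (edgeLength e * (g * g)) := by
  have hb : 0 < max b 1 := lt_max_of_lt_right one_pos
  calc ∫ x in hull t, ρ x * (c.eval x * c.eval x)
      ≤ ∫ _ in hull t, max b 1 * (4 * g ^ 2) := by
        refine setIntegral_mono_on_ae
          (h.integrableOn ht (c.continuous_eval.mul c.continuous_eval))
          (integrableOn_const (isCompact_hull t).measure_lt_top.ne) (measurableSet_hull t) ?_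
        filter_upwards [(ae_restrict_iff' (measurableSet_hull t)).1 (h.bound t ht)] with x hx hxt
        have h1 := hx hxt
        rw [← sq]
        exact mul_le_mul (h1.2.trans (le_max_left _ _)) (T.sq_eval_le ht he het hg hc hxt)
          (sq_nonneg _) hb.le
    _ = volume.real (hull t) * (max b 1 * (4 * g ^ 2)) := by simp
    _ ≤ edgeLength e * T.size / 2 * (max b 1 * (4 * g ^ 2)) :=
        mul_le_mul_of_nonneg_right (T.volume_le ht he het) (by positivity)
    _ = _ := by ring

/-- A charging argument: each positive term is charged to a related element of `U`, and no element
of `U` is charged twice. -/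
theorem sum_le_sum_of_rel {α β : Type*} {S : Finset α} {U : Finset β} (R : α → β → Prop)
    {f : α → ℝ} {g : β → ℝ} (hg : ∀ e ∈ U, 0 ≤ g e)
    (h : ∀ i ∈ S, f i ≤ 0 ∨ ∃ e ∈ U, R i e ∧ f i ≤ g e)
    (huniq : ∀ e ∈ U, ∀ i ∈ S, ∀ j ∈ S, R i e → R j e → i = j) : ∑ i ∈ S, f i ≤ ∑ e ∈ U, g e := by
  classical
  calc ∑ i ∈ S, f i ≤ ∑ i ∈ S, ∑ e ∈ U, if R i e then g e else 0 := by
        refine Finset.sum_le_sum fun i hi => ?_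
        have hnn : ∀ e ∈ U, 0 ≤ if R i e then g e else 0 := fun e he => by
          split
          · exact hg e he
          · exact le_rfl
        rcases h i hi with h0 | ⟨e, he, hR, hle⟩
        · exact h0.trans (Finset.sum_nonneg hnn)
        · refine le_trans ?_ (Finset.single_le_sum hnn he)
          rwa [if_pos hR]
    _ = ∑ e ∈ U, ∑ i ∈ S, if R i e then g e else 0 := Finset.sum_comm
    _ ≤ ∑ e ∈ U, g e := by
        refine Finset.sum_le_sum fun e he => ?_
        rw [← Finset.sum_filter, Finset.sum_const, nsmul_eq_mul]
        refine mul_le_of_le_one_left (hg e he) ?_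
        have : (S.filter fun i => R i e).card ≤ 1 := Finset.card_le_one.2 fun i hi j hj =>
          huniq e he i (Finset.mem_filter.1 hi).1 j (Finset.mem_filter.1 hj).1
            (Finset.mem_filter.1 hi).2 (Finset.mem_filter.1 hj).2
        exact_mod_cast this

namespace TwoLevelMesh

variable {M : TwoLevelMesh Ω} {κ ρ : Plane → ℝ} {a b a' b' : ℝ} {K E e : Finset Plane}

/-- A function supported near the edges in `E_p` vanishes on a fine element of `K` without an edge
in the edge `E` of `K`. -/
theorem IsEdgePressure.eq_zero {q : M.BrokenP1} {g : M.Cell → Plane → ℝ}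
    (h : M.IsEdgePressure E q g) (hK : K ∈ M.coarse) (hE : E ∈ M.Ep) (hEK : ¬ E ⊆ K) {τ : M.Cell}
    (hτ : τ ∈ M.cells K) : q τ = 0 :=
  h.2.1 τ fun _ he heτ => hEK (M.edge_subset_of_cell hK hE he hτ heτ)

theorem piB_apply (B : M.MultiscaleBasis κ ρ) (s : M.Selection) (q : M.BrokenP1)
    (hK : K ∈ M.coarse) (E : M.Ep0) (hEK : E.1 ⊆ K) {τ : M.Cell} (hτ : τ ∈ M.cells K) :
    piB B s q τ = coeffB0 E q • (B.edge E).p1 τ + ∑ j : Fin (M.numEdge E.1),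
      if (j : ℕ) < s.n E then coeffB B E q j • (B.edge E).p2 j τ else 0 := by
  unfold piB
  rw [Finset.sum_apply, Finset.sum_eq_single E]
  · rw [Pi.add_apply, Finset.sum_apply, Pi.smul_apply]
    congr 1
    refine Finset.sum_congr rfl fun j _ => ?_
    split <;> simp
  · intro E' _ hne
    have hE'K : ¬ E'.1 ⊆ K := fun h => hne (Subtype.ext
      (M.coarse_edge_unique hK (M.mem_Ep0.1 E'.2).1 (M.mem_Ep0.1 E.2).1 h hEK))
    have hE' := (M.mem_Ep0.1 E'.2).1
    rw [Pi.add_apply, Finset.sum_apply, Pi.smul_apply,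
      (B.edge E').p1_spec.eq_zero hK hE' hE'K hτ, smul_zero, zero_add]
    refine Finset.sum_eq_zero fun j _ => ?_
    split
    · rw [Pi.smul_apply, ((B.edge E').p2_spec j).eq_zero hK hE' hE'K hτ, smul_zero]
    · rfl
  · simp

theorem piB_apply_eq_zero (B : M.MultiscaleBasis κ ρ) (s : M.Selection) (q : M.BrokenP1)
    (hK : K ∈ M.coarse) (h : ∀ E ∈ M.Ep0, ¬ E ⊆ K) {τ : M.Cell} (hτ : τ ∈ M.cells K) :
    piB B s q τ = 0 := by
  unfold piB
  rw [Finset.sum_apply]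
  refine Finset.sum_eq_zero fun E _ => ?_
  have hE := (M.mem_Ep0.1 E.2).1
  rw [Pi.add_apply, Finset.sum_apply, Pi.smul_apply,
    (B.edge E).p1_spec.eq_zero hK hE (h _ E.2) hτ, smul_zero, zero_add]
  refine Finset.sum_eq_zero fun j _ => ?_
  split
  · rw [Pi.smul_apply, ((B.edge E).p2_spec j).eq_zero hK hE (h _ E.2) hτ, smul_zero]
  · rfl

theorem sum_vertices_of_mem_QhTilde {q : M.BrokenP1} (hq : q ∈ M.QhTilde) (τ : M.Cell) :
    ∑ x ∈ τ.1, (q τ).eval x = 0 :=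
  M.Th.sum_vertices_eq_zero τ.2 (hq.2.2.1 τ)

/-- The error on a fine element with an edge in `E`. -/
theorem sub_piB_eval (B : M.MultiscaleBasis κ ρ) (s : M.Selection) {q : M.BrokenP1}
    (hq : q ∈ M.QhTilde) (hK : K ∈ M.coarse) (E : M.Ep0) (hEK : E.1 ⊆ K) {τ : M.Cell}
    (hτ : τ ∈ M.cells K) (he : e ∈ M.fineOn E.1) (heτ : e ⊆ τ.1) {x : Plane} (hx : x ∈ hull e) :
    ((q - piB B s q) τ).eval x = ∑ j ∈ Finset.univ.filter
      (fun j : Fin (M.numEdge E.1) => ¬ (j : ℕ) < s.n E),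
        coeffB B E q j * (B.edge E).delta j e := by
  have hE := (M.mem_Ep0.1 E.2).1
  rw [← sub_sum_head (s.n E) _ (edgeValue_expansion B E hq he), Pi.sub_apply,
    piB_apply B s q hK E hEK hτ, P1.eval_sub, P1.eval_add, P1.eval_smul, P1.eval_sum,
    eval_eq_edgeValue hq (fineOn_subset_fineEp0 E.2 he) heτ hx,
    (B.edge E).p1_spec.2.2 e he τ (M.mem_cellsAt.2 heτ) x hx, mul_one, sub_sub]
  congr 2
  refine Finset.sum_congr rfl fun j _ => ?_
  split
  · rw [P1.eval_smul, ((B.edge E).p2_spec j).2.2 e he τ (M.mem_cellsAt.2 heτ) x hx]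
    exact congrArg _ ((B.edge E).inner_eq_delta hE j he heτ hx)
  · exact P1.eval_zero x

/-- The zero vertex sum, which is the form of mean zero used in the triangle estimate, is linear and
so passes from the basis functions to the error. -/
theorem sum_vertices_sub_piB (B : M.MultiscaleBasis κ ρ) (s : M.Selection) {q : M.BrokenP1}
    (hq : q ∈ M.QhTilde) (hK : K ∈ M.coarse) (E : M.Ep0) (hEK : E.1 ⊆ K) {τ : M.Cell}
    (hτ : τ ∈ M.cells K) : ∑ x ∈ τ.1, ((q - piB B s q) τ).eval x = 0 := by
  have h1 := sum_vertices_of_mem_QhTilde hq τ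
  have h2 := sum_vertices_of_mem_QhTilde (B.edge E).p1_spec.1 τ
  have h3 := fun j => sum_vertices_of_mem_QhTilde ((B.edge E).p2_spec j).1 τ
  simp_rw [Pi.sub_apply, piB_apply B s q hK E hEK hτ, P1.eval_sub, P1.eval_add, P1.eval_smul,
    P1.eval_sum]
  rw [Finset.sum_sub_distrib, Finset.sum_add_distrib, h1, ← Finset.mul_sum, h2, Finset.sum_comm,
    Finset.sum_eq_zero]
  · ring
  · intro j _
    split
    · simp_rw [P1.eval_smul]
      rw [← Finset.mul_sum, h3, mul_zero]
    · simp_rw [P1.eval_zero]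
      exact Finset.sum_const_zero

theorem QhTilde_apply_eq_zero {q : M.BrokenP1} (hq : q ∈ M.QhTilde) (hK : K ∈ M.coarse)
    (hE : E ∈ M.Ep) (hEK : E ⊆ K) {τ : M.Cell} (hτ : τ ∈ M.cells K)
    (h : ∀ e ∈ M.fineOn E, ¬ e ⊆ τ.1) : q τ = 0 := by
  refine hq.1 τ fun e he heτ => ?_
  obtain ⟨E', hE', he'⟩ := M.mem_fineEp.1 he
  have := M.coarse_edge_unique hK hE hE' hEK (M.edge_subset_of_cell hK hE' he' hτ heτ)
  exact h e (this ▸ he') heτ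

theorem setIntegral_eq_zero_of_apply_eq_zero {r : M.BrokenP1} {τ : M.Cell} (h : r τ = 0) :
    ∫ x in hull τ.1, ρ x * ((r τ).eval x * (r τ).eval x) = 0 := by
  simp [h, P1.eval_zero]

variable {T : ℝ} {f : ℝ → Plane → ℝ} {v v' : ℝ → M.BrokenRT} {pI pI' pB pB' : ℝ → M.BrokenP1}

/-- The error of the interpolant on a coarse element with an edge in `E_p^0`. -/
theorem piB_error_of_edge (hΩ : interior (closure Ω) = Ω) (hκ : CoeffBounds M.Th κ a b)
    (hρ : CoeffBounds M.Th ρ a' b') (B : M.MultiscaleBasis κ ρ) (s : M.Selection)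
    (h : M.IsReferenceSolution κ ρ T f v v' pI pI' pB pB') {t : ℝ} (ht : t ∈ Icc 0 T)
    (hK : K ∈ M.coarse) (E : M.Ep0) (hEK : E.1 ⊆ K) :
    M.rhoForm (M.cells K) ρ (pB t - piB B s (pB t)) (pB t - piB B s (pB t)) ≤
      2 * max b' 1 * M.Th.size * (nextInv (B.edge E).ev (s.n E)
        * M.kappaForm (M.cells K) κ (v' t) (v' t)) := by
  have hE := (M.mem_Ep0.1 E.2).1
  have hq := (h.pB_mem t ht).1
  have hC : 0 ≤ 2 * max b' 1 * M.Th.size :=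
    mul_nonneg (mul_nonneg two_pos.le (one_pos.le.trans (le_max_right _ _))) M.Th.size_nonneg
  obtain ⟨σ, hσ, hv⟩ := h.local_edge hΩ ht B hK E hEK
  have hcoef : ∑ j ∈ Finset.univ.filter (fun j : Fin (M.numEdge E.1) => ¬ (j : ℕ) < s.n E),
      coeffB B E (pB t) j ^ 2
        ≤ nextInv (B.edge E).ev (s.n E) * M.kappaForm (M.cells K) κ (v' t) (v' t) :=
    sum_tail_sq_le (kappaBilin hκ (M.cells K)) (fun x => kappaForm_nonneg hκ _ x)
      (fun x y => kappaForm_symm _ x y) (kappaBilin hκ (M.patch E.1))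
      (fun x => kappaForm_mono hκ (cells_subset_patch hK hEK) x) (B.edge E).ev
      ((B.edge E).ev_pos hκ) (B.edge E).ordered (s.n E) (B.edge E).φ
      ((B.edge E).kappaForm_φ hκ) (v' t) _ hσ hv
  refine le_trans ?_ (mul_le_mul_of_nonneg_left hcoef hC)
  rw [← sum_weighted_sq (M.fineOn E.1) edgeLength (B.edge E).delta
    ((B.edge E).delta_orthonormal hE), Finset.mul_sum]
  -- Each fine triangle of `K` is charged to one of its fine edges in `E`. Such an edge has only one
  -- triangle in `K`, and triangles without such an edge contribute nothing.
  refine sum_le_sum_of_rel (fun τ e => e ⊆ τ.1) ?_ ?_ ?_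
  · exact fun e he => mul_nonneg hC
      (mul_nonneg (edgeLength_pos (M.mem_fineOn.1 he).1).le (mul_self_nonneg _))
  · intro τ hτ
    by_cases hex : ∃ e ∈ M.fineOn E.1, e ⊆ τ.1
    · obtain ⟨e, he, heτ⟩ := hex
      exact Or.inr ⟨e, he, heτ, hρ.setIntegral_sq_le τ.2 (M.mem_fineOn.1 he).1 heτ
        (fun x hx => sub_piB_eval B s hq hK E hEK hτ he heτ hx)
        (sum_vertices_sub_piB B s hq hK E hEK hτ)⟩
    · push Not at hex
      refine Or.inl (setIntegral_eq_zero_of_apply_eq_zero ?_).le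
      rw [Pi.sub_apply, piB_apply B s _ hK E hEK hτ, QhTilde_apply_eq_zero hq hK hE hEK hτ hex,
        (B.edge E).p1_spec.2.1 τ hex, Finset.sum_eq_zero]
      · simp
      · intro j _
        rw [((B.edge E).p2_spec j).2.1 τ hex]
        simp
  · exact fun e he τ hτ τ' hτ' => M.cell_unique_of_fineOn hK hE hEK he hτ hτ'

/-- The error of the interpolant on a coarse element without an edge in `E_p^0`. -/
theorem piB_error_of_no_edge (hρ : CoeffBounds M.Th ρ a' b') (B : M.MultiscaleBasis κ ρ)
    (s : M.Selection) {q : M.BrokenP1} (hq : q ∈ M.QhTilde0) (hK : K ∈ M.coarse)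
    (hno : ∀ E ∈ M.Ep0, ¬ E ⊆ K) :
    M.rhoForm (M.cells K) ρ (q - piB B s q) (q - piB B s q) ≤ 0 := by
  refine Finset.sum_nonpos fun τ hτ => ?_
  have hr : (q - piB B s q) τ = q τ := by
    rw [Pi.sub_apply, piB_apply_eq_zero B s q hK hno hτ, sub_zero]
  beta_reduce
  by_cases hex : ∃ e ∈ M.fineEp, e ⊆ τ.1
  · obtain ⟨e, he, heτ⟩ := hex
    obtain ⟨E, hE, heE⟩ := M.mem_fineEp.1 he
    have hfr : hull E ⊆ frontier Ω := by
      by_contra hfr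
      exact hno E (M.mem_Ep0.2 ⟨hE, hfr⟩) (M.edge_subset_of_cell hK hE heE hτ heτ)
    obtain ⟨hedge, hsub⟩ := M.mem_fineOn.1 heE
    rw [hr]
    -- The edge lies on the boundary of Ω, where the pressure vanishes. With edge value and mean
    -- both zero the affine function contributes nothing.
    refine (hρ.setIntegral_sq_le τ.2 hedge heτ (g := 0)
      (hq.2 e he (hsub.trans hfr) τ (M.mem_cellsAt.2 heτ))
      (sum_vertices_of_mem_QhTilde hq.1 τ)).trans ?_
    simp
  · push Not at hex
    exact (setIntegral_eq_zero_of_apply_eq_zero (hr.trans (hq.1.1 τ hex))).le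

/-- The error of the interpolant of the component in the additional pressure space. -/
theorem piB_error (hΩ : interior (closure Ω) = Ω) (hκ : CoeffBounds M.Th κ a b)
    (hρ : CoeffBounds M.Th ρ a' b') (B : M.MultiscaleBasis κ ρ) (s : M.Selection)
    (h : M.IsReferenceSolution κ ρ T f v v' pI pI' pB pB') {t : ℝ} (ht : t ∈ Icc 0 T) :
    M.normQsq ρ (pB t - piB B s (pB t)) ≤
      2 * max b' 1 * M.Th.size * (⨆ E : M.Ep0, nextInv (B.edge E).ev (s.n E))
        * M.normVsq κ (v' t) := by
  have hC : 0 ≤ 2 * max b' 1 * M.Th.size :=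
    mul_nonneg (mul_nonneg two_pos.le (one_pos.le.trans (le_max_right _ _))) M.Th.size_nonneg
  have hΛ : 0 ≤ ⨆ E : M.Ep0, nextInv (B.edge E).ev (s.n E) :=
    Real.iSup_nonneg fun E => nextInv_nonneg ((B.edge E).ev_pos hκ) _
  have e1 : M.normQsq ρ (pB t - piB B s (pB t)) = ∑ K : M.coarse,
    M.rhoForm (M.cells K.1) ρ (pB t - piB B s (pB t)) (pB t - piB B s (pB t)) := sum_cells _
  have e2 : M.normVsq κ (v' t) = ∑ K : M.coarse, M.kappaForm (M.cells K.1) κ (v' t) (v' t) :=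
    sum_cells _
  rw [e1, e2, Finset.mul_sum]
  refine Finset.sum_le_sum fun K _ => ?_
  have hv0 := kappaForm_nonneg hκ (M.cells K.1) (v' t)
  -- At most one edge belongs to each element, and its bound involves the energy on that element
  -- alone, so summation produces no overlap factor.
  by_cases hex : ∃ E ∈ M.Ep0, E ⊆ K.1
  · obtain ⟨E, hE, hEK⟩ := hex
    refine (piB_error_of_edge hΩ hκ hρ B s h ht K.2 ⟨E, hE⟩ hEK).trans ?_
    rw [mul_assoc _ (⨆ E : M.Ep0, nextInv (B.edge E).ev (s.n E))]
    refine mul_le_mul_of_nonneg_left (mul_le_mul_of_nonneg_right ?_ hv0) hC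
    exact le_ciSup (f := fun E : M.Ep0 => nextInv (B.edge E).ev (s.n E))
      (Set.finite_range _).bddAbove ⟨E, hE⟩
  · push Not at hex
    exact (piB_error_of_no_edge hρ B s (h.pB_mem t ht) K.2 hex).trans
      (mul_nonneg (mul_nonneg hC hΛ) hv0)

end TwoLevelMesh

end

end MGMsFEM

end

/-! ### The theorem, with a constant depending only on the upper bound of ρ -/

theorem mainTheorem4 (Ω : Set MGMsFEM.Plane) (hΩ : interior (closure Ω) = Ω)
    (κ ρ : MGMsFEM.Plane → ℝ) (hκ : MGMsFEM.IsCoefficient Ω κ) (hρ : MGMsFEM.IsCoefficient Ω ρ) :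
    ∃ c : ℝ, 0 < c ∧
      ∀ (M : MGMsFEM.TwoLevelMesh Ω) (B : M.MultiscaleBasis κ ρ) (s : M.Selection)
        (T : ℝ) (_ : 0 < T) (f : ℝ → MGMsFEM.Plane → ℝ)
        (_ : ∀ t ∈ Set.Icc 0 T, MeasureTheory.IntegrableOn (f t) Ω)
        (v v' : ℝ → M.BrokenRT) (pI pI' pB pB' : ℝ → M.BrokenP1)
        (_ : M.IsReferenceSolution κ ρ T f v v' pI pI' pB pB'),
        ∀ t ∈ Set.Icc 0 T,
          M.normQsq ρ (pI t - MGMsFEM.TwoLevelMesh.piI B s (pI t)) ≤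
              (⨆ K : M.coarse, MGMsFEM.TwoLevelMesh.nextInv (B.elt K).μ (s.m K))
                * M.normVsq κ (v' t) ∧
          M.normQsq ρ (pB t - MGMsFEM.TwoLevelMesh.piB B s (pB t)) ≤
              c * M.Th.size
                * (⨆ E : M.Ep0, MGMsFEM.TwoLevelMesh.nextInv (B.edge E).ev (s.n E))
                * M.normVsq κ (v' t) := by
  obtain ⟨a, b, hκ'⟩ := hκ.exists_bounds hΩ
  obtain ⟨a', b', hρ'⟩ := hρ.exists_bounds hΩ
  refine ⟨2 * max b' 1, mul_pos two_pos (lt_max_of_lt_right one_pos), ?_⟩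
  intro M B s T _ f _ v v' pI pI' pB pB' h t ht
  exact ⟨MGMsFEM.TwoLevelMesh.piI_error hΩ (hκ' M.Th) B s h ht,
    MGMsFEM.TwoLevelMesh.piB_error hΩ (hκ' M.Th) (hρ' M.Th) B s h ht⟩
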